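/- Let $F:[0,1]^2\to\mathbb R^3$ be an injective piecewise-linear map, i.e. an injective map that is affine on each simplex of some finite triangulation of $[0,1]^2$. Let $\ell$ be a piecewise-linear simple closed curve in $[0,1]^2$, i.e. the image of a map $\gamma:[0,1]\to[0,1]^2$ that is affine on each interval of some finite subdivision of $[0,1]$, with $\gamma(0)=\gamma(1)$ and $\gamma$ injective on $[0,1)$. Then $F(\ell)$ is an unknot: there is an ambient isotopy of $\mathbb R^3$, i.e. a continuous map $H:[0,1]\times\mathbb R^3\to\mathbb R^3$ such that every $H_t=H(t,\cdot)$ is a homeomorphism of $\mathbb R^3$, $H_0=\mathrm{id}$, and $H_1(F(\ell))=\{(x,y,z): x^2+y^2=1,\ z=0\}$. -/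

import Mathlib

/-- `f` is piecewise linear on `S`: there is a finite simplicial complex (a triangulation)
with underlying space `S` such that `f` is affine on each of its closed simplices.
Such a map is automatically continuous on `S`. -/
def IsPLOn {E F : Type*} [AddCommGroup E] [Module ℝ E] [AddCommGroup F] [Module ℝ F]
    (f : E → F) (S : Set E) : Prop :=
  ∃ K : Geometry.SimplicialComplex ℝ E, K.faces.Finite ∧ K.space = S ∧
    ∀ s ∈ K.faces, ∃ g : E →ᵃ[ℝ] F, Set.EqOn f g (convexHull ℝ (s : Set E))

/-- The restriction of `γ` to `[0,1]` is a piecewise linear simple closed curve, i.e. a piecewise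
linear embedding of the circle `[0,1]/(0 ~ 1)`. -/
structure IsPLSimpleClosedCurve {E : Type*} [AddCommGroup E] [Module ℝ E] (γ : ℝ → E) :
    Prop where
  pl : IsPLOn γ (Set.Icc (0 : ℝ) 1)
  closed : γ 0 = γ 1
  simple : Set.InjOn γ (Set.Ico (0 : ℝ) 1)

/-- The closed unit square `[0,1]²` in the plane. -/
def unitSquare : Set (EuclideanSpace ℝ (Fin 2)) :=
  {p | ∀ i, p i ∈ Set.Icc (0 : ℝ) 1}

/-- There is an ambient isotopy of `X` (a continuous family of homeomorphisms `H t` of `X`,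
`t ∈ [0,1]`, with `H 0 = id`) carrying `K` onto `L`. -/
def AmbientIsotopic {X : Type*} [TopologicalSpace X] (K L : Set X) : Prop :=
  ∃ H : unitInterval × X → X, Continuous H ∧
    (∀ t, IsHomeomorph fun x => H (t, x)) ∧
    (∀ x, H (0, x) = x) ∧
    (fun x => H (1, x)) '' K = L

/-- The round unit circle in the plane `z = 0` of three-space. -/
def standardCircle : Set (EuclideanSpace ℝ (Fin 3)) :=
  {x | x 0 ^ 2 + x 1 ^ 2 = 1 ∧ x 2 = 0}

/-- `K` is an unknot: it is ambient isotopic to the standard round circle. -/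
def IsUnknot (K : Set (EuclideanSpace ℝ (Fin 3))) : Prop :=
  AmbientIsotopic K standardCircle

open Set Filter Topology

/-! A polygon in the square bounds a disc made of triangles. Its image is shrunk across the image of
that disc, one triangle at a time, until it is the boundary of a flat triangle in space, which is
visibly unknotted (`isUnknot_triangle`).

The elementary move is `ambientIsotopicRel_triangle`: two sides of a flat triangle in three-space
are pushed across it onto the third side, while a closed set meeting the triangle at most in the
ends of that side stays fixed. The rest of the curve can be put into this closed set because `F` is
injective.

`F` need not be affine on a given triangle of the domain. The triangle is cut along finitely many
lines until every piece lies in one simplex of the triangulation, and the moves on the pieces are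
composed (`IsTameTriangle.of_cut`, `isTameTriangle_of_functionals`).

For polygons, the Jordan and Schoenflies theorems are replaced by an induction on the number of
vertices (`exists_isSweptRegion`). Take an extreme vertex `b` with neighbours `a`, `c`. If the
polygon is not itself the triangle `bac`, then either that triangle is an ear, or some diagonal `bw`
inside it splits the polygon (`PolyArc.exists_diagonal`). In both cases regions of polygons with
fewer vertices are glued along a chord (`isSweptRegion_glue`): one arc is swept across its region
onto the chord, and the chord is then swept across the other region. The inductive statement
`IsSweptRegion` records sweeping onto every edge, because the edge that will serve as chord is not
known in advance.

Gluing needs two planar facts. The regions overlap only in the chord, since otherwise a linear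
functional would attain a maximum over the overlap at an interior point
(`inter_subset_of_boundary_disjoint`). Each arc stays outside the other region, since a connected
set missing the boundary cannot pass from outside to inside (`IsPreconnected.disjoint_of_frontier`).
-/

/-- An ambient isotopy from `K` onto `L` that fixes every point of `R` throughout. -/
def AmbientIsotopicRel {X : Type*} [TopologicalSpace X] (R K L : Set X) : Prop :=
  ∃ H : unitInterval × X → X, Continuous H ∧
    (∀ t, IsHomeomorph fun x => H (t, x)) ∧
    (∀ x, H (0, x) = x) ∧ (∀ t, ∀ x ∈ R, H (t, x) = x) ∧
    (fun x => H (1, x)) '' K = L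

/-! ### Calculus of isotopies relative to a fixed set -/

namespace AmbientIsotopicRel

variable {X Y : Type*} [TopologicalSpace X] [TopologicalSpace Y] {R K L M A : Set X}

theorem ambientIsotopic (h : AmbientIsotopicRel R K L) : AmbientIsotopic K L := by
  obtain ⟨H, h1, h2, h3, -, h5⟩ := h
  exact ⟨H, h1, h2, h3, h5⟩

theorem of_ambientIsotopic (h : AmbientIsotopic K L) : AmbientIsotopicRel ∅ K L := by
  obtain ⟨H, h1, h2, h3, h5⟩ := h
  exact ⟨H, h1, h2, h3, by simp, h5⟩

theorem mono {R' : Set X} (h : AmbientIsotopicRel R K L) (hR : R' ⊆ R) :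
    AmbientIsotopicRel R' K L := by
  obtain ⟨H, h1, h2, h3, h4, h5⟩ := h
  exact ⟨H, h1, h2, h3, fun t x hx => h4 t x (hR hx), h5⟩

theorem trans (h : AmbientIsotopicRel R K L) (h' : AmbientIsotopicRel R L M) :
    AmbientIsotopicRel R K M := by
  obtain ⟨H, h1, h2, h3, h4, h5⟩ := h
  obtain ⟨G, g1, g2, g3, g4, g5⟩ := h'
  -- The two isotopies run simultaneously, as `G_t ∘ H_t`, so no concatenation in time is needed.
  refine ⟨fun p => G (p.1, H p), by fun_prop, fun t => (g2 t).comp (h2 t), fun x => ?_,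
    fun t x hx => ?_, ?_⟩
  · simp [h3, g3]
  · simp [h4 t x hx, g4 t x hx]
  · rw [← g5, ← h5, image_image]

theorem symm (h : AmbientIsotopicRel R K L) : AmbientIsotopicRel R L K := by
  obtain ⟨H, h1, h2, h3, h4, h5⟩ := h
  set e : X ≃ₜ X := (h2 1).homeomorph with he
  have hea : ∀ x, e x = H (1, x) := fun x => rfl
  -- The reversed isotopy is `H_{1-t} ∘ H_1⁻¹`, which starts at the identity and ends at `H_1⁻¹`.
  refine ⟨fun p => H (unitInterval.symm p.1, e.symm p.2), ?_, fun t => ?_, fun x => ?_,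
    fun t x hx => ?_, ?_⟩
  · have := unitInterval.continuous_symm
    fun_prop
  · exact (h2 (unitInterval.symm t)).comp e.symm.isHomeomorph
  · have := e.apply_symm_apply x
    rw [hea] at this
    simpa using this
  · have hx' : e.symm x = x := by
      rw [Homeomorph.symm_apply_eq, hea, h4 1 x hx]
    simp [hx', h4 _ x hx]
  · rw [← h5, image_image]
    simp only [unitInterval.symm_one, h3, ← hea]
    simp

/-- This turns a local move into a move of the whole curve: the part of the curve not being moved is
placed in the fixed set. -/
theorem union (h : AmbientIsotopicRel R K L) (hA : A ⊆ R) :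
    AmbientIsotopicRel R (K ∪ A) (L ∪ A) := by
  obtain ⟨H, h1, h2, h3, h4, h5⟩ := h
  refine ⟨H, h1, h2, h3, h4, ?_⟩
  rw [image_union, h5]
  congr 1
  exact (image_congr fun x hx => h4 1 x (hA hx)).trans (image_id _)

theorem image (h : AmbientIsotopicRel R K L) (e : X ≃ₜ Y) :
    AmbientIsotopicRel (e '' R) (e '' K) (e '' L) := by
  obtain ⟨H, h1, h2, h3, h4, h5⟩ := h
  refine ⟨fun p => e (H (p.1, e.symm p.2)), by fun_prop, fun t => ?_, fun x => by simp [h3], ?_, ?_⟩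
  · exact e.isHomeomorph.comp ((h2 t).comp e.symm.isHomeomorph)
  · rintro t _ ⟨x, hx, rfl⟩
    simp [h4 t x hx]
  · simp [← h5, image_image]

end AmbientIsotopicRel

/-! ### The triangle move in three-space -/

/-- Bounded distance from the identity makes preimages of bounded sets bounded, so the map is proper
and hence closed; a continuous closed bijection is a homeomorphism. -/
theorem isHomeomorph_of_norm_sub_le {X : Type*} [NormedAddCommGroup X] [ProperSpace X]
    {f : X → X} (hf : Continuous f) (hb : Function.Bijective f) {C : ℝ}
    (hC : ∀ x, ‖f x - x‖ ≤ C) : IsHomeomorph f := by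
  rw [isHomeomorph_iff_continuous_isClosedMap_bijective]
  refine ⟨hf, ?_, hb⟩
  have : IsProperMap f := by
    rw [isProperMap_iff_tendsto_cocompact]
    refine ⟨hf, ?_⟩
    rw [← Metric.cobounded_eq_cocompact, ← tendsto_norm_atTop_iff_cobounded]
    have h1 : Tendsto (fun x : X => ‖x‖ - C) (Bornology.cobounded X) atTop :=
      tendsto_atTop_add_const_right _ _ tendsto_norm_cobounded_atTop
    refine tendsto_atTop_mono (fun x => ?_) h1
    have h2 := norm_sub_norm_le x (f x)
    have h3 := hC x
    rw [norm_sub_rev] at h3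
    linarith
  exact this.isClosedMap

/-- A bounded vertical displacement which is strictly contracting from above is an isotopy. -/
theorem ambientIsotopicRel_of_displacement {Q : Type*} [NormedAddCommGroup Q] [ProperSpace Q]
    (φ : Q × ℝ → ℝ) (hφ : Continuous φ) (C : ℝ) (hC : ∀ x, |φ x| ≤ C)
    (hmono : ∀ q y₁ y₂, y₁ < y₂ → φ (q, y₂) - φ (q, y₁) < y₂ - y₁)
    {R : Set (Q × ℝ)} (hR : ∀ x ∈ R, φ x = 0) (K : Set (Q × ℝ)) :
    AmbientIsotopicRel R K ((fun x => (x.1, x.2 - φ x)) '' K) := by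
  refine ⟨fun p => (p.2.1, p.2.2 - p.1 * φ p.2), by fun_prop, fun t => ?_, by simp, ?_, by simp⟩
  · obtain ⟨t, ht0, ht1⟩ := t
    -- On each vertical line the map is strictly increasing and at bounded distance from the
    -- identity, hence a bijection of the line.
    have hsm : ∀ q, StrictMono fun y => y - t * φ (q, y) := by
      intro q y₁ y₂ hy
      have := hmono q y₁ y₂ hy
      dsimp only
      rcases ht0.eq_or_lt with h0 | h0
      · rw [← h0]; linarith
      · nlinarith [mul_lt_mul_of_pos_left this h0, mul_nonneg (sub_nonneg.2 ht1) (sub_pos.2 hy).le]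
    have hbd : ∀ x, |t * φ x| ≤ C := by
      intro x
      rw [abs_mul, abs_of_nonneg ht0]
      have := hC x
      have := abs_nonneg (φ x)
      nlinarith
    refine isHomeomorph_of_norm_sub_le (C := C) (by fun_prop) ⟨?_, ?_⟩ ?_
    · rintro ⟨q, y⟩ ⟨q', y'⟩ h
      simp only [Prod.mk.injEq] at h
      obtain ⟨rfl, h⟩ := h
      rw [(hsm q).injective h]
    · rintro ⟨q, y⟩
      have hc : Continuous fun y => y - t * φ (q, y) := by fun_prop
      have htop : Tendsto (fun y => y - t * φ (q, y)) atTop atTop :=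
        tendsto_atTop_mono (fun y => by rw [id]; linarith [(abs_le.1 (hbd (q, y))).2])
          (tendsto_atTop_add_const_right _ (-C) tendsto_id)
      have hbot : Tendsto (fun y => y - t * φ (q, y)) atBot atBot :=
        tendsto_atBot_mono (fun y => by rw [id]; linarith [(abs_le.1 (hbd (q, y))).1])
          (tendsto_atBot_add_const_right _ C tendsto_id)
      obtain ⟨y', hy'⟩ := hc.surjective htop hbot y
      exact ⟨(q, y'), by simpa using hy'⟩
    · rintro ⟨q, y⟩
      simp only [Prod.mk_sub_mk, sub_self, Prod.norm_mk, norm_zero, Real.norm_eq_abs]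
      rw [sub_sub_cancel_left, abs_neg]
      exact max_le ((abs_nonneg _).trans (hbd (q, y))) (hbd _)
  · intro t x hx
    simp [hR x hx]

/-- Height, above the base, of the model triangle with vertices `-1`, `1` and apex `(0, 1)`. -/
noncomputable def tentHeight (s : ℝ) : ℝ := max 0 (1 - |s|)

theorem continuous_tentHeight : Continuous tentHeight := by
  unfold tentHeight; fun_prop

theorem tentHeight_nonneg (s : ℝ) : 0 ≤ tentHeight s := le_max_left _ _

theorem tentHeight_le_one (s : ℝ) : tentHeight s ≤ 1 :=
  max_le zero_le_one (by linarith [abs_nonneg s])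

theorem tentHeight_pos {s : ℝ} : 0 < tentHeight s ↔ |s| < 1 := by
  simp [tentHeight]

theorem tentHeight_of_le {s : ℝ} (h : |s| ≤ 1) : tentHeight s = 1 - |s| :=
  max_eq_right (by linarith)

/-- A closed set meeting the model triangle in at most two corners leaves room around it. -/
theorem exists_tent_room {R : Set ((ℝ × ℝ) × ℝ)} (hR : IsClosed R)
    (hRT : ∀ s y : ℝ, 0 ≤ y → y ≤ tentHeight s → ((s, 0), y) ∈ R → 1 ≤ |s|) :
    ∃ δ : ℝ → ℝ, Continuous δ ∧ (∀ s, |s| < 1 → 0 < δ s) ∧ ∀ s z y, ((s, z), y) ∈ R →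
      |s| < 1 → δ s ≤ |z| ∨ y ≤ -δ s ∨ tentHeight s + δ s ≤ y := by
  -- Adding the corner `s = 1` makes the set nonempty, since the distance to the empty set would be
  -- the default value 0. The corner does no harm over `|s| < 1`.
  set R' : Set ((ℝ × ℝ) × ℝ) := insert ((1, 0), 0) R with hR'
  have hcl : IsClosed R' := by
    rw [hR', insert_eq]
    exact isClosed_singleton.union hR
  have hne : R'.Nonempty := ⟨_, mem_insert _ _⟩
  obtain ⟨f, hfdef⟩ : ∃ f : ℝ → ℝ → ℝ, ∀ s u, f s u =
    Metric.infDist (((s, 0), u * tentHeight s) : (ℝ × ℝ) × ℝ) R' := ⟨_, fun _ _ => rfl⟩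
  have hf : Continuous ↿f := by
    have := continuous_tentHeight
    have h2 : Continuous fun p : ℝ × ℝ => (((p.1, 0), p.2 * tentHeight p.1) : (ℝ × ℝ) × ℝ) := by
      fun_prop
    change Continuous fun p : ℝ × ℝ => f p.1 p.2
    simp only [hfdef]
    exact (Metric.continuous_infDist_pt R').comp h2
  have hfs : ∀ s, Continuous (f s) := fun s => hf.comp (by fun_prop : Continuous fun u => (s, u))
  have hbdd : ∀ s, BddBelow (f s '' Icc 0 1) := fun s => (isCompact_Icc.image (hfs s)).bddBelow
  -- `δ s` is the distance from the vertical slice of the triangle over `s` to `R'`. The slice is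
  -- parametrised by the fixed interval `[0,1]`, which makes the infimum continuous in `s`.
  refine ⟨fun s => sInf (f s '' Icc 0 1), isCompact_Icc.continuous_sInf hf, fun s hs => ?_,
    fun s z y hmem hs => ?_⟩
  · obtain ⟨u, hu, h⟩ := isCompact_Icc.exists_sInf_image_eq (nonempty_Icc.2 zero_le_one)
      (hfs s).continuousOn
    dsimp only
    rw [h, hfdef]
    refine (hcl.notMem_iff_infDist_pos hne).1 fun hmem => ?_
    have h0 := tentHeight_nonneg s
    rcases hmem with hmem | hmem
    · simp only [Prod.mk.injEq] at hmem
      rw [hmem.1.1] at hs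
      simp at hs
    · exact absurd (hRT _ _ (mul_nonneg hu.1 h0) (by nlinarith [hu.2]) hmem) (not_le.2 hs)
  · by_contra! hcon
    obtain ⟨h1, h2, h3⟩ := hcon
    set δ := sInf (f s '' Icc 0 1)
    have hh := tentHeight_pos.2 hs
    have key : ∀ y', 0 ≤ y' → y' ≤ tentHeight s → δ ≤ |y - y'| := by
      intro y' h0 h1'
      have hle : δ ≤ f s (y' / tentHeight s) :=
        csInf_le (hbdd s) (mem_image_of_mem _ ⟨by positivity, (div_le_one hh).2 h1'⟩)
      have h4 : f s (y' / tentHeight s) ≤ dist (((s, 0), y') : (ℝ × ℝ) × ℝ) ((s, z), y) := by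
        rw [hfdef, div_mul_cancel₀ _ hh.ne']
        exact Metric.infDist_le_dist_of_mem (mem_insert_of_mem _ hmem)
      have h5 := hle.trans h4
      rw [Prod.dist_eq, Prod.dist_eq] at h5
      simp only [dist_self, Real.dist_eq, zero_sub, abs_neg, le_max_iff] at h5
      rcases h5 with (h5 | h5) | h5
      · linarith [abs_nonneg z]
      · linarith
      · rwa [abs_sub_comm]
    rcases le_total y 0 with hy | hy
    · have := key 0 le_rfl hh.le
      rw [sub_zero, abs_of_nonpos hy] at this
      linarith
    · rcases le_total y (tentHeight s) with hy' | hy'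
      · have := key y hy hy'
        rw [sub_self, abs_zero] at this
        linarith [abs_nonneg z]
      · have := key _ hh.le le_rfl
        rw [abs_of_nonneg (by linarith)] at this
        linarith

/-- The profile climbs linearly from 0 at `y = -δ` to `k` at `y = h`, then descends to 0 at `y = h +
δ`. Its rising slope `k / (h + δ)` is below 1 because `k ≤ h`, so subtracting it preserves the order
on a vertical line. -/
theorem tent_profile_sub_lt {k h δ y₁ y₂ : ℝ} (hk : 0 ≤ k) (hkh : k ≤ h) (hδ : 0 < δ)
    (hy : y₁ < y₂) :
    max 0 (min (k * (y₂ + δ) / (h + δ)) (k * (h + δ - y₂) / δ)) -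
      max 0 (min (k * (y₁ + δ) / (h + δ)) (k * (h + δ - y₁) / δ)) < y₂ - y₁ := by
  have hh : 0 < h + δ := by linarith
  have hA : k * (y₂ + δ) / (h + δ) < k * (y₁ + δ) / (h + δ) + (y₂ - y₁) := by
    rw [div_add' _ _ _ hh.ne', div_lt_div_iff_of_pos_right hh]
    nlinarith
  have hB : k * (h + δ - y₂) / δ ≤ k * (h + δ - y₁) / δ := by
    gcongr
  rw [sub_lt_iff_lt_add]
  refine max_lt (by linarith [le_max_left 0 (min (k * (y₁ + δ) / (h + δ)) (k * (h + δ - y₁) / δ))]) ?_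
  rcases le_total (k * (y₁ + δ) / (h + δ)) (k * (h + δ - y₁) / δ) with hc | hc
  · refine (min_le_left _ _).trans_lt ?_
    rw [min_eq_left hc]
    linarith [le_max_right 0 (k * (y₁ + δ) / (h + δ))]
  · refine (min_le_right _ _).trans_lt ?_
    rw [min_eq_right hc]
    linarith [le_max_right 0 (k * (h + δ - y₁) / δ)]

theorem tent_profile_le {k h δ y : ℝ} (hk : 0 ≤ k) (hh : 0 ≤ h) (hδ : 0 < δ) :
    max 0 (min (k * (y + δ) / (h + δ)) (k * (h + δ - y) / δ)) ≤ k := by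
  refine max_le hk ?_
  rcases le_total y h with hy | hy
  · refine (min_le_left _ _).trans ?_
    rw [div_le_iff₀ (by linarith)]
    gcongr
  · refine (min_le_right _ _).trans ?_
    rw [div_le_iff₀ hδ]
    gcongr
    linarith

/-- The triangle move in model coordinates. -/
theorem ambientIsotopicRel_tent {R : Set ((ℝ × ℝ) × ℝ)} (hR : IsClosed R)
    (hRT : ∀ s y : ℝ, 0 ≤ y → y ≤ tentHeight s → ((s, 0), y) ∈ R → 1 ≤ |s|) :
    AmbientIsotopicRel R ((fun s : ℝ => ((s, 0), 1 - |s|)) '' Icc (-1) 1)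
      ((fun s : ℝ => ((s, 0), 0)) '' Icc (-1) 1) := by
  obtain ⟨δ, hδ, hpos, hroom⟩ := exists_tent_room hR hRT
  -- The peak of the displacement: the full height of the triangle in its plane `z = 0`, tapering to
  -- 0 at `|z| = δ`, so that nothing in `R` moves.
  set k : ℝ × ℝ → ℝ := fun q => tentHeight q.1 * max 0 (1 - |q.2| / δ q.1) with hk
  set φ : (ℝ × ℝ) × ℝ → ℝ := fun x => max 0 (min (k x.1 * (x.2 + δ x.1.1) /
    (tentHeight x.1.1 + δ x.1.1)) (k x.1 * (tentHeight x.1.1 + δ x.1.1 - x.2) / δ x.1.1)) with hφ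
  have hk0 : ∀ q : ℝ × ℝ, ¬ |q.1| < 1 → k q = 0 := fun q hq => by
    have : tentHeight q.1 = 0 :=
      le_antisymm (not_lt.1 (mt tentHeight_pos.1 hq)) (tentHeight_nonneg _)
    simp [hk, this]
  have hkn : ∀ q, 0 ≤ k q := fun q => mul_nonneg (tentHeight_nonneg _) (le_max_left _ _)
  have hkh : ∀ q, k q ≤ tentHeight q.1 := fun q => by
    by_cases hq : |q.1| < 1
    · refine mul_le_of_le_one_right (tentHeight_nonneg _) (max_le zero_le_one ?_)
      have := hpos _ hq
      have : 0 ≤ |q.2| / δ q.1 := by positivity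
      linarith
    · rw [hk0 q hq]; exact tentHeight_nonneg _
  have hφ0 : ∀ x : (ℝ × ℝ) × ℝ, ¬ |x.1.1| < 1 → φ x = 0 := fun x hx => by
    simp [hφ, hk0 x.1 hx]
  have hφn : ∀ x, 0 ≤ φ x := fun x => le_max_left _ _
  have hφh : ∀ x, φ x ≤ tentHeight x.1.1 := fun x => by
    by_cases hx : |x.1.1| < 1
    · exact (tent_profile_le (hkn _) (tentHeight_nonneg _) (hpos _ hx)).trans (hkh _)
    · rw [hφ0 x hx]; exact tentHeight_nonneg _
  have hcont : Continuous φ := by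
    have hth := continuous_tentHeight
    rw [continuous_iff_continuousAt]
    intro x
    by_cases hx : |x.1.1| < 1
    · have h1 := hpos _ hx
      have h2 : tentHeight x.1.1 + δ x.1.1 ≠ 0 := by linarith [tentHeight_nonneg x.1.1]
      have hkc : ContinuousAt (fun x : (ℝ × ℝ) × ℝ => k x.1) x := by
        refine ContinuousAt.mul (by fun_prop) (Filter.Tendsto.max continuousAt_const
          (ContinuousAt.sub continuousAt_const (ContinuousAt.div (by fun_prop) (by fun_prop) h1.ne')))
      refine Filter.Tendsto.max continuousAt_const (Filter.Tendsto.min ?_ ?_)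
      · exact (hkc.mul (by fun_prop)).div (by fun_prop) h2
      · exact (hkc.mul (by fun_prop)).div (by fun_prop) h1.ne'
    -- Over `|s| ≥ 1` the room `δ` may vanish and the quotients may break down; continuity comes
    -- from squeezing `φ` between 0 and the height.
    · have h0 : tentHeight x.1.1 = 0 :=
        le_antisymm (not_lt.1 (mt tentHeight_pos.1 hx)) (tentHeight_nonneg _)
      have hc : ContinuousAt (fun x : (ℝ × ℝ) × ℝ => tentHeight x.1.1) x := by fun_prop
      unfold ContinuousAt at hc ⊢
      rw [hφ0 x hx]
      dsimp only at hc
      rw [h0] at hc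
      exact squeeze_zero hφn hφh hc
  have hfix : ∀ x ∈ R, φ x = 0 := by
    rintro ⟨⟨s, z⟩, y⟩ hx
    by_cases hs : |s| < 1
    · have h1 := hpos _ hs
      have h2 : 0 < tentHeight s + δ s := by linarith [tentHeight_nonneg s]
      have h3 := hkn (s, z)
      refine max_eq_left ?_
      rcases hroom s z y hx hs with h | h | h
      · have : k (s, z) = 0 := by
          have : 1 ≤ |z| / δ s := (one_le_div h1).2 h
          simp only [hk]
          rw [max_eq_left (by linarith), mul_zero]
        simp [this]
      · exact (min_le_left _ _).trans (div_nonpos_of_nonpos_of_nonneg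
          (mul_nonpos_of_nonneg_of_nonpos h3 (by linarith)) h2.le)
      · exact (min_le_right _ _).trans (div_nonpos_of_nonpos_of_nonneg
          (mul_nonpos_of_nonneg_of_nonpos h3 (by linarith)) h1.le)
    · exact hφ0 _ hs
  convert ambientIsotopicRel_of_displacement φ hcont 1 (fun x => ?_) (fun q y₁ y₂ hy => ?_) hfix
    ((fun s : ℝ => ((s, 0), 1 - |s|)) '' Icc (-1) 1) using 1
  · rw [image_image]
    refine image_congr fun s hs => ?_
    have hs1 : |s| ≤ 1 := abs_le.2 hs
    -- The two upper sides lie exactly at the peak of the profile, where the displacement equals the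
    -- height.
    suffices φ ((s, 0), 1 - |s|) = 1 - |s| by simp [this]
    rcases hs1.eq_or_lt with h | h
    · rw [hφ0 _ (by simp [h]), h, sub_self]
    · have h1 := hpos _ h
      have h2 : 0 < tentHeight s + δ s := by linarith [tentHeight_nonneg s]
      have h3 := tentHeight_of_le hs1
      have h4 : k (s, 0) = tentHeight s := by simp [hk]
      simp only [hφ, h4, ← h3]
      rw [mul_div_assoc, div_self h2.ne', mul_one, add_sub_cancel_left, mul_div_assoc,
        div_self h1.ne', mul_one, min_self, max_eq_right (tentHeight_nonneg s)]
  · rw [abs_of_nonneg (hφn x)]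
    exact (hφh x).trans (tentHeight_le_one _)
  · by_cases hq : |q.1| < 1
    · exact tent_profile_sub_lt (hkn _) (hkh _) (hpos _ hq) hy
    · rw [hφ0 _ hq, hφ0 _ hq]; linarith

section Triangle

variable {E : Type*} [AddCommGroup E] [Module ℝ E]

theorem mem_convexHull_triple {a b c x : E} : x ∈ convexHull ℝ {a, b, c} ↔
    ∃ α β γ : ℝ, 0 ≤ α ∧ 0 ≤ β ∧ 0 ≤ γ ∧ α + β + γ = 1 ∧ α • a + β • b + γ • c = x := by
  constructor
  · intro h
    rw [convexHull_insert (by simp), convexHull_pair, mem_convexJoin] at h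
    obtain ⟨y, rfl, z, ⟨s, t, hs, ht, hst, rfl⟩, u, v, hu, hv, huv, rfl⟩ := h
    refine ⟨u, v * s, v * t, hu, by positivity, by positivity, ?_, by module⟩
    rw [add_assoc, ← mul_add, hst, mul_one, huv]
  · rintro ⟨α, β, γ, hα, hβ, hγ, h, rfl⟩
    have hc := convex_convexHull ℝ ({a, b, c} : Set E)
    have := hc.sum_mem (t := Finset.univ) (w := ![α, β, γ]) (z := ![a, b, c])
      (by intro i _; fin_cases i <;> assumption) (by simp [Fin.sum_univ_three, h])
      (by intro i _; apply subset_convexHull; fin_cases i <;> simp)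
    simpa [Fin.sum_univ_three] using this

theorem segment_eq_image_abs {a b c m u v : E} (ha : a = m - u) (hc : c = m + u)
    (hb : b = m + v) :
    (fun s : ℝ => m + s • u + (1 - |s|) • v) '' Icc (-1) 1 = segment ℝ a b ∪ segment ℝ b c := by
  subst ha hc hb
  ext x
  constructor
  · rintro ⟨s, hs, rfl⟩
    rcases le_total s 0 with h | h
    · left
      refine ⟨-s, 1 + s, by linarith, by linarith [hs.1], by ring, ?_⟩
      simp only [abs_of_nonpos h]
      module
    · right
      refine ⟨1 - s, s, by linarith [hs.2], h, by ring, ?_⟩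
      simp only [abs_of_nonneg h]
      module
  · rintro (⟨p, q, hp, hq, hpq, rfl⟩ | ⟨p, q, hp, hq, hpq, rfl⟩)
    · refine ⟨-p, ⟨by linarith, by linarith⟩, ?_⟩
      obtain rfl : q = 1 - p := by linarith
      simp only [abs_neg, abs_of_nonneg hp]
      module
    · refine ⟨q, ⟨by linarith, by linarith⟩, ?_⟩
      obtain rfl : p = 1 - q := by linarith
      simp only [abs_of_nonneg hq]
      module

theorem image_Icc_eq_segment {a c m u : E} (ha : a = m - u) (hc : c = m + u) :
    (fun s : ℝ => m + s • u) '' Icc (-1) 1 = segment ℝ a c := by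
  subst ha hc
  ext x
  constructor
  · rintro ⟨s, hs, rfl⟩
    exact ⟨(1 - s) / 2, (1 + s) / 2, by linarith [hs.2], by linarith [hs.1], by ring, by module⟩
  · rintro ⟨p, q, hp, hq, hpq, rfl⟩
    refine ⟨q - p, ⟨by linarith, by linarith⟩, ?_⟩
    obtain rfl : p = 1 - q := by linarith
    module

end Triangle

/-- Affine coordinates of three-space adapted to two independent directions. -/
theorem exists_affine_coordinates (m u v : EuclideanSpace ℝ (Fin 3))
    (h : LinearIndependent ℝ ![u, v]) :
    ∃ (w : EuclideanSpace ℝ (Fin 3)) (Φ : ((ℝ × ℝ) × ℝ) ≃ₜ EuclideanSpace ℝ (Fin 3)),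
      ∀ s z y, Φ ((s, z), y) = m + s • u + z • w + y • v := by
  obtain ⟨w, hw⟩ := exists_linearIndependent_snoc_of_lt_finrank h (by simp)
  have hw' : LinearIndependent ℝ ![u, v, w] := by
    have : ![u, v, w] = Fin.snoc ![u, v] w := by
      ext i j; fin_cases i <;> rfl
    rw [this]
    exact hw
  let f : ((ℝ × ℝ) × ℝ) →ₗ[ℝ] EuclideanSpace ℝ (Fin 3) :=
    { toFun := fun x => x.1.1 • u + x.1.2 • w + x.2 • v
      map_add' := fun x y => by simp only [Prod.fst_add, Prod.snd_add]; module
      map_smul' := fun r x => by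
        simp only [Prod.smul_fst, Prod.smul_snd, RingHom.id_apply, smul_eq_mul]; module }
  have hf : Function.Injective f := by
    rw [← LinearMap.ker_eq_bot, LinearMap.ker_eq_bot']
    rintro ⟨⟨s, z⟩, y⟩ h0
    have := Fintype.linearIndependent_iff.1 hw' ![s, y, z] (by
      simp only [Fin.sum_univ_three]
      simpa [f, add_right_comm] using h0)
    have h1 := this 0
    have h2 := this 1
    have h3 := this 2
    simp only [Matrix.cons_val] at h1 h2 h3
    simp [h1, h2, h3]
  let e := (LinearMap.linearEquivOfInjective f hf (by simp)).toContinuousLinearEquiv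
  refine ⟨w, e.toHomeomorph.trans (Homeomorph.addLeft m), fun s z y => ?_⟩
  change m + (s • u + z • w + y • v) = _
  module

/-- Two sides of a flat triangle can be pushed across it onto the third side, fixing any closed
set that meets the triangle at most in the end points. -/
theorem ambientIsotopicRel_triangle {a b c : EuclideanSpace ℝ (Fin 3)}
    (h : LinearIndependent ℝ ![b - a, c - a]) {R : Set (EuclideanSpace ℝ (Fin 3))}
    (hR : IsClosed R) (hRT : R ∩ convexHull ℝ {a, b, c} ⊆ {a, c}) :
    AmbientIsotopicRel R (segment ℝ a b ∪ segment ℝ b c) (segment ℝ a c) := by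
  -- With origin at the midpoint of `ac`, half the base as first axis and the median to `b` as
  -- vertical axis, the triangle becomes the model one.
  set m := (1 / 2 : ℝ) • (a + c) with hm
  set u := (1 / 2 : ℝ) • (c - a) with hu
  set v := b - m with hv
  have ha : a = m - u := by rw [hm, hu]; module
  have hc : c = m + u := by rw [hm, hu]; module
  have hb : b = m + v := by rw [hv]; module
  have huv : LinearIndependent ℝ ![u, v] := by
    rw [LinearIndependent.pair_iff] at h ⊢
    intro s t hst
    have := h t (s / 2 - t / 2) (by rw [← hst, hv, hu, hm]; module)
    exact ⟨by linarith, this.1⟩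
  obtain ⟨w, Φ, hΦ⟩ := exists_affine_coordinates m u v huv
  have := (ambientIsotopicRel_tent (R := Φ ⁻¹' R) (hR.preimage Φ.continuous) ?_).image Φ
  · rw [image_preimage_eq _ Φ.surjective, image_image, image_image] at this
    simp only [hΦ, zero_smul, add_zero] at this
    rwa [segment_eq_image_abs ha hc hb, image_Icc_eq_segment ha hc] at this
  · intro s y hy0 hy hmem
    by_contra! hs
    have hy' : y ≤ 1 - |s| := by rwa [tentHeight_of_le hs.le] at hy
    have h1 := abs_le.1 (show |s| ≤ 1 - y by linarith)
    have hx := hRT ⟨hmem, mem_convexHull_triple.2 ⟨(1 - s - y) / 2, y, (1 + s - y) / 2,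
      by linarith [h1.2], hy0, by linarith [h1.1], by ring, by
        rw [hΦ]; nth_rewrite 1 [ha]; nth_rewrite 1 [hb]; nth_rewrite 1 [hc]; module⟩⟩
    have hinj := Φ.injective
    rcases hx with hx | hx
    · have : Φ ((s, 0), y) = Φ ((-1, 0), 0) := by rw [hx, hΦ]; nth_rewrite 1 [ha]; module
      have := congrArg (fun x => x.1.1) (hinj this)
      simp only at this
      rw [this] at hs
      norm_num at hs
    · have : Φ ((s, 0), y) = Φ ((1, 0), 0) := by rw [hx, hΦ]; nth_rewrite 1 [hc]; module
      have := congrArg (fun x => x.1.1) (hinj this)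
      simp only at this
      rw [this] at hs
      norm_num at hs

/-! ### Boundaries of flat triangles are unknots -/

/-- The self-homeomorphism of Euclidean space given by an invertible matrix. -/
noncomputable def Matrix.toEuclideanHomeomorph {n : Type*} [Fintype n] [DecidableEq n]
    (M : Matrix n n ℝ) (hM : M.det ≠ 0) : EuclideanSpace ℝ n ≃ₜ EuclideanSpace ℝ n where
  toFun := Matrix.toEuclideanLin M
  invFun := Matrix.toEuclideanLin M⁻¹
  left_inv x := by
    rw [← LinearMap.comp_apply, ← Matrix.toLpLin_mul_same,
      Matrix.nonsing_inv_mul _ (isUnit_iff_ne_zero.2 hM), Matrix.toLpLin_one, LinearMap.id_apply]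
  right_inv x := by
    rw [← LinearMap.comp_apply, ← Matrix.toLpLin_mul_same,
      Matrix.mul_nonsing_inv _ (isUnit_iff_ne_zero.2 hM), Matrix.toLpLin_one, LinearMap.id_apply]
  continuous_toFun := LinearMap.continuous_of_finiteDimensional _
  continuous_invFun := LinearMap.continuous_of_finiteDimensional _

theorem ambientIsotopicRel_matrix_path {n : Type*} [Fintype n] [DecidableEq n]
    (M : ℝ → Matrix n n ℝ) (hM : Continuous M) (h0 : M 0 = 1)
    (hdet : ∀ t ∈ Icc (0 : ℝ) 1, (M t).det ≠ 0) (K : Set (EuclideanSpace ℝ n)) :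
    AmbientIsotopicRel ∅ K (Matrix.toEuclideanLin (M 1) '' K) := by
  refine ⟨fun p => Matrix.toEuclideanLin (M p.1) p.2, ?_, fun t => ?_, fun x => ?_, by simp, by simp⟩
  · simp only [Matrix.toLpLin_apply]
    have h1 : Continuous fun p : unitInterval × EuclideanSpace ℝ n => M p.1 :=
      hM.comp (continuous_subtype_val.comp continuous_fst)
    have h2 : Continuous fun p : unitInterval × EuclideanSpace ℝ n => WithLp.ofLp p.2 := by fun_prop
    exact (PiLp.continuous_toLp 2 _).comp (h1.matrix_mulVec h2)
  · exact ((M t).toEuclideanHomeomorph (hdet t t.2)).isHomeomorph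
  · simp [h0]

theorem ambientIsotopicRel_translate {E : Type*} [NormedAddCommGroup E] [NormedSpace ℝ E] (m : E)
    (K : Set E) : AmbientIsotopicRel ∅ K ((fun x => m + x) '' K) := by
  refine ⟨fun p => (p.1 : ℝ) • m + p.2, by fun_prop, fun t => ?_, by simp, by simp, by simp⟩
  exact (Homeomorph.addLeft ((t : ℝ) • m)).isHomeomorph

/-- An invertible linear image of the round circle is an unknot. -/
theorem isUnknot_matrix_image_standardCircle (M : Matrix (Fin 3) (Fin 3) ℝ) (hM : M.det ≠ 0) :
    AmbientIsotopicRel ∅ (Matrix.toEuclideanLin M '' standardCircle) standardCircle := by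
  -- An invertible matrix may have negative determinant, so it need not be joined to 1; it is
  -- factored into diagonal matrices and transvections, and each factor is treated on the circle.
  refine Matrix.diagonal_transvection_induction_of_det_ne_zero
    (fun M => AmbientIsotopicRel ∅ (Matrix.toEuclideanLin M '' standardCircle) standardCircle)
    M hM (fun D hD => ?_) (fun t => ?_) (fun A B hA hB h1 h2 => ?_)
  · have hD' : ∀ i, D i ≠ 0 := by
      rw [Matrix.det_diagonal] at hD
      exact fun i => Finset.prod_ne_zero_iff.1 hD i (Finset.mem_univ i)
    -- Only the absolute values `|D i|` are joined to 1. The signs are coordinate reflections, which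
    -- map the round circle to itself.
    have := ambientIsotopicRel_matrix_path
      (fun t => Matrix.diagonal fun i => (1 - t) + t * |D i|) (by fun_prop) (by simp)
      (fun t ht => by
        rw [Matrix.det_diagonal]
        refine Finset.prod_ne_zero_iff.2 fun i _ => ?_
        have := abs_pos.2 (hD' i)
        rcases ht.1.eq_or_lt with h | h
        · simp [← h]
        · nlinarith [mul_pos h this, ht.2]) standardCircle
    refine AmbientIsotopicRel.symm ?_
    convert this using 1
    ext x
    simp only [mem_image, Matrix.toLpLin_apply, standardCircle, mem_ofPred_eq]
    have hsg : ∀ i, SignType.sign (D i) * |D i| = D i := fun i => sign_mul_abs _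
    have hsq : ∀ i, ((SignType.sign (D i) : ℝ)) ^ 2 = 1 := fun i => by
      rcases (hD' i).lt_or_gt with h | h
      · simp [sign_neg h]
      · simp [sign_pos h]
    constructor
    · rintro ⟨y, ⟨hy, hy2⟩, rfl⟩
      refine ⟨WithLp.toLp 2 fun i => SignType.sign (D i) * y i, ?_, ?_⟩
      · simp only [mul_pow, hsq, one_mul]
        exact ⟨hy, by rw [hy2, mul_zero]⟩
      · ext i
        simp only [Matrix.mulVec_diagonal, sub_self, zero_add, one_mul]
        rw [← mul_assoc, mul_comm |D i|, hsg]
    · rintro ⟨y, ⟨hy, hy2⟩, rfl⟩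
      refine ⟨WithLp.toLp 2 fun i => SignType.sign (D i) * y i, ?_, ?_⟩
      · simp only [mul_pow, hsq, one_mul]
        exact ⟨hy, by rw [hy2, mul_zero]⟩
      · ext i
        simp only [Matrix.mulVec_diagonal, sub_self, zero_add, one_mul]
        rw [← mul_assoc]
        rw [self_mul_sign]
  · obtain ⟨i, j, hij, c⟩ := t
    refine AmbientIsotopicRel.symm ?_
    have := ambientIsotopicRel_matrix_path (fun t => Matrix.transvection i j (t * c))
      (by unfold Matrix.transvection
          refine continuous_const.add (continuous_matrix fun k l => ?_)
          simp only [Matrix.single_apply]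
          split_ifs <;> fun_prop) (by simp)
      (fun t _ => by rw [Matrix.det_transvection_of_ne _ _ hij]; exact one_ne_zero) standardCircle
    simpa using this
  · have h3 := h2.image (A.toEuclideanHomeomorph hA)
    rw [image_empty] at h3
    have h4 : (A.toEuclideanHomeomorph hA '' (Matrix.toEuclideanLin B '' standardCircle)) =
        Matrix.toEuclideanLin (A * B) '' standardCircle := by
      rw [image_image]
      refine image_congr fun x _ => ?_
      rw [Matrix.toLpLin_mul_same]
      rfl
    rw [h4] at h3
    exact h3.trans h1

/-- Rescaling of the first two coordinates. -/
noncomputable def planarScale (r : ℝ) (x : EuclideanSpace ℝ (Fin 3)) : EuclideanSpace ℝ (Fin 3) :=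
  !₂[r * x 0, r * x 1, x 2]

theorem planarScale_mul (r s : ℝ) (x : EuclideanSpace ℝ (Fin 3)) :
    planarScale r (planarScale s x) = planarScale (r * s) x := by
  ext i; fin_cases i <;> simp [planarScale, mul_assoc]

theorem planarScale_one (x : EuclideanSpace ℝ (Fin 3)) : planarScale 1 x = x := by
  ext i; fin_cases i <;> simp [planarScale]

/-- Planar rescaling by a bounded factor is continuous if the factor is continuous off the axis. -/
theorem continuous_planarScale {Y : Type*} [TopologicalSpace Y] {ρ : Y → ℝ}
    {f : Y → EuclideanSpace ℝ (Fin 3)} (hf : Continuous f) (C : ℝ) (hC : ∀ y, ¬ (f y 0 = 0 ∧ f y 1 = 0) → |ρ y| ≤ C)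
    (hρ : ∀ y, ¬ (f y 0 = 0 ∧ f y 1 = 0) → ContinuousAt ρ y) :
    Continuous fun y => planarScale (ρ y) (f y) := by
  have h : ∀ i : Fin 3, (i = 0 ∨ i = 1) → Continuous fun y => ρ y * f y i := by
    intro i hi
    rw [continuous_iff_continuousAt]
    intro y
    by_cases hy : f y 0 = 0 ∧ f y 1 = 0
    · have h0 : f y i = 0 := by rcases hi with rfl | rfl; exacts [hy.1, hy.2]
      have h1 : Tendsto (fun y => f y i) (𝓝 y) (𝓝 0) := by
        rw [← h0]
        exact (by fun_prop : Continuous fun y => f y i).continuousAt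
      have h2 : ContinuousAt (fun y => ρ y * f y i) y ↔
          Tendsto (fun y => ρ y * f y i) (𝓝 y) (𝓝 0) := by
        simp [ContinuousAt, h0]
      rw [h2]
      refine squeeze_zero_norm (a := fun y => C * ‖f y i‖) (fun z => ?_) ?_
      · rw [norm_mul]
        by_cases hz : f z 0 = 0 ∧ f z 1 = 0
        · have : f z i = 0 := by rcases hi with rfl | rfl; exacts [hz.1, hz.2]
          simp [this]
        · exact mul_le_mul_of_nonneg_right (hC z hz) (norm_nonneg _)
      · simpa using (h1.norm.const_mul C)
    · exact (hρ y hy).mul (by fun_prop)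
  refine (PiLp.continuous_toLp 2 _).comp (continuous_pi fun i => ?_)
  fin_cases i
  · exact h 0 (Or.inl rfl)
  · exact h 1 (Or.inr rfl)
  · change Continuous fun y => f y 2
    fun_prop

/-- Radial rescaling of the plane by the ratio of a gauge to the Euclidean norm, interpolated. -/
noncomputable def radialFactor (t : ℝ) (x : EuclideanSpace ℝ (Fin 3)) : ℝ :=
  (1 - t) + t * (max (max (-x 0) (-x 1)) (x 0 + x 1) / √(x 0 ^ 2 + x 1 ^ 2))

/-- The boundary of a triangle in the plane `z = 0`, given by a gauge. -/
def gaugeTriangle : Set (EuclideanSpace ℝ (Fin 3)) :=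
  {x | max (max (-x 0) (-x 1)) (x 0 + x 1) = 1 ∧ x 2 = 0}

/-- The three functionals sum to zero, so their maximum controls both coordinates. Comparability
with the norm keeps the radial factor bounded above and away from 0. -/
theorem gauge_bounds (p q : ℝ) :
    √(p ^ 2 + q ^ 2) ≤ 4 * max (max (-p) (-q)) (p + q) ∧
      max (max (-p) (-q)) (p + q) ≤ 2 * √(p ^ 2 + q ^ 2) := by
  set N := max (max (-p) (-q)) (p + q)
  have h1 : -p ≤ N := (le_max_left _ _).trans (le_max_left _ _)
  have h2 : -q ≤ N := (le_max_right _ _).trans (le_max_left _ _)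
  have h3 : p + q ≤ N := le_max_right _ _
  constructor
  · rw [Real.sqrt_le_left (by linarith)]
    have hp : |p| ≤ 2 * N := abs_le.2 ⟨by linarith, by linarith⟩
    have hq : |q| ≤ 2 * N := abs_le.2 ⟨by linarith, by linarith⟩
    have := sq_le_sq' (by linarith [abs_nonneg p]) hp
    have := sq_le_sq' (by linarith [abs_nonneg q]) hq
    rw [sq_abs] at *
    nlinarith
  · have hp : |p| ≤ √(p ^ 2 + q ^ 2) := Real.abs_le_sqrt (by nlinarith)
    have hq : |q| ≤ √(p ^ 2 + q ^ 2) := Real.abs_le_sqrt (by nlinarith)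
    have hp' := abs_le.1 hp
    have hq' := abs_le.1 hq
    have := Real.sqrt_nonneg (p ^ 2 + q ^ 2)
    exact max_le (max_le (by linarith) (by linarith)) (by linarith)

theorem radialFactor_bounds {t : ℝ} (ht : t ∈ Icc (0 : ℝ) 1) {x : EuclideanSpace ℝ (Fin 3)}
    (hx : ¬ (x 0 = 0 ∧ x 1 = 0)) : 1 / 4 ≤ radialFactor t x ∧ radialFactor t x ≤ 2 := by
  have hpos : 0 < √(x 0 ^ 2 + x 1 ^ 2) := by
    rw [Real.sqrt_pos]
    by_contra! h
    exact hx ⟨by nlinarith [sq_nonneg (x 0), sq_nonneg (x 1)],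
      by nlinarith [sq_nonneg (x 0), sq_nonneg (x 1)]⟩
  obtain ⟨h1, h2⟩ := gauge_bounds (x 0) (x 1)
  have h3 : 1 / 4 ≤ max (max (-x 0) (-x 1)) (x 0 + x 1) / √(x 0 ^ 2 + x 1 ^ 2) := by
    rw [le_div_iff₀ hpos]; linarith
  have h4 : max (max (-x 0) (-x 1)) (x 0 + x 1) / √(x 0 ^ 2 + x 1 ^ 2) ≤ 2 := by
    rwa [div_le_iff₀ hpos]
  unfold radialFactor
  constructor <;> nlinarith [ht.1, ht.2]

/-- The factor is constant along horizontal rays from the axis, so the radial map is inverted by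
scaling with the reciprocal factor. -/
theorem radialFactor_planarScale (t : ℝ) (x : EuclideanSpace ℝ (Fin 3)) {r : ℝ} (hr : 0 < r) :
    radialFactor t (planarScale r x) = radialFactor t x := by
  have h1 : max (max (-(r * x 0)) (-(r * x 1))) (r * x 0 + r * x 1) =
      r * max (max (-x 0) (-x 1)) (x 0 + x 1) := by
    rw [mul_max_of_nonneg _ _ hr.le, mul_max_of_nonneg _ _ hr.le, mul_add, mul_neg, mul_neg]
  have h2 : √((r * x 0) ^ 2 + (r * x 1) ^ 2) = r * √(x 0 ^ 2 + x 1 ^ 2) := by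
    rw [mul_pow, mul_pow, ← mul_add, Real.sqrt_mul (sq_nonneg r), Real.sqrt_sq hr.le]
  simp only [radialFactor, planarScale, PiLp.toLp_apply, Matrix.cons_val]
  rw [h1, h2, mul_div_mul_left _ _ hr.ne']

theorem planarScale_of_axis (r : ℝ) {x : EuclideanSpace ℝ (Fin 3)} (hx : x 0 = 0 ∧ x 1 = 0) :
    planarScale r x = x := by
  ext i; fin_cases i <;> simp [planarScale, hx.1, hx.2]

theorem continuousAt_radialFactor (p : ℝ × EuclideanSpace ℝ (Fin 3))
    (hx : ¬ (p.2 0 = 0 ∧ p.2 1 = 0)) :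
    ContinuousAt (fun p : ℝ × EuclideanSpace ℝ (Fin 3) => radialFactor p.1 p.2) p := by
  have hpos : √(p.2 0 ^ 2 + p.2 1 ^ 2) ≠ 0 := by
    rw [Real.sqrt_ne_zero']
    by_contra! h
    exact hx ⟨by nlinarith [sq_nonneg (p.2 0), sq_nonneg (p.2 1)],
      by nlinarith [sq_nonneg (p.2 0), sq_nonneg (p.2 1)]⟩
  unfold radialFactor
  exact ContinuousAt.add (by fun_prop)
    (ContinuousAt.mul (by fun_prop) (ContinuousAt.div (by fun_prop) (by fun_prop) hpos))

/-- Each horizontal ray from the axis is stretched by the interpolated ratio of gauge to norm. At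
time 1 the planar norm of the image is the gauge of the point, so the level set 1 of the gauge
becomes the circle. The axis, where the ratio has no meaning, stays fixed. -/
theorem ambientIsotopicRel_gaugeTriangle :
    AmbientIsotopicRel ∅ gaugeTriangle standardCircle := by
  have hpos : ∀ x : EuclideanSpace ℝ (Fin 3), 0 < x 0 ^ 2 + x 1 ^ 2 → ¬ (x 0 = 0 ∧ x 1 = 0) := by
    rintro x h ⟨h0, h1⟩
    simp [h0, h1] at h
  refine ⟨fun p => planarScale (radialFactor p.1 p.2) p.2, ?_, fun t => ?_, fun x => ?_, by simp, ?_⟩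
  · refine continuous_planarScale continuous_snd 2 (fun p hp => ?_) (fun p hp => ?_)
    · have := radialFactor_bounds p.1.2 hp
      rw [abs_le]
      exact ⟨by linarith, this.2⟩
    · exact ContinuousAt.comp (f := fun p : unitInterval × EuclideanSpace ℝ (Fin 3) =>
        ((p.1 : ℝ), p.2)) (continuousAt_radialFactor (p.1, p.2) hp) (by fun_prop)
  · have hct : ∀ x : EuclideanSpace ℝ (Fin 3), ¬ (x 0 = 0 ∧ x 1 = 0) →
        ContinuousAt (radialFactor t) x := fun x hx =>
      ContinuousAt.comp (f := fun x : EuclideanSpace ℝ (Fin 3) => ((t : ℝ), x))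
        (continuousAt_radialFactor ((t : ℝ), x) hx) (by fun_prop)
    let e : EuclideanSpace ℝ (Fin 3) ≃ₜ EuclideanSpace ℝ (Fin 3) :=
      { toFun := fun x => planarScale (radialFactor t x) x
        invFun := fun x => planarScale (radialFactor t x)⁻¹ x
        left_inv := fun x => by
          by_cases hx : x 0 = 0 ∧ x 1 = 0
          · dsimp only
            rw [planarScale_of_axis _ hx, planarScale_of_axis _ hx]
          · have := radialFactor_bounds t.2 hx
            dsimp only
            rw [radialFactor_planarScale _ _ (by linarith), planarScale_mul,
              inv_mul_cancel₀ (by linarith), planarScale_one]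
        right_inv := fun x => by
          by_cases hx : x 0 = 0 ∧ x 1 = 0
          · dsimp only
            rw [planarScale_of_axis _ hx, planarScale_of_axis _ hx]
          · have := radialFactor_bounds t.2 hx
            dsimp only
            rw [radialFactor_planarScale _ _ (inv_pos.2 (by linarith)), planarScale_mul,
              mul_inv_cancel₀ (by linarith), planarScale_one]
        continuous_toFun := continuous_planarScale continuous_id 2 (fun x hx => by
          have := radialFactor_bounds t.2 hx
          rw [abs_le]
          exact ⟨by linarith, this.2⟩) hct
        continuous_invFun := continuous_planarScale continuous_id 4 (fun x hx => by
          have := radialFactor_bounds t.2 hx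
          rw [abs_inv, abs_of_pos (by linarith)]
          exact inv_le_of_inv_le₀ (by norm_num) (by linarith)) (fun x hx => (hct x hx).inv₀ (by
          have := radialFactor_bounds t.2 hx
          linarith)) }
    exact e.isHomeomorph
  · simp [radialFactor, planarScale_one]
  · ext y
    simp only [mem_image, gaugeTriangle, standardCircle, mem_ofPred_eq, Set.Icc.coe_one]
    constructor
    · rintro ⟨x, ⟨h1, h2⟩, rfl⟩
      have hs : 0 < √(x 0 ^ 2 + x 1 ^ 2) := by
        have := (gauge_bounds (x 0) (x 1)).2
        rw [h1] at this
        linarith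
      have hsq := Real.sq_sqrt (Real.sqrt_pos.1 hs).le
      simp only [planarScale, radialFactor, h1, PiLp.toLp_apply, Matrix.cons_val]
      refine ⟨?_, h2⟩
      rw [mul_pow, mul_pow, ← mul_add, sub_self, zero_add, one_mul, div_pow, hsq, one_pow,
        one_div_mul_cancel (Real.sqrt_pos.1 hs).ne']
    · rintro ⟨h1, h2⟩
      have hx := hpos y (by rw [h1]; norm_num)
      obtain ⟨hb, -⟩ := radialFactor_bounds (t := 1) (by simp) hx
      have hN : radialFactor 1 y = max (max (-y 0) (-y 1)) (y 0 + y 1) := by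
        simp [radialFactor, h1]
      have hr : 0 < (radialFactor 1 y)⁻¹ := inv_pos.2 (by linarith)
      refine ⟨planarScale (radialFactor 1 y)⁻¹ y, ⟨?_, h2⟩, ?_⟩
      · simp only [planarScale, PiLp.toLp_apply, Matrix.cons_val]
        rw [← mul_neg, ← mul_neg, ← mul_add, ← mul_max_of_nonneg _ _ hr.le,
          ← mul_max_of_nonneg _ _ hr.le, ← hN, inv_mul_cancel₀ (by linarith)]
      · rw [radialFactor_planarScale _ _ hr, planarScale_mul, mul_inv_cancel₀ (by linarith),
          planarScale_one]

theorem gaugeTriangle_eq : gaugeTriangle =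
    segment ℝ !₂[(-1 : ℝ), -1, 0] !₂[(2 : ℝ), -1, 0] ∪
      segment ℝ !₂[(2 : ℝ), -1, 0] !₂[(-1 : ℝ), 2, 0] ∪
      segment ℝ !₂[(-1 : ℝ), 2, 0] !₂[(-1 : ℝ), -1, 0] := by
  ext x
  simp only [gaugeTriangle, mem_ofPred_eq, mem_union]
  constructor
  · rintro ⟨h, h2⟩
    have h3 : -x 0 ≤ 1 := h ▸ (le_max_left _ _).trans (le_max_left _ _)
    have h4 : -x 1 ≤ 1 := h ▸ (le_max_right _ _).trans (le_max_left _ _)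
    have h5 : x 0 + x 1 ≤ 1 := h ▸ le_max_right _ _
    have h6 : -x 0 = 1 ∨ -x 1 = 1 ∨ x 0 + x 1 = 1 := by
      rcases max_choice (max (-x 0) (-x 1)) (x 0 + x 1) with h' | h'
      · rcases max_choice (-x 0) (-x 1) with h'' | h''
        · left; rw [← h'', ← h', h]
        · right; left; rw [← h'', ← h', h]
      · right; right; rw [← h', h]
    rcases h6 with h6 | h6 | h6
    · right
      refine ⟨(x 1 + 1) / 3, (2 - x 1) / 3, by linarith, by linarith, by ring, ?_⟩
      ext i; fin_cases i <;> simp <;> linarith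
    · left; left
      refine ⟨(2 - x 0) / 3, (x 0 + 1) / 3, by linarith, by linarith, by ring, ?_⟩
      ext i; fin_cases i <;> simp <;> linarith
    · left; right
      refine ⟨(2 - x 1) / 3, (x 1 + 1) / 3, by linarith, by linarith, by ring, ?_⟩
      ext i; fin_cases i <;> simp <;> linarith
  · rintro ((⟨s, t, hs, ht, hst, rfl⟩ | ⟨s, t, hs, ht, hst, rfl⟩) | ⟨s, t, hs, ht, hst, rfl⟩) <;>
    obtain rfl : s = 1 - t := by linarith
    all_goals simp
    · have : max (-(t * 2) + (1 - t)) 1 = 1 := max_eq_right (by linarith)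
      rw [this, max_eq_left (by linarith)]
    · rw [max_eq_right]
      · linarith
      · exact max_le (by linarith) (by linarith)
    · have : max 1 (t + -((1 - t) * 2)) = 1 := max_eq_left (by linarith)
      rw [this, max_eq_left (by linarith)]

/-- The boundary of a nondegenerate flat triangle is an unknot. -/
theorem isUnknot_triangle {a b c : EuclideanSpace ℝ (Fin 3)}
    (h : LinearIndependent ℝ ![b - a, c - a]) :
    IsUnknot (segment ℝ a b ∪ segment ℝ b c ∪ segment ℝ c a) := by
  obtain ⟨w, hw⟩ := exists_linearIndependent_snoc_of_lt_finrank h (by simp)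
  have hw' : LinearIndependent ℝ ![b - a, c - a, w] := by
    have : ![b - a, c - a, w] = Fin.snoc ![b - a, c - a] w := by
      ext i j; fin_cases i <;> rfl
    rw [this]
    exact hw
  -- The model triangle has vertices `(-1,-1)`, `(2,-1)`, `(-1,2)` and centroid 0. The factors `1/3`
  -- match its sides of coordinate length 3, and the translation `m` is the centroid of `abc`.
  set M : Matrix (Fin 3) (Fin 3) ℝ :=
    Matrix.of fun i j => ![(1 / 3 : ℝ) • (b - a), (1 / 3 : ℝ) • (c - a), w] j i with hM
  have hMx : ∀ x, Matrix.toEuclideanLin M x =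
      x 0 • (1 / 3 : ℝ) • (b - a) + x 1 • (1 / 3 : ℝ) • (c - a) + x 2 • w := by
    intro x
    ext i
    simp [hM, Matrix.toLpLin_apply, Matrix.mulVec, dotProduct, Fin.sum_univ_three, mul_comm]
  have hdet : M.det ≠ 0 := by
    intro h0
    obtain ⟨x, hx, hx0⟩ := Matrix.exists_mulVec_eq_zero_iff.2 h0
    have h1 := hMx (WithLp.toLp 2 x)
    rw [Matrix.toLpLin_apply] at h1
    simp only [hx0, WithLp.toLp_zero] at h1
    have := Fintype.linearIndependent_iff.1 hw' ![x 0 / 3, x 1 / 3, x 2] (by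
      simp only [Fin.sum_univ_three, Matrix.cons_val]
      rw [h1]
      module)
    have h2 := this 0
    have h3 := this 1
    have h4 := this 2
    simp only [Matrix.cons_val] at h2 h3 h4
    apply hx
    ext i
    fin_cases i <;> simp <;> linarith
  set m := a + (1 / 3 : ℝ) • (b - a) + (1 / 3 : ℝ) • (c - a) with hm
  have key : (fun x => m + x) '' (Matrix.toEuclideanLin M '' gaugeTriangle) =
      segment ℝ a b ∪ segment ℝ b c ∪ segment ℝ c a := by
    have himg : ∀ p q, Matrix.toEuclideanLin M '' segment ℝ p q =
        segment ℝ (Matrix.toEuclideanLin M p) (Matrix.toEuclideanLin M q) := fun p q =>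
      image_segment ℝ (Matrix.toEuclideanLin M).toAffineMap p q
    simp only [gaugeTriangle_eq, image_union, himg, segment_translate_image]
    have e1 : m + Matrix.toEuclideanLin M !₂[(-1 : ℝ), -1, 0] = a := by
      rw [hMx, hm]; simp only [Matrix.cons_val]; module
    have e2 : m + Matrix.toEuclideanLin M !₂[(2 : ℝ), -1, 0] = b := by
      rw [hMx, hm]; simp only [Matrix.cons_val]; module
    have e3 : m + Matrix.toEuclideanLin M !₂[(-1 : ℝ), 2, 0] = c := by
      rw [hMx, hm]; simp only [Matrix.cons_val]; module
    rw [e1, e2, e3]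
  have h1 := ambientIsotopicRel_translate m (Matrix.toEuclideanLin M '' gaugeTriangle)
  rw [key] at h1
  have h2 := ambientIsotopicRel_gaugeTriangle.image (M.toEuclideanHomeomorph hdet)
  rw [image_empty] at h2
  exact (h1.symm.trans (h2.trans
    (isUnknot_matrix_image_standardCircle M hdet))).ambientIsotopic

/-! ### Piecewise linear maps and half-spaces -/

/-- A simplex is a finite intersection of half-spaces. -/
theorem AffineIndependent.exists_halfspaces {E : Type*} [NormedAddCommGroup E] [NormedSpace ℝ E]
    [FiniteDimensional ℝ E] {s : Finset E} (hs : AffineIndependent ℝ ((↑) : s → E)) :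
    ∃ L : Set (E →ᵃ[ℝ] ℝ), L.Finite ∧
      ∀ x, x ∈ convexHull ℝ (s : Set E) ↔ ∀ l ∈ L, 0 ≤ l x := by
  classical
  -- Complete the vertices to an affine basis: the simplex is where all barycentric coordinates are
  -- nonnegative and those of the added points are also nonpositive.
  obtain ⟨t, hst, hti, htop⟩ := exists_subset_affineIndependent_affineSpan_eq_top
    (s := (s : Set E)) hs
  have htf : t.Finite := finite_set_of_fin_dim_affineIndependent ℝ hti
  have := htf.fintype
  let B : AffineBasis t ℝ E := ⟨fun p => p, hti, by simpa using htop⟩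
  have hB : ∀ i : t, B i = (i : E) := fun _ => rfl
  refine ⟨range (fun i => B.coord i) ∪ (fun i => -B.coord i) '' {i | (i : E) ∉ s},
    (finite_range _).union ((toFinite _).image _), fun x => ?_⟩
  have hL : (∀ l ∈ range (fun i => B.coord i) ∪ (fun i => -B.coord i) '' {i | (i : E) ∉ s},
      0 ≤ l x) ↔ (∀ i, 0 ≤ B.coord i x) ∧ ∀ i : t, (i : E) ∉ s → B.coord i x ≤ 0 := by
    constructor
    · intro h
      refine ⟨fun i => h _ (Or.inl ⟨i, rfl⟩), fun i hi => ?_⟩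
      have := h _ (Or.inr ⟨i, hi, rfl⟩)
      simpa using this
    · rintro ⟨h1, h2⟩ l (⟨i, rfl⟩ | ⟨i, hi, rfl⟩)
      · exact h1 i
      · simpa using h2 i hi
  rw [hL]
  constructor
  · intro hx
    have hc : Convex ℝ {x | (∀ i, 0 ≤ B.coord i x) ∧ ∀ i : t, (i : E) ∉ s → B.coord i x ≤ 0} := by
      have e : {x | (∀ i, 0 ≤ B.coord i x) ∧ ∀ i : t, (i : E) ∉ s → B.coord i x ≤ 0} =
          (⋂ i, B.coord i ⁻¹' Ici 0) ∩ ⋂ i : t, ⋂ _ : (i : E) ∉ s, B.coord i ⁻¹' Iic 0 := by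
        ext; simp
      rw [e]
      exact (convex_iInter fun i => (convex_Ici 0).affine_preimage _).inter
        (convex_iInter fun i => convex_iInter fun _ => (convex_Iic 0).affine_preimage _)
    refine convexHull_min (fun y hy => ?_) hc hx
    have hyt : y ∈ t := hst hy
    have key : ∀ i, B.coord i y = if i = ⟨y, hyt⟩ then 1 else 0 := fun i => by
      rw [← B.coord_apply, hB]
    refine ⟨fun i => ?_, fun i hi => ?_⟩
    · rw [key]; split_ifs <;> norm_num
    · rw [key, if_neg]
      rintro rfl
      exact hi hy
  · rintro ⟨h1, h2⟩
    have h0 : ∀ i : t, (i : E) ∉ s → B.coord i x = 0 := fun i hi => le_antisymm (h2 i hi) (h1 i)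
    have e1 := B.linear_combination_coord_eq_self x
    have e2 := B.sum_coord_apply_eq_one x
    have e3 : ∑ i ∈ Finset.univ.filter (fun i : t => (i : E) ∈ s), B.coord i x • (i : E) = x := by
      refine Eq.trans ?_ e1
      refine Finset.sum_filter_of_ne fun i _ hi => ?_
      by_contra hc
      simp [h0 i hc] at hi
    have e4 : ∑ i ∈ Finset.univ.filter (fun i : t => (i : E) ∈ s), B.coord i x = 1 := by
      rw [← e2]
      refine Finset.sum_filter_of_ne fun i _ hi => ?_
      by_contra hc
      exact hi (h0 i hc)
    rw [← e3]
    exact (convex_convexHull ℝ _).sum_mem (fun i _ => h1 i) e4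
      (fun i hi => subset_convexHull ℝ _ (Finset.mem_filter.1 hi).2)

/-- Pasting over finitely many closed simplices, on each of which the map agrees with a continuous
affine one. -/
theorem IsPLOn.continuousOn {E F : Type*} [NormedAddCommGroup E] [NormedSpace ℝ E]
    [FiniteDimensional ℝ E] [NormedAddCommGroup F] [NormedSpace ℝ F] {f : E → F} {S : Set E}
    (hf : IsPLOn f S) : ContinuousOn f S := by
  obtain ⟨K, hfin, rfl, hK⟩ := hf
  have : Finite K.faces := hfin
  have e : K.space = ⋃ s : K.faces, convexHull ℝ ((s : Finset E) : Set E) := by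
    simp [Geometry.SimplicialComplex.space, iUnion_subtype]
  rw [e]
  refine (locallyFinite_of_finite _).continuousOn_iUnion
    (fun s => (s : Finset E).finite_toSet.isClosed_convexHull ℝ) fun s => ?_
  obtain ⟨g, hg⟩ := hK s s.2
  exact g.continuous_of_finiteDimensional.continuousOn.congr hg

/-- A family of functionals that decides on which triangles a piecewise linear map is affine. -/
theorem IsPLOn.exists_functionals {E F : Type*} [NormedAddCommGroup E] [NormedSpace ℝ E]
    [FiniteDimensional ℝ E] [AddCommGroup F] [Module ℝ F] {f : E → F} {S : Set E}
    (hf : IsPLOn f S) : ∃ L : List (E →ᵃ[ℝ] ℝ), ∀ a b c : E, convexHull ℝ {a, b, c} ⊆ S →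
      (∀ l ∈ L, (0 ≤ l a ∧ 0 ≤ l b ∧ 0 ≤ l c) ∨ (l a ≤ 0 ∧ l b ≤ 0 ∧ l c ≤ 0)) →
      ∃ g : E →ᵃ[ℝ] F, EqOn f g (convexHull ℝ {a, b, c}) := by
  obtain ⟨K, hfin, rfl, hK⟩ := hf
  choose! L hLf hL using fun s (hs : s ∈ K.faces) => (K.indep hs).exists_halfspaces
  have hfin' : (⋃ s ∈ K.faces, L s).Finite := hfin.biUnion hLf
  refine ⟨hfin'.toFinset.toList, fun a b c hsub hun => ?_⟩
  -- The centroid lies in some simplex `s`. A defining functional of `s` is nonnegative there and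
  -- has one sign on the vertices, so it is nonnegative at all three; the whole triangle lies in
  -- `s`.
  obtain ⟨p, hp⟩ : ∃ p : E, p = (1 / 3 : ℝ) • a + (1 / 3 : ℝ) • b + (1 / 3 : ℝ) • c := ⟨_, rfl⟩
  have hpm : p ∈ convexHull ℝ {a, b, c} := mem_convexHull_triple.2
    ⟨1 / 3, 1 / 3, 1 / 3, by norm_num, by norm_num, by norm_num, by norm_num, hp.symm⟩
  obtain ⟨s, hs, hps⟩ := Geometry.SimplicialComplex.mem_space_iff.1 (hsub hpm)
  obtain ⟨g, hg⟩ := hK s hs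
  refine ⟨g, hg.mono (convexHull_min ?_ (convex_convexHull ℝ _))⟩
  have key : ∀ l ∈ L s, 0 ≤ l a ∧ 0 ≤ l b ∧ 0 ≤ l c := by
    intro l hl
    have hsum : 3 * l p = l a + l b + l c := by
      have e : p = AffineMap.lineMap (AffineMap.lineMap a b (1 / 2 : ℝ)) c (1 / 3 : ℝ) := by
        rw [hp, AffineMap.lineMap_apply_module, AffineMap.lineMap_apply_module]; module
      rw [e, AffineMap.apply_lineMap, AffineMap.apply_lineMap, AffineMap.lineMap_apply_module,
        AffineMap.lineMap_apply_module]
      simp only [smul_eq_mul]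
      ring
    have hlp := (hL s hs p).1 hps l hl
    rcases hun l (by simpa using ⟨s, hs, hl⟩) with h | h
    · exact h
    · exact ⟨by linarith [h.1, h.2], by linarith [h.1, h.2], by linarith [h.1, h.2]⟩
  rintro x (rfl | rfl | rfl)
  · exact (hL s hs _).2 fun l hl => (key l hl).1
  · exact (hL s hs _).2 fun l hl => (key l hl).2.1
  · exact (hL s hs _).2 fun l hl => (key l hl).2.2

/-! ### Cutting nondegenerate triangles -/

section Nondegenerate

variable {E : Type*} [AddCommGroup E] [Module ℝ E]

theorem LinearIndependent.pair_ext {u v : E} (h : LinearIndependent ℝ ![u, v]) {p q p' q' : ℝ}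
    (e : p • u + q • v = p' • u + q' • v) : p = p' ∧ q = q' := by
  have := LinearIndependent.pair_iff.1 h (p - p') (q - q') (by
    rw [sub_smul, sub_smul, sub_add_sub_comm, e, sub_self])
  exact ⟨by linarith [this.1], by linarith [this.2]⟩

theorem linearIndependent_triangle_rotate {a b c : E} (h : LinearIndependent ℝ ![b - a, c - a]) :
    LinearIndependent ℝ ![c - b, a - b] := by
  rw [LinearIndependent.pair_iff] at h ⊢
  intro s t hst
  have := h (-s - t) s (by rw [← hst]; module)
  exact ⟨this.2, by linarith [this.1, this.2]⟩

theorem linearIndependent_triangle_swap {a b c : E} (h : LinearIndependent ℝ ![b - a, c - a]) :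
    LinearIndependent ℝ ![b - c, a - c] := by
  rw [LinearIndependent.pair_iff] at h ⊢
  intro s t hst
  have := h s (-s - t) (by rw [← hst]; module)
  exact ⟨this.1, by linarith [this.1, this.2]⟩

theorem linearIndependent_triangle_left {a b c : E} (h : LinearIndependent ℝ ![b - a, c - a])
    {t : ℝ} (ht : t ≠ 0) : LinearIndependent ℝ ![b - a, AffineMap.lineMap a c t - a] := by
  rw [LinearIndependent.pair_iff] at h ⊢
  intro p q hpq
  have := h p (q * t) (by rw [← hpq, AffineMap.lineMap_apply_module]; module)
  exact ⟨this.1, by simpa [ht] using this.2⟩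

theorem linearIndependent_triangle_right {a b c : E} (h : LinearIndependent ℝ ![b - a, c - a])
    {t : ℝ} (ht : t ≠ 1) :
    LinearIndependent ℝ ![b - AffineMap.lineMap a c t, c - AffineMap.lineMap a c t] := by
  rw [LinearIndependent.pair_iff] at h ⊢
  intro p q hpq
  have := h p (q * (1 - t) - p * t) (by rw [← hpq, AffineMap.lineMap_apply_module]; module)
  have h1 := this.1
  have h2 : q * (1 - t) = 0 := by rw [← this.2, h1]; ring
  exact ⟨h1, by simpa [sub_eq_zero, ht.symm] using h2⟩

/-- The two pieces of a triangle cut from a vertex meet along the cut. -/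
theorem convexHull_inter_of_cut {a b c : E} (h : LinearIndependent ℝ ![b - a, c - a]) {t : ℝ}
    (h0 : 0 < t) (h1 : t < 1) :
    convexHull ℝ {a, b, AffineMap.lineMap a c t} ∩ convexHull ℝ {AffineMap.lineMap a c t, b, c} ⊆
      segment ℝ b (AffineMap.lineMap a c t) := by
  rintro x ⟨hx, hx'⟩
  obtain ⟨α, β, γ, hα, hβ, hγ, hs, rfl⟩ := mem_convexHull_triple.1 hx
  obtain ⟨α', β', γ', hα', hβ', hγ', hs', e⟩ := mem_convexHull_triple.1 hx'
  obtain rfl : α = 1 - β - γ := by linarith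
  obtain rfl : α' = 1 - β' - γ' := by linarith
  rw [AffineMap.lineMap_apply_module] at e ⊢
  obtain ⟨e1, e2⟩ := h.pair_ext (p := β') (q := (1 - β' - γ') * t + γ') (p' := β) (q' := γ * t) (by
    have := congrArg (fun y => y - a) e
    linear_combination (norm := module) this)
  subst e1
  have h3 : γ' = 0 := by nlinarith [mul_nonneg hα h0.le]
  have h4 : 1 - β' - γ = 0 := by nlinarith
  refine ⟨β', γ, hβ, hγ, by linarith, ?_⟩
  rw [h4]
  module

theorem segment_inter_segment_of_linearIndependent {a b c : E}
    (h : LinearIndependent ℝ ![b - a, c - a]) : segment ℝ a b ∩ segment ℝ a c ⊆ {a} := by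
  rintro x ⟨⟨s, t, hs, ht, hst, rfl⟩, ⟨s', t', hs', ht', hst', e⟩⟩
  obtain rfl : s = 1 - t := by linarith
  obtain rfl : s' = 1 - t' := by linarith
  obtain ⟨e1, -⟩ := h.pair_ext (p := t) (q := 0) (p' := 0) (q' := t') (by
    have := congrArg (fun y => y - a) e
    linear_combination (norm := module) -this)
  rw [mem_singleton_iff, e1]
  module

theorem segment_eq_union_of_mem {a b d : E} (hd : d ∈ segment ℝ a b) :
    segment ℝ a b = segment ℝ a d ∪ segment ℝ d b := by
  apply Subset.antisymm
  · obtain ⟨s, t, hs, ht, hst, rfl⟩ := hd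
    rintro _ ⟨p, q, hp, hq, hpq, rfl⟩
    obtain rfl : s = 1 - t := by linarith
    obtain rfl : p = 1 - q := by linarith
    rcases le_total q t with h | h
    · left
      rcases ht.eq_or_lt with rfl | ht
      · obtain rfl : q = 0 := by linarith
        simp
      · refine ⟨1 - q / t, q / t, ?_, by positivity, by ring, ?_⟩
        · rw [sub_nonneg, div_le_one ht]; exact h
        · have : q / t * t = q := by field_simp
          linear_combination (norm := module) (this) • (b - a)
    · right
      rcases hs.eq_or_lt with hs | hs
      · obtain rfl : t = 1 := by linarith
        obtain rfl : q = 1 := by linarith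
        simp
      · refine ⟨(1 - q) / (1 - t), 1 - (1 - q) / (1 - t), by positivity, ?_, by ring, ?_⟩
        · rw [sub_nonneg, div_le_one hs]; linarith
        · have : (1 - q) / (1 - t) * (1 - t) = 1 - q := by field_simp
          linear_combination (norm := module) (this) • (a - b)
  · have hc := convex_segment (𝕜 := ℝ) a b
    exact union_subset (hc.segment_subset (left_mem_segment ℝ a b) hd)
      (hc.segment_subset hd (right_mem_segment ℝ a b))

end Nondegenerate

/-! ### Pushing across the image of a triangle -/

section Push

variable {E : Type*} [NormedAddCommGroup E] [NormedSpace ℝ E]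

/-- The image of the path `abc` can be pushed across the image of the triangle `abc` onto the
image of the side `ac`. -/
def PushesAcross (F : E → EuclideanSpace ℝ (Fin 3)) (a b c : E) : Prop :=
  ∀ R : Set (EuclideanSpace ℝ (Fin 3)), IsClosed R →
    R ∩ F '' convexHull ℝ {a, b, c} ⊆ {F a, F c} →
    AmbientIsotopicRel R (F '' (segment ℝ a b ∪ segment ℝ b c)) (F '' segment ℝ a c)

theorem PushesAcross.symm {F : E → EuclideanSpace ℝ (Fin 3)} {a b c : E}
    (h : PushesAcross F a b c) : PushesAcross F c b a := by
  intro R hR hRT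
  rw [segment_symm ℝ c b, segment_symm ℝ b a, segment_symm ℝ c a, union_comm]
  refine h R hR ?_
  rwa [pair_comm b c, insert_comm a c, pair_comm a b, pair_comm (F a)]

theorem isClosed_image_segment {F : E → EuclideanSpace ℝ (Fin 3)} {S : Set E} {a b : E}
    (hF : ContinuousOn F S) (h : segment ℝ a b ⊆ S) : IsClosed (F '' segment ℝ a b) := by
  rw [← convexHull_pair] at h ⊢
  exact (((toFinite {a, b}).isCompact_convexHull ℝ).image_of_continuousOn (hF.mono h)).isClosed

theorem Set.InjOn.image_inter_image_subset_singleton {α β : Type*} {F : α → β} {S A B : Set α}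
    (hF : InjOn F S) (hA : A ⊆ S) (hB : B ⊆ S) {p : α} (h : A ∩ B ⊆ {p}) :
    F '' A ∩ F '' B ⊆ {F p} := by
  rw [← hF.image_inter hA hB]
  rintro _ ⟨x, hx, rfl⟩
  rw [h hx]; rfl

theorem convexHull_triple_subset {C : Set E} (hC : Convex ℝ C) {a b c : E} (ha : a ∈ C)
    (hb : b ∈ C) (hc : c ∈ C) : convexHull ℝ {a, b, c} ⊆ C :=
  convexHull_min (by rintro x (rfl | rfl | rfl) <;> assumption) hC

theorem left_mem_triangle (a b c : E) : a ∈ convexHull ℝ {a, b, c} :=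
  subset_convexHull ℝ _ (by simp)

theorem mid_mem_triangle (a b c : E) : b ∈ convexHull ℝ {a, b, c} :=
  subset_convexHull ℝ _ (by simp)

theorem right_mem_triangle (a b c : E) : c ∈ convexHull ℝ {a, b, c} :=
  subset_convexHull ℝ _ (by simp)

variable {F : E → EuclideanSpace ℝ (Fin 3)} {S : Set E} {a b c d : E}

/-- Keep `ad` still and push `db ∪ bc` across `dbc` onto `dc`; then push `ad ∪ dc` across `adc` onto
`ac`. -/
theorem PushesAcross.of_cut_leg (hF : ContinuousOn F S) (hinj : InjOn F S)
    (hS : convexHull ℝ {a, b, c} ⊆ S) (hd : d ∈ segment ℝ a b)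
    (hi : segment ℝ a d ∩ convexHull ℝ {d, b, c} ⊆ {d})
    (h1 : PushesAcross F d b c) (h2 : PushesAcross F a d c) : PushesAcross F a b c := by
  have hcv := convex_convexHull ℝ ({a, b, c} : Set E)
  have ha := left_mem_triangle a b c
  have hb := mid_mem_triangle a b c
  have hc := right_mem_triangle a b c
  have hd' := hcv.segment_subset ha hb hd
  have hT1 : convexHull ℝ {d, b, c} ⊆ convexHull ℝ {a, b, c} :=
    convexHull_triple_subset hcv hd' hb hc
  have hT2 : convexHull ℝ {a, d, c} ⊆ convexHull ℝ {a, b, c} :=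
    convexHull_triple_subset hcv ha hd' hc
  have had := (hcv.segment_subset ha hd').trans hS
  have hi' := hinj.image_inter_image_subset_singleton had (hT1.trans hS) hi
  intro R hR hRT
  have s1 := ((h1 (R ∪ F '' segment ℝ a d) (hR.union (isClosed_image_segment hF had)) (by
    rintro x ⟨hx | hx, hxT⟩
    · rcases hRT ⟨hx, image_mono hT1 hxT⟩ with rfl | rfl
      · left; exact hi' ⟨mem_image_of_mem _ (left_mem_segment ℝ a d), hxT⟩
      · right; rfl
    · left; exact hi' ⟨hx, hxT⟩)).union subset_union_right).mono subset_union_left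
  have s2 := h2 R hR (fun x hx => hRT ⟨hx.1, image_mono hT2 hx.2⟩)
  rw [← image_union, ← image_union, union_comm, union_comm (segment ℝ d c), ← union_assoc,
    ← segment_eq_union_of_mem hd] at s1
  exact s1.trans s2

/-- The first move runs backwards: `ab` is spread across `adb` onto `ad ∪ db` with `bc` still. Then
`db ∪ bc` is pushed onto `dc` with `ad` still. -/
theorem PushesAcross.of_cut_base (hF : ContinuousOn F S) (hinj : InjOn F S)
    (hS : convexHull ℝ {a, b, c} ⊆ S) (hd : d ∈ segment ℝ a c)
    (hi : segment ℝ a d ∩ convexHull ℝ {d, b, c} ⊆ {d})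
    (hi₂ : segment ℝ b c ∩ convexHull ℝ {a, d, b} ⊆ {b})
    (h1 : PushesAcross F a d b) (h2 : PushesAcross F d b c) : PushesAcross F a b c := by
  have hcv := convex_convexHull ℝ ({a, b, c} : Set E)
  have ha := left_mem_triangle a b c
  have hb := mid_mem_triangle a b c
  have hc := right_mem_triangle a b c
  have hd' := hcv.segment_subset ha hc hd
  have hT1 : convexHull ℝ {a, d, b} ⊆ convexHull ℝ {a, b, c} :=
    convexHull_triple_subset hcv ha hd' hb
  have hT2 : convexHull ℝ {d, b, c} ⊆ convexHull ℝ {a, b, c} :=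
    convexHull_triple_subset hcv hd' hb hc
  have had := (hcv.segment_subset ha hd').trans hS
  have hbc := (hcv.segment_subset hb hc).trans hS
  have hi' := hinj.image_inter_image_subset_singleton had (hT2.trans hS) hi
  have hi₂' := hinj.image_inter_image_subset_singleton hbc (hT1.trans hS) hi₂
  intro R hR hRT
  have s1 := ((h1 (R ∪ F '' segment ℝ b c) (hR.union (isClosed_image_segment hF hbc)) (by
    rintro x ⟨hx | hx, hxT⟩
    · rcases hRT ⟨hx, image_mono hT1 hxT⟩ with rfl | rfl
      · left; rfl
      · right; exact hi₂' ⟨mem_image_of_mem _ (right_mem_segment ℝ b c), hxT⟩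
    · right; exact hi₂' ⟨hx, hxT⟩)).union subset_union_right).mono subset_union_left
  have s2 := ((h2 (R ∪ F '' segment ℝ a d) (hR.union (isClosed_image_segment hF had)) (by
    rintro x ⟨hx | hx, hxT⟩
    · rcases hRT ⟨hx, image_mono hT2 hxT⟩ with rfl | rfl
      · left; exact hi' ⟨mem_image_of_mem _ (left_mem_segment ℝ a d), hxT⟩
      · right; rfl
    · left; exact hi' ⟨hx, hxT⟩)).union subset_union_right).mono subset_union_left
  rw [← image_union, ← image_union] at s1 s2
  have e1 : segment ℝ a d ∪ segment ℝ d b ∪ segment ℝ b c =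
      segment ℝ d b ∪ segment ℝ b c ∪ segment ℝ a d := by
    rw [union_assoc, union_comm]
  rw [e1] at s1
  rw [union_comm (segment ℝ d c), ← segment_eq_union_of_mem hd] at s2
  exact s1.symm.trans s2

/-- Pushing `bc ∪ cd` across `bcd` onto `bd`, with `ab` and `ad` still, leaves the boundary of
`abd`. -/
theorem isUnknot_of_cut (hF : ContinuousOn F S) (hinj : InjOn F S)
    (hS : convexHull ℝ {a, b, c} ⊆ S) (hd : d ∈ segment ℝ a c)
    (hi : segment ℝ a d ∩ convexHull ℝ {b, c, d} ⊆ {d})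
    (hi₂ : segment ℝ a b ∩ convexHull ℝ {b, c, d} ⊆ {b})
    (h1 : PushesAcross F b c d)
    (h2 : IsUnknot (F '' (segment ℝ a b ∪ segment ℝ b d ∪ segment ℝ d a))) :
    IsUnknot (F '' (segment ℝ a b ∪ segment ℝ b c ∪ segment ℝ c a)) := by
  have hcv := convex_convexHull ℝ ({a, b, c} : Set E)
  have ha := left_mem_triangle a b c
  have hb := mid_mem_triangle a b c
  have hc := right_mem_triangle a b c
  have hd' := hcv.segment_subset ha hc hd
  have hT1 : convexHull ℝ {b, c, d} ⊆ convexHull ℝ {a, b, c} :=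
    convexHull_triple_subset hcv hb hc hd'
  have had := (hcv.segment_subset ha hd').trans hS
  have hab := (hcv.segment_subset ha hb).trans hS
  have hi' := hinj.image_inter_image_subset_singleton had (hT1.trans hS) hi
  have hi₂' := hinj.image_inter_image_subset_singleton hab (hT1.trans hS) hi₂
  have s1 := (h1 (F '' segment ℝ a b ∪ F '' segment ℝ a d)
    ((isClosed_image_segment hF hab).union (isClosed_image_segment hF had)) (by
    rintro x ⟨hx | hx, hxT⟩
    · left; exact hi₂' ⟨hx, hxT⟩
    · right; exact hi' ⟨hx, hxT⟩)).union Subset.rfl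
  rw [← image_union, ← image_union, ← image_union] at s1
  have s2 := (AmbientIsotopicRel.of_ambientIsotopic h2)
  refine AmbientIsotopicRel.ambientIsotopic (R := ∅) ?_
  convert (s1.mono (empty_subset _)).trans ?_ using 2
  · rw [segment_symm ℝ c a, segment_eq_union_of_mem hd, segment_symm ℝ d c]
    ext x; simp only [mem_union]; tauto
  · convert s2 using 2
    rw [segment_symm ℝ d a]
    ext x; simp only [mem_union]; tauto

/-- A relation between the image edges, scaled down, displaces the centroid within the triangle
without changing its image; injectivity makes the displacement zero. -/
theorem linearIndependent_image_triangle {G : Type*} [AddCommGroup G] [Module ℝ G]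
    (g : E →ᵃ[ℝ] G) (h : LinearIndependent ℝ ![b - a, c - a])
    (hg : InjOn g (convexHull ℝ {a, b, c})) : LinearIndependent ℝ ![g b - g a, g c - g a] := by
  rw [LinearIndependent.pair_iff]
  intro p q hpq
  -- Small enough that the displaced centroid keeps nonnegative barycentric coordinates.
  obtain ⟨ε, hε⟩ : ∃ ε : ℝ, ε = 1 / (3 * (1 + |p| + |q|)) := ⟨_, rfl⟩
  have hp := abs_nonneg p
  have hq := abs_nonneg q
  have hpos : 0 < ε := by rw [hε]; positivity
  have h3 : ε + ε * |p| + ε * |q| = 1 / 3 := by rw [hε]; field_simp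
  have hp1 : ε * p ≤ ε * |p| := mul_le_mul_of_nonneg_left (le_abs_self p) hpos.le
  have hp2 : -(ε * |p|) ≤ ε * p := by nlinarith [neg_abs_le p]
  have hq1 : ε * q ≤ ε * |q| := mul_le_mul_of_nonneg_left (le_abs_self q) hpos.le
  have hq2 : -(ε * |q|) ≤ ε * q := by nlinarith [neg_abs_le q]
  have hp3 : 0 ≤ ε * |p| := by positivity
  have hq3 : 0 ≤ ε * |q| := by positivity
  have key : ∀ x y : ℝ, (1 - x - y) • a + x • b + y • c =
      (x • (b - a) + y • (c - a)) +ᵥ a := fun x y => by rw [vadd_eq_add]; module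
  have hgl : ∀ x y : ℝ, g ((1 - x - y) • a + x • b + y • c) =
      x • (g b - g a) + y • (g c - g a) + g a := fun x y => by
    rw [key, AffineMap.map_vadd, map_add, map_smul, map_smul, vadd_eq_add]
    simp only [← vsub_eq_sub, AffineMap.linearMap_vsub]
  have e := hg (mem_convexHull_triple.2 ⟨1 - (1 / 3 + ε * p) - (1 / 3 + ε * q), 1 / 3 + ε * p,
    1 / 3 + ε * q, by linarith, by linarith, by linarith, by ring, rfl⟩)
    (mem_convexHull_triple.2 ⟨1 - 1 / 3 - 1 / 3, 1 / 3, 1 / 3, by norm_num, by norm_num,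
      by norm_num, by norm_num, rfl⟩) (by
      rw [hgl, hgl]
      linear_combination (norm := module) ε • hpq)
  rw [key, key, vadd_right_cancel_iff] at e
  obtain ⟨e1, e2⟩ := h.pair_ext e
  constructor
  · have : ε * p = 0 := by linarith
    exact (mul_eq_zero.1 this).resolve_left hpos.ne'
  · have : ε * q = 0 := by linarith
    exact (mul_eq_zero.1 this).resolve_left hpos.ne'

theorem image_segment_of_eqOn {g : E →ᵃ[ℝ] EuclideanSpace ℝ (Fin 3)} {T : Set E}
    (hg : EqOn F g T) {p q : E} (h : segment ℝ p q ⊆ T) :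
    F '' segment ℝ p q = segment ℝ (F p) (F q) := by
  rw [(hg.mono h).image_eq, image_segment, hg (h (left_mem_segment ℝ p q)),
    hg (h (right_mem_segment ℝ p q))]

theorem PushesAcross.of_affine {g : E →ᵃ[ℝ] EuclideanSpace ℝ (Fin 3)}
    (hg : EqOn F g (convexHull ℝ {a, b, c})) (hinj : InjOn F (convexHull ℝ {a, b, c}))
    (h : LinearIndependent ℝ ![b - a, c - a]) : PushesAcross F a b c := by
  have hcv := convex_convexHull ℝ ({a, b, c} : Set E)
  have ha := left_mem_triangle a b c
  have hb := mid_mem_triangle a b c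
  have hc := right_mem_triangle a b c
  have hgi := linearIndependent_image_triangle g h (hg.injOn_iff.1 hinj)
  rw [← hg ha, ← hg hb, ← hg hc] at hgi
  intro R hR hRT
  rw [image_union, image_segment_of_eqOn hg (hcv.segment_subset ha hb),
    image_segment_of_eqOn hg (hcv.segment_subset hb hc),
    image_segment_of_eqOn hg (hcv.segment_subset ha hc)]
  refine ambientIsotopicRel_triangle hgi hR ?_
  rw [hg.image_eq, AffineMap.image_convexHull] at hRT
  simpa [image_insert_eq, hg ha, hg hb, hg hc] using hRT

theorem isUnknot_of_affine {g : E →ᵃ[ℝ] EuclideanSpace ℝ (Fin 3)}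
    (hg : EqOn F g (convexHull ℝ {a, b, c})) (hinj : InjOn F (convexHull ℝ {a, b, c}))
    (h : LinearIndependent ℝ ![b - a, c - a]) :
    IsUnknot (F '' (segment ℝ a b ∪ segment ℝ b c ∪ segment ℝ c a)) := by
  have hcv := convex_convexHull ℝ ({a, b, c} : Set E)
  have ha := left_mem_triangle a b c
  have hb := mid_mem_triangle a b c
  have hc := right_mem_triangle a b c
  have hgi := linearIndependent_image_triangle g h (hg.injOn_iff.1 hinj)
  rw [← hg ha, ← hg hb, ← hg hc] at hgi
  rw [image_union, image_union, image_segment_of_eqOn hg (hcv.segment_subset ha hb),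
    image_segment_of_eqOn hg (hcv.segment_subset hb hc),
    image_segment_of_eqOn hg (hcv.segment_subset hc ha)]
  exact isUnknot_triangle hgi

end Push

/-! ### Tame triangles -/

section Tame

variable {E : Type*} [NormedAddCommGroup E] [NormedSpace ℝ E]

/-- The image of the triangle `abc` can be swept from any corner to the opposite side, and its
boundary is an unknot. -/
structure IsTameTriangle (F : E → EuclideanSpace ℝ (Fin 3)) (a b c : E) : Prop where
  push_left : PushesAcross F c a b
  push_mid : PushesAcross F a b c
  push_right : PushesAcross F b c a
  unknot : IsUnknot (F '' (segment ℝ a b ∪ segment ℝ b c ∪ segment ℝ c a))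

variable {F : E → EuclideanSpace ℝ (Fin 3)} {S : Set E} {a b c d : E}

theorem IsTameTriangle.rotate (h : IsTameTriangle F a b c) : IsTameTriangle F b c a :=
  ⟨h.push_mid, h.push_right, h.push_left, by rw [union_comm, ← union_assoc]; exact h.unknot⟩

/-- The cut runs from `b` to `d` on `ac`. For the sweeps from `a` and from `c` the point `d` lies on
a leg, for the sweep from `b` on the base; the boundary is handled by removing `dbc`. -/
theorem IsTameTriangle.of_cut (hF : ContinuousOn F S) (hinj : InjOn F S)
    (hS : convexHull ℝ {a, b, c} ⊆ S) (h : LinearIndependent ℝ ![b - a, c - a]) {t : ℝ}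
    (h0 : 0 < t) (h1 : t < 1) (hd : d = AffineMap.lineMap a c t)
    (hT : IsTameTriangle F a b d) (hT' : IsTameTriangle F d b c) : IsTameTriangle F a b c := by
  have hcut := convexHull_inter_of_cut h h0 h1
  have l1 := linearIndependent_triangle_left h h0.ne'
  have l2 := linearIndependent_triangle_right h h1.ne
  rw [← hd] at hcut l1 l2
  have hdm : d ∈ segment ℝ a c := by
    rw [hd, segment_eq_image_lineMap]
    exact mem_image_of_mem _ ⟨h0.le, h1.le⟩
  have sub1 : ∀ {p q : E}, p ∈ ({a, b, d} : Set E) → q ∈ ({a, b, d} : Set E) →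
      segment ℝ p q ⊆ convexHull ℝ {a, b, d} := fun hp hq =>
    (convex_convexHull ℝ _).segment_subset (subset_convexHull ℝ _ hp) (subset_convexHull ℝ _ hq)
  have sub2 : ∀ {p q : E}, p ∈ ({d, b, c} : Set E) → q ∈ ({d, b, c} : Set E) →
      segment ℝ p q ⊆ convexHull ℝ {d, b, c} := fun hp hq =>
    (convex_convexHull ℝ _).segment_subset (subset_convexHull ℝ _ hp) (subset_convexHull ℝ _ hq)
  have e1 : ({a, d, b} : Set E) = {a, b, d} := by rw [pair_comm]
  have e2 : ({d, c, b} : Set E) = {d, b, c} := by rw [pair_comm]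
  have e3 : ({d, a, b} : Set E) = {a, b, d} := by rw [insert_comm, pair_comm d b]
  have e4 : ({b, c, d} : Set E) = {d, b, c} := by rw [pair_comm c d, insert_comm]
  have e5 : ({a, c, b} : Set E) = {a, b, c} := by rw [pair_comm]
  have e6 : ({c, a, b} : Set E) = {a, b, c} := by rw [insert_comm, pair_comm c b]
  -- The two pieces meet only along `bd`, so an edge of one other than the cut meets the other only
  -- in a corner.
  have i1 : segment ℝ a d ∩ convexHull ℝ {d, b, c} ⊆ {d} := fun x hx =>
    segment_inter_segment_of_linearIndependent (linearIndependent_triangle_swap l1)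
      ⟨by rw [segment_symm]; exact hcut ⟨sub1 (by simp) (by simp) hx.1, hx.2⟩,
        by rw [segment_symm]; exact hx.1⟩
  have i2 : segment ℝ a b ∩ convexHull ℝ {d, b, c} ⊆ {b} := fun x hx =>
    segment_inter_segment_of_linearIndependent (linearIndependent_triangle_rotate l1)
      ⟨hcut ⟨sub1 (by simp) (by simp) hx.1, hx.2⟩, by rw [segment_symm]; exact hx.1⟩
  have i3 : segment ℝ b c ∩ convexHull ℝ {a, b, d} ⊆ {b} := fun x hx =>
    segment_inter_segment_of_linearIndependent (linearIndependent_triangle_rotate l2)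
      ⟨hx.1, hcut ⟨hx.2, sub2 (by simp) (by simp) hx.1⟩⟩
  have i4 : segment ℝ c d ∩ convexHull ℝ {a, b, d} ⊆ {d} := fun x hx =>
    segment_inter_segment_of_linearIndependent l2
      ⟨by rw [segment_symm]; exact hcut ⟨hx.2, sub2 (by simp) (by simp) hx.1⟩,
        by rw [segment_symm]; exact hx.1⟩
  refine ⟨?_, ?_, ?_, ?_⟩
  · exact .of_cut_leg hF hinj (by rwa [e6]) (by rwa [segment_symm]) (by rwa [e3])
      hT.push_left hT'.push_left
  · exact .of_cut_base hF hinj hS hdm i1 (by rwa [e1]) hT.push_right.symm hT'.push_mid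
  · exact (PushesAcross.of_cut_leg hF hinj (by rwa [e5]) hdm (by rwa [e2])
      hT'.push_right.symm hT.push_right.symm).symm
  · exact isUnknot_of_cut hF hinj hS hdm (by rwa [e4]) (by rwa [e4]) hT'.push_right hT.unknot

theorem IsTameTriangle.of_affine {g : E →ᵃ[ℝ] EuclideanSpace ℝ (Fin 3)}
    (hg : EqOn F g (convexHull ℝ {a, b, c})) (hinj : InjOn F (convexHull ℝ {a, b, c}))
    (h : LinearIndependent ℝ ![b - a, c - a]) : IsTameTriangle F a b c := by
  have e4 : ({b, c, a} : Set E) = {a, b, c} := by rw [pair_comm c a, insert_comm]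
  have e6 : ({c, a, b} : Set E) = {a, b, c} := by rw [insert_comm, pair_comm c b]
  have h1 := linearIndependent_triangle_rotate h
  exact ⟨.of_affine (by rwa [e6]) (by rwa [e6]) (linearIndependent_triangle_rotate h1),
    .of_affine hg hinj h, .of_affine (by rwa [e4]) (by rwa [e4]) h1, isUnknot_of_affine hg hinj h⟩

/-- The functional `l` does not change sign on the triangle. -/
def IsUncut (l : E →ᵃ[ℝ] ℝ) (a b c : E) : Prop :=
  (0 ≤ l a ∧ 0 ≤ l b ∧ 0 ≤ l c) ∨ (l a ≤ 0 ∧ l b ≤ 0 ∧ l c ≤ 0)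

theorem IsUncut.rotate {l : E →ᵃ[ℝ] ℝ} (h : IsUncut l a b c) : IsUncut l b c a := by
  unfold IsUncut at *; tauto

/-- Cutting along a further line never undoes what earlier cuts achieved. -/
theorem IsUncut.cut {l : E →ᵃ[ℝ] ℝ} (h : IsUncut l a b c) {t : ℝ} (h0 : 0 < t) (h1 : t < 1)
    (hd : d = AffineMap.lineMap a c t) : IsUncut l a b d ∧ IsUncut l d b c := by
  have hld : l d = (1 - t) * l a + t * l c := by
    rw [hd, AffineMap.apply_lineMap, AffineMap.lineMap_apply_module]; rfl
  have h1' : 0 ≤ 1 - t := by linarith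
  rcases h with ⟨ha, hb, hc⟩ | ⟨ha, hb, hc⟩
  · have : 0 ≤ l d := by rw [hld]; positivity
    exact ⟨Or.inl ⟨ha, hb, this⟩, Or.inl ⟨this, hb, hc⟩⟩
  · have : l d ≤ 0 := by
      rw [hld]; nlinarith [mul_nonneg h1' (neg_nonneg.2 ha), mul_nonneg h0.le (neg_nonneg.2 hc)]
    exact ⟨Or.inr ⟨ha, hb, this⟩, Or.inr ⟨this, hb, hc⟩⟩

theorem exists_lineMap_eq_zero {l : E →ᵃ[ℝ] ℝ} (h : l a * l c < 0) :
    ∃ t : ℝ, 0 < t ∧ t < 1 ∧ l (AffineMap.lineMap a c t) = 0 := by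
  have hne : l a - l c ≠ 0 := fun h0 => by
    have : l a = l c := by linarith
    rw [this] at h
    nlinarith [mul_self_nonneg (l c)]
  refine ⟨l a / (l a - l c), ?_, ?_, ?_⟩
  · rcases mul_neg_iff.1 h with ⟨h1, h2⟩ | ⟨h1, h2⟩
    · exact div_pos h1 (by linarith)
    · exact div_pos_of_neg_of_neg h1 (by linarith)
  · rcases mul_neg_iff.1 h with ⟨h1, h2⟩ | ⟨h1, h2⟩
    · rw [div_lt_one (by linarith)]; linarith
    · rw [div_lt_one_of_neg (by linarith)]; linarith
  · rw [AffineMap.apply_lineMap, AffineMap.lineMap_apply_module]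
    simp only [smul_eq_mul]
    field_simp
    ring

/-- Cutting along finitely many lines reduces tameness to triangles not crossed by any line. -/
theorem isTameTriangle_of_functionals (hF : ContinuousOn F S) (hinj : InjOn F S)
    (L₀ : List (E →ᵃ[ℝ] ℝ))
    (hbase : ∀ a b c : E, LinearIndependent ℝ ![b - a, c - a] → convexHull ℝ {a, b, c} ⊆ S →
      (∀ l ∈ L₀, IsUncut l a b c) → IsTameTriangle F a b c) (L : List (E →ᵃ[ℝ] ℝ)) :
    ∀ a b c : E, LinearIndependent ℝ ![b - a, c - a] → convexHull ℝ {a, b, c} ⊆ S →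
      (∀ l ∈ L₀, l ∉ L → IsUncut l a b c) → IsTameTriangle F a b c := by
  -- `L` holds the functionals that may still change sign; the members of `L₀` outside `L` are
  -- already settled.
  induction L with
  | nil => exact fun a b c h hS hl => hbase a b c h hS fun l hl₀ => hl l hl₀ (by simp)
  | cons l L ih =>
    have hrot : ∀ a b c : E, convexHull ℝ {a, b, c} ⊆ S → convexHull ℝ {b, c, a} ⊆ S :=
      fun a b c h => by rwa [pair_comm c a, insert_comm]
    have hzero : ∀ a b c : E, LinearIndependent ℝ ![b - a, c - a] → convexHull ℝ {a, b, c} ⊆ S →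
        (∀ k ∈ L₀, k ∉ l :: L → IsUncut k a b c) → IsUncut l a b c → IsTameTriangle F a b c :=
      fun a b c h hS hk hl => ih a b c h hS fun k hk₀ hkL => by
        by_cases e : k = l
        · rwa [e]
        · exact hk k hk₀ (by simp [e, hkL])
    have hsub : ∀ (a b c : E) (t : ℝ), 0 < t → t < 1 → convexHull ℝ {a, b, c} ⊆ S →
        convexHull ℝ {a, b, AffineMap.lineMap a c t} ⊆ S ∧
        convexHull ℝ {AffineMap.lineMap a c t, b, c} ⊆ S := by
      intro a b c t h0 h1 hS
      have hcv := convex_convexHull ℝ ({a, b, c} : Set E)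
      have hd := hcv.lineMap_mem (left_mem_triangle a b c) (right_mem_triangle a b c)
        ⟨h0.le, h1.le⟩
      exact ⟨(convexHull_triple_subset hcv (left_mem_triangle a b c) (mid_mem_triangle a b c)
        hd).trans hS, (convexHull_triple_subset hcv hd (mid_mem_triangle a b c)
        (right_mem_triangle a b c)).trans hS⟩
    -- The zero line of `l` passes through the vertex `b`: at most one cut, through `b`, is needed.
    have hmid : ∀ a b c : E, LinearIndependent ℝ ![b - a, c - a] → convexHull ℝ {a, b, c} ⊆ S →
        (∀ k ∈ L₀, k ∉ l :: L → IsUncut k a b c) → l b = 0 → IsTameTriangle F a b c := by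
      intro a b c h hS hk hb
      by_cases hac : l a * l c < 0
      · obtain ⟨t, h0, h1, hd⟩ := exists_lineMap_eq_zero hac
        obtain ⟨s1, s2⟩ := hsub a b c t h0 h1 hS
        refine .of_cut hF hinj hS h h0 h1 rfl
          (hzero _ _ _ (linearIndependent_triangle_left h h0.ne') s1
            (fun k hk₀ hkL => ((hk k hk₀ hkL).cut h0 h1 rfl).1) ?_)
          (hzero _ _ _ (linearIndependent_triangle_right h h1.ne) s2
            (fun k hk₀ hkL => ((hk k hk₀ hkL).cut h0 h1 rfl).2) ?_)
        · rw [IsUncut, hb, hd]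
          rcases le_total 0 (l a) with h | h <;> simp [h]
        · rw [IsUncut, hb, hd]
          rcases le_total 0 (l c) with h | h <;> simp [h]
      · refine hzero a b c h hS hk ?_
        rw [IsUncut, hb]
        rcases mul_nonneg_iff.1 (not_lt.1 hac) with h | h <;> simp [h]
    -- The vertex `a` is alone on its side. Cutting from `b` to the zero `d` of `l` on `ac` leaves
    -- `dbc` uncrossed, while `abd` has the vertex `d` on the line.
    have hcut : ∀ a b c : E, LinearIndependent ℝ ![b - a, c - a] → convexHull ℝ {a, b, c} ⊆ S →
        (∀ k ∈ L₀, k ∉ l :: L → IsUncut k a b c) → l a * l c < 0 → 0 < l b * l c →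
        IsTameTriangle F a b c := by
      intro a b c h hS hk hac hbc
      obtain ⟨t, h0, h1, hd⟩ := exists_lineMap_eq_zero hac
      obtain ⟨s1, s2⟩ := hsub a b c t h0 h1 hS
      refine .of_cut hF hinj hS h h0 h1 rfl ?_
        (hzero _ _ _ (linearIndependent_triangle_right h h1.ne) s2
          (fun k hk₀ hkL => ((hk k hk₀ hkL).cut h0 h1 rfl).2) ?_)
      · exact (hmid _ _ _ (linearIndependent_triangle_rotate (linearIndependent_triangle_left h h0.ne'))
          (hrot _ _ _ s1) (fun k hk₀ hkL => ((hk k hk₀ hkL).cut h0 h1 rfl).1.rotate)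
          hd).rotate.rotate
      · rw [IsUncut, hd]
        rcases mul_pos_iff.1 hbc with ⟨h1, h2⟩ | ⟨h1, h2⟩ <;> simp [h1.le, h2.le]
    intro a b c h hS hk
    have h' := linearIndependent_triangle_rotate h
    have h'' := linearIndependent_triangle_rotate h'
    have hS' := hrot _ _ _ hS
    have hS'' := hrot _ _ _ hS'
    have hk' : ∀ k ∈ L₀, k ∉ l :: L → IsUncut k b c a := fun k h1 h2 => (hk k h1 h2).rotate
    have hk'' : ∀ k ∈ L₀, k ∉ l :: L → IsUncut k c a b := fun k h1 h2 => (hk' k h1 h2).rotate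
    -- Up to rotation, each sign pattern is uncrossed, has a zero at the middle vertex, or has one
    -- vertex alone on its side.
    rcases lt_trichotomy (l a) 0 with ha | ha | ha
    · rcases lt_trichotomy (l b) 0 with hb | hb | hb
      · rcases le_or_gt (l c) 0 with hc | hc
        · exact hzero _ _ _ h hS hk (Or.inr ⟨ha.le, hb.le, hc⟩)
        · exact (hcut _ _ _ h'' hS'' hk'' (by nlinarith) (by nlinarith)).rotate
      · exact hmid _ _ _ h hS hk hb
      · rcases lt_trichotomy (l c) 0 with hc | hc | hc
        · exact (hcut _ _ _ h' hS' hk' (by nlinarith) (by nlinarith)).rotate.rotate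
        · exact (hmid _ _ _ h' hS' hk' hc).rotate.rotate
        · exact hcut _ _ _ h hS hk (by nlinarith) (by nlinarith)
    · exact (hmid _ _ _ h'' hS'' hk'' ha).rotate
    · rcases lt_trichotomy (l b) 0 with hb | hb | hb
      · rcases lt_trichotomy (l c) 0 with hc | hc | hc
        · exact hcut _ _ _ h hS hk (by nlinarith) (by nlinarith)
        · exact (hmid _ _ _ h' hS' hk' hc).rotate.rotate
        · exact (hcut _ _ _ h' hS' hk' (by nlinarith) (by nlinarith)).rotate.rotate
      · exact hmid _ _ _ h hS hk hb
      · rcases le_or_gt 0 (l c) with hc | hc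
        · exact hzero _ _ _ h hS hk (Or.inl ⟨ha.le, hb.le, hc⟩)
        · exact (hcut _ _ _ h'' hS'' hk'' (by nlinarith) (by nlinarith)).rotate

/-- Every triangle is tame for an injective piecewise linear map. -/
theorem IsPLOn.isTameTriangle [FiniteDimensional ℝ E] (hF : IsPLOn F S) (hinj : InjOn F S)
    (h : LinearIndependent ℝ ![b - a, c - a]) (hS : convexHull ℝ {a, b, c} ⊆ S) :
    IsTameTriangle F a b c := by
  obtain ⟨L, hL⟩ := hF.exists_functionals
  refine isTameTriangle_of_functionals hF.continuousOn hinj L (fun a b c h hS hl => ?_) L a b c h hS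
    fun l h1 h2 => absurd h1 h2
  obtain ⟨g, hg⟩ := hL a b c hS hl
  exact .of_affine hg (hinj.mono hS) h

end Tame

/-! ### Polygonal arcs and loops -/

section Arc

variable {E : Type*} [NormedAddCommGroup E] [NormedSpace ℝ E]

/-- `S` is an embedded polygonal arc from `a` to `b` with set of vertices `V`. -/
inductive PolyArc : E → E → Set E → Set E → Prop
  | segment {a b : E} (h : a ≠ b) : PolyArc a b {a, b} (segment ℝ a b)
  | concat {a b c : E} {V W S T : Set E} (h : PolyArc a b V S) (h' : PolyArc b c W T)
      (hST : S ∩ T ⊆ {b}) : PolyArc a c (V ∪ W) (S ∪ T)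

namespace PolyArc

variable {a b c : E} {V S : Set E}

theorem finite (h : PolyArc a b V S) : V.Finite := by
  induction h with
  | segment h => exact toFinite _
  | concat h h' hST ih ih' => exact ih.union ih'

theorem ends_mem (h : PolyArc a b V S) : a ∈ V ∧ b ∈ V := by
  induction h with
  | segment h => simp
  | concat h h' hST ih ih' => exact ⟨Or.inl ih.1, Or.inr ih'.2⟩

theorem vertices_subset (h : PolyArc a b V S) : V ⊆ S := by
  induction h with
  | segment h => rintro x (rfl | rfl); exacts [left_mem_segment _ _ _, right_mem_segment _ _ _]
  | concat h h' hST ih ih' => exact union_subset_union ih ih'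

theorem left_mem (h : PolyArc a b V S) : a ∈ S := h.vertices_subset h.ends_mem.1

theorem right_mem (h : PolyArc a b V S) : b ∈ S := h.vertices_subset h.ends_mem.2

theorem ne (h : PolyArc a b V S) : a ≠ b := by
  induction h with
  | segment h => exact h
  | concat h h' hST ih ih' =>
    rintro rfl
    exact ih (hST ⟨h.left_mem, h'.right_mem⟩)

theorem isCompact (h : PolyArc a b V S) : IsCompact S := by
  induction h with
  | segment h =>
    rw [← convexHull_pair]
    exact (toFinite _).isCompact_convexHull ℝ
  | concat h h' hST ih ih' => exact ih.union ih'

theorem isPreconnected (h : PolyArc a b V S) : IsPreconnected S := by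
  induction h with
  | segment h => exact (convex_segment _ _).isPreconnected
  | concat h h' hST ih ih' => exact ih.union _ h.right_mem h'.left_mem ih'

theorem symm (h : PolyArc a b V S) : PolyArc b a V S := by
  induction h with
  | segment h =>
    rw [pair_comm, segment_symm]
    exact .segment h.symm
  | @concat a m c V W S T h h' hST ih ih' =>
    rw [union_comm V, union_comm S]
    exact .concat ih' ih (by rwa [inter_comm])

theorem split (h : PolyArc a b V S) {w : E} (hw : w ∈ V) (hwa : w ≠ a) (hwb : w ≠ b) :
    ∃ V₁ V₂ S₁ S₂, PolyArc a w V₁ S₁ ∧ PolyArc w b V₂ S₂ ∧ S₁ ∩ S₂ ⊆ {w} ∧ V = V₁ ∪ V₂ ∧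
      S = S₁ ∪ S₂ := by
  induction h with
  | segment h => rcases hw with rfl | rfl <;> contradiction
  | @concat a m c V W S T h h' hST ih ih' =>
    by_cases hwm : w = m
    · subst hwm
      exact ⟨V, W, S, T, h, h', hST, rfl, rfl⟩
    rcases hw with hw | hw
    · obtain ⟨V₁, V₂, S₁, S₂, h1, h2, h12, rfl, rfl⟩ := ih hw hwa hwm
      refine ⟨V₁, V₂ ∪ W, S₁, S₂ ∪ T, h1, h2.concat h' fun x hx => hST ⟨Or.inr hx.1, hx.2⟩, ?_,
        union_assoc _ _ _, union_assoc _ _ _⟩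
      rintro x ⟨hx1, hx2 | hx2⟩
      · exact h12 ⟨hx1, hx2⟩
      · obtain rfl := hST ⟨Or.inl hx1, hx2⟩
        exact h12 ⟨hx1, h2.right_mem⟩
    · obtain ⟨V₁, V₂, S₁, S₂, h1, h2, h12, rfl, rfl⟩ := ih' hw hwm hwb
      refine ⟨V ∪ V₁, V₂, S ∪ S₁, S₂, h.concat h1 fun x hx => hST ⟨hx.1, Or.inl hx.2⟩, h2, ?_,
        (union_assoc _ _ _).symm, (union_assoc _ _ _).symm⟩
      rintro x ⟨hx1 | hx1, hx2⟩
      · obtain rfl := hST ⟨hx1, Or.inr hx2⟩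
        exact h12 ⟨h1.left_mem, hx2⟩
      · exact h12 ⟨hx1, hx2⟩

theorem first_edge (h : PolyArc a b V S) : (V = {a, b} ∧ S = _root_.segment ℝ a b) ∨
    ∃ p V' S', a ≠ p ∧ PolyArc p b V' S' ∧ _root_.segment ℝ a p ∩ S' ⊆ {p} ∧ V = insert a V' ∧
      S = _root_.segment ℝ a p ∪ S' := by
  induction h with
  | segment h => exact Or.inl ⟨rfl, rfl⟩
  | @concat a m c V W S T h h' hST ih ih' =>
    right
    rcases ih with ⟨rfl, rfl⟩ | ⟨p, V', S', hne, hp, hi, rfl, rfl⟩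
    · refine ⟨m, W, T, h.ne, h', hST, ?_, rfl⟩
      rw [insert_union, singleton_union, insert_eq_of_mem h'.ends_mem.1]
    · refine ⟨p, V' ∪ W, S' ∪ T, hne, hp.concat h' fun x hx => hST ⟨Or.inr hx.1, hx.2⟩, ?_,
        insert_union, union_assoc _ _ _⟩
      rintro x ⟨hx1, hx2 | hx2⟩
      · exact hi ⟨hx1, hx2⟩
      · obtain rfl := hST ⟨Or.inl hx1, hx2⟩
        exact hi ⟨hx1, hp.right_mem⟩

theorem exists_edge (h : PolyArc a b V S) {x : E} (hx : x ∈ S) (hxV : x ∉ V) :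
    ∃ p ∈ V, ∃ q ∈ V, x ∈ openSegment ℝ p q ∧ _root_.segment ℝ p q ⊆ S ∧
      Disjoint (openSegment ℝ p q) V := by
  induction h with
  | @segment a b h =>
    refine ⟨a, by simp, b, by simp, ?_, Subset.rfl, ?_⟩
    · exact mem_openSegment_of_ne_left_right (fun e => hxV (by simp [e]))
        (fun e => hxV (by simp [e])) hx
    · rw [disjoint_right]
      rintro y (rfl | rfl) hy
      · exact h (left_mem_openSegment_iff.1 hy)
      · exact h (right_mem_openSegment_iff.1 hy)
  | @concat a m c V W S T h h' hST ih ih' =>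
    rw [mem_union, not_or] at hxV
    rcases hx with hx | hx
    · obtain ⟨p, hp, q, hq, hxpq, hsub, hdis⟩ := ih hx hxV.1
      refine ⟨p, Or.inl hp, q, Or.inl hq, hxpq, hsub.trans subset_union_left, ?_⟩
      rw [disjoint_union_right]
      refine ⟨hdis, disjoint_left.2 fun y hy hyW => ?_⟩
      have : y = m := hST ⟨hsub (openSegment_subset_segment _ _ _ hy), h'.vertices_subset hyW⟩
      exact disjoint_left.1 hdis hy (this ▸ h.ends_mem.2)
    · obtain ⟨p, hp, q, hq, hxpq, hsub, hdis⟩ := ih' hx hxV.2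
      refine ⟨p, Or.inr hp, q, Or.inr hq, hxpq, hsub.trans subset_union_right, ?_⟩
      rw [disjoint_union_right]
      refine ⟨disjoint_left.2 fun y hy hyV => ?_, hdis⟩
      have : y = m := hST ⟨h.vertices_subset hyV, hsub (openSegment_subset_segment _ _ _ hy)⟩
      exact disjoint_left.1 hdis hy (this ▸ h'.ends_mem.1)

/-- Needed for arcs that touch the boundary of a region only at their ends: without the ends the arc
lies wholly inside or wholly outside. -/
theorem isPreconnected_diff (h : PolyArc a b V S) : IsPreconnected (S \ {a}) ∧
    IsPreconnected (S \ {b}) ∧ IsPreconnected (S \ {a, b}) := by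
  induction h with
  | @segment a b h =>
    have hinj := AffineMap.lineMap_injective ℝ h
    have e : ∀ x : E, ∀ I : Set ℝ, IsPreconnected I → IsPreconnected (AffineMap.lineMap a b '' I) :=
      fun _ I hI => hI.image _ (AffineMap.lineMap_continuous (R := ℝ)).continuousOn
    have ha : ({a} : Set E) = AffineMap.lineMap a b '' ({0} : Set ℝ) := by simp
    have hb : ({b} : Set E) = AffineMap.lineMap a b '' ({1} : Set ℝ) := by simp
    have hab : ({a, b} : Set E) = AffineMap.lineMap a b '' ({0, 1} : Set ℝ) := by
      simp [image_insert_eq]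
    rw [segment_eq_image_lineMap, hab, ha, hb, ← image_sdiff hinj, ← image_sdiff hinj,
      ← image_sdiff hinj, Icc_sdiff_left, Icc_sdiff_right, Icc_sdiff_both]
    exact ⟨e a _ isPreconnected_Ioc, e a _ isPreconnected_Ico, e a _ isPreconnected_Ioo⟩
  | @concat a m c V W S T h h' hST ih ih' =>
    have ha : a ∉ T := fun hT => h.ne (hST ⟨h.left_mem, hT⟩)
    have hc : c ∉ S := fun hS => h'.ne (hST ⟨hS, h'.right_mem⟩).symm
    have hma : m ∈ S \ {a} := ⟨h.right_mem, h.ne.symm⟩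
    have hmc : m ∈ T \ {c} := ⟨h'.left_mem, h'.ne⟩
    have e1 : (S ∪ T) \ {a} = (S \ {a}) ∪ T := by
      rw [union_sdiff_distrib, sdiff_singleton_eq_self ha]
    have e2 : (S ∪ T) \ {c} = S ∪ (T \ {c}) := by
      rw [union_sdiff_distrib, sdiff_singleton_eq_self hc]
    have e3 : (S ∪ T) \ {a, c} = (S \ {a}) ∪ (T \ {c}) := by
      ext x
      simp only [Set.mem_sdiff, mem_union, mem_insert_iff, mem_singleton_iff, not_or]
      constructor
      · tauto
      · rintro (⟨h1, h2⟩ | ⟨h1, h2⟩)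
        · exact ⟨Or.inl h1, h2, fun e => hc (e ▸ h1)⟩
        · exact ⟨Or.inr h1, fun e => ha (e ▸ h1), h2⟩
    rw [e1, e2, e3]
    exact ⟨ih.1.union m hma h'.left_mem h'.isPreconnected,
      h.isPreconnected.union m h.right_mem hmc ih'.2.1, ih.1.union m hma hmc ih'.2.1⟩

/-- An arc containing the chord between its end points, with no vertex inside it, is a segment. -/
theorem eq_segment (h : PolyArc a b V S) (hsub : _root_.segment ℝ a b ⊆ S)
    (hdis : Disjoint (openSegment ℝ a b) V) : V = {a, b} := by
  cases h with
  | segment h => rfl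
  | @concat _ m _ V W S T h h' hST =>
    exfalso
    -- The connected chord is covered by the closed sets `S` and `T`, so it passes through their
    -- only common point, a vertex.
    have := isPreconnected_closed_iff.1 (convex_segment (𝕜 := ℝ) a b).isPreconnected S T
      h.isCompact.isClosed h'.isCompact.isClosed hsub ⟨a, left_mem_segment _ _ _, h.left_mem⟩
      ⟨b, right_mem_segment _ _ _, h'.right_mem⟩
    obtain ⟨x, hx, hxST⟩ := this
    obtain rfl := hST hxST
    exact disjoint_left.1 hdis (mem_openSegment_of_ne_left_right h.ne h'.ne.symm hx)
      (Or.inl h.ends_mem.2)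

end PolyArc

/-- `P` is a simple closed polygon with set of vertices `V`. -/
def PolyLoop (V P : Set E) : Prop :=
  ∃ a b V₁ V₂ S₁ S₂, PolyArc a b V₁ S₁ ∧ PolyArc a b V₂ S₂ ∧ S₁ ∩ S₂ ⊆ {a, b} ∧
    V = V₁ ∪ V₂ ∧ P = S₁ ∪ S₂

variable {V P : Set E}

/-- The base points of a loop are arbitrary: any vertex may serve as one. -/
theorem PolyLoop.rotate (h : PolyLoop V P) {v : E} (hv : v ∈ V) :
    ∃ b V₁ V₂ S₁ S₂, PolyArc v b V₁ S₁ ∧ PolyArc v b V₂ S₂ ∧ S₁ ∩ S₂ ⊆ {v, b} ∧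
      V = V₁ ∪ V₂ ∧ P = S₁ ∪ S₂ := by
  obtain ⟨a, b, V₁, V₂, S₁, S₂, h1, h2, hi, rfl, rfl⟩ := h
  wlog hv1 : v ∈ V₁ generalizing V₁ V₂ S₁ S₂
  · have := this V₂ V₁ S₂ S₁ h2 h1 (by rwa [inter_comm]) (by rwa [union_comm])
      (hv.resolve_left hv1)
    rwa [union_comm V₁, union_comm S₁]
  by_cases ha : v = a
  · subst ha; exact ⟨b, V₁, V₂, S₁, S₂, h1, h2, hi, rfl, rfl⟩
  by_cases hb : v = b
  · subst hb; exact ⟨a, V₁, V₂, S₁, S₂, h1.symm, h2.symm, by rwa [pair_comm], rfl, rfl⟩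
  obtain ⟨V₃, V₄, S₃, S₄, h3, h4, h34, rfl, rfl⟩ := h1.split hv1 ha hb
  refine ⟨a, V₃, V₄ ∪ V₂, S₃, S₄ ∪ S₂, h3.symm, h4.concat h2.symm ?_, ?_, union_assoc _ _ _,
    union_assoc _ _ _⟩
  · intro x hx
    rcases hi ⟨Or.inr hx.1, hx.2⟩ with rfl | rfl
    · exact absurd (h34 ⟨h3.left_mem, hx.1⟩).symm ha
    · rfl
  · rintro x ⟨hx1, hx2 | hx2⟩
    · exact Or.inl (h34 ⟨hx1, hx2⟩)
    · rcases hi ⟨Or.inl hx1, hx2⟩ with rfl | rfl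
      · exact Or.inr rfl
      · exact absurd (h34 ⟨hx1, h4.right_mem⟩).symm hb

/-- The form used by the induction: two edges at the chosen vertex and one arc joining their other
ends. -/
theorem PolyLoop.exists_neighbors (h : PolyLoop V P) {v : E} (hv : v ∈ V) :
    ∃ p q V' S', v ≠ p ∧ v ≠ q ∧ PolyArc p q V' S' ∧ segment ℝ v p ∩ segment ℝ v q ⊆ {v} ∧
      segment ℝ v p ∩ S' ⊆ {p} ∧ segment ℝ v q ∩ S' ⊆ {q} ∧ V = insert v V' ∧
      P = segment ℝ v p ∪ segment ℝ v q ∪ S' := by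
  obtain ⟨w, V₁, V₂, S₁, S₂, h1, h2, hi, rfl, rfl⟩ := h.rotate hv
  rcases h1.first_edge with ⟨rfl, rfl⟩ | ⟨p, V₃, S₃, hvp, h3, h3i, rfl, rfl⟩ <;>
    rcases h2.first_edge with ⟨rfl, rfl⟩ | ⟨q, V₄, S₄, hvq, h4, h4i, rfl, rfl⟩
  -- If both arcs were single edges they would coincide, and their midpoint would be a forbidden
  -- common point.
  · exfalso
    rw [inter_self] at hi
    have hm : midpoint ℝ v w ∈ segment ℝ v w := midpoint_mem_segment v w
    rcases hi hm with e | e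
    · exact h1.ne ((midpoint_eq_left_iff ℝ).1 e)
    · exact h1.ne ((midpoint_eq_right_iff ℝ).1 e)
  · have hv4 : v ∉ S₄ := fun hx => hvq (h4i ⟨left_mem_segment _ _ _, hx⟩)
    refine ⟨q, w, V₄, S₄, hvq, h1.ne, h4, ?_, h4i, ?_, ?_, ?_⟩
    · intro x hx
      rcases hi ⟨hx.2, Or.inl hx.1⟩ with rfl | rfl
      · rfl
      · have : x = q := h4i ⟨hx.1, h4.right_mem⟩
        exact absurd this.symm h4.ne
    · intro x hx
      rcases hi ⟨hx.1, Or.inr hx.2⟩ with rfl | rfl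
      · exact absurd hx.2 hv4
      · rfl
    · ext x
      have := h4.ends_mem.2
      simp only [mem_union, mem_insert_iff, mem_singleton_iff]
      constructor
      · rintro ((rfl | rfl) | rfl | h) <;> simp_all
      · tauto
    · rw [← union_assoc, union_comm (segment ℝ v w)]
  · have hv3 : v ∉ S₃ := fun hx => hvp (h3i ⟨left_mem_segment _ _ _, hx⟩)
    refine ⟨p, w, V₃, S₃, hvp, h2.ne, h3, ?_, h3i, ?_, ?_, ?_⟩
    · intro x hx
      rcases hi ⟨Or.inl hx.1, hx.2⟩ with rfl | rfl
      · rfl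
      · have : x = p := h3i ⟨hx.1, h3.right_mem⟩
        exact absurd this.symm h3.ne
    · intro x hx
      rcases hi ⟨Or.inr hx.2, hx.1⟩ with rfl | rfl
      · exact absurd hx.2 hv3
      · rfl
    · ext x
      have := h3.ends_mem.2
      simp only [mem_union, mem_insert_iff, mem_singleton_iff]
      constructor
      · rintro ((rfl | h) | rfl | rfl) <;> simp_all
      · tauto
    · rw [union_assoc, union_comm S₃, union_assoc]
  · have hv3 : v ∉ S₃ := fun hx => hvp (h3i ⟨left_mem_segment _ _ _, hx⟩)
    have hv4 : v ∉ S₄ := fun hx => hvq (h4i ⟨left_mem_segment _ _ _, hx⟩)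
    refine ⟨p, q, V₃ ∪ V₄, S₃ ∪ S₄, hvp, hvq, h3.concat h4.symm ?_, ?_, ?_, ?_, ?_, ?_⟩
    · intro x hx
      rcases hi ⟨Or.inr hx.1, Or.inr hx.2⟩ with rfl | rfl
      · exact absurd hx.1 hv3
      · rfl
    · intro x hx
      rcases hi ⟨Or.inl hx.1, Or.inl hx.2⟩ with rfl | rfl
      · rfl
      · have : x = p := h3i ⟨hx.1, h3.right_mem⟩
        exact absurd this.symm h3.ne
    · rintro x ⟨hx1, hx2 | hx2⟩
      · exact h3i ⟨hx1, hx2⟩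
      · rcases hi ⟨Or.inl hx1, Or.inr hx2⟩ with rfl | rfl
        · exact absurd hx2 hv4
        · exact h3i ⟨hx1, h3.right_mem⟩
    · rintro x ⟨hx1, hx2 | hx2⟩
      · rcases hi ⟨Or.inr hx2, Or.inl hx1⟩ with rfl | rfl
        · exact absurd hx2 hv3
        · exact h4i ⟨hx1, h4.right_mem⟩
      · exact h4i ⟨hx1, hx2⟩
    · rw [insert_union_distrib]
    · ext x; simp only [mem_union]; tauto

end Arc

/-! ### Swept regions and their glueing -/

section Region

variable {E : Type*} [NormedAddCommGroup E] [NormedSpace ℝ E]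

/-- A region `D` bounded by the polygon `P` with vertex set `V`, such that the image under `F` of
the rest of `P` can be swept across `F(D)` onto any edge, and the image of `P` is an unknot. -/
structure IsSweptRegion (F : E → EuclideanSpace ℝ (Fin 3)) (V P D : Set E) : Prop where
  isClosed : IsClosed D
  subset_hull : D ⊆ convexHull ℝ V
  boundary_subset : P ⊆ D
  isOpen : IsOpen (D \ P)
  halfDisc : ∀ x ∈ P, x ∉ V → ∃ n : E →L[ℝ] ℝ, ∀ᶠ w in 𝓝 (0 : E), 0 ≤ n w → x + w ∈ D
  sweep : ∀ u ∈ V, ∀ v ∈ V, ∀ B, u ≠ v → Disjoint (openSegment ℝ u v) V → IsClosed B →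
    u ∈ B → v ∈ B → segment ℝ u v ∩ B ⊆ {u, v} → P = segment ℝ u v ∪ B →
    ∀ R, IsClosed R → R ∩ F '' D ⊆ {F u, F v} →
    AmbientIsotopicRel R (F '' B) (F '' segment ℝ u v)
  unknot : IsUnknot (F '' P)

/-- Two bounded regions whose boundaries do not enter each other meet only along the common edge. -/
theorem inter_subset_of_boundary_disjoint {D₁ D₂ A₁ A₂ C : Set E} (hD₁ : IsCompact D₁)
    (hD₂ : IsCompact D₂) (h₁ : IsOpen (D₁ \ (A₁ ∪ C))) (h₂ : IsOpen (D₂ \ (A₂ ∪ C)))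
    (hA₁ : A₁ ∩ D₂ ⊆ C) (hA₂ : A₂ ∩ D₁ ⊆ C) (hC : IsClosed C) (hne : C.Nonempty) (hcv : Convex ℝ C) :
    D₁ ∩ D₂ ⊆ C := by
  rintro x ⟨hx1, hx2⟩
  by_contra hxC
  -- Separate `x` from `C` by `f`. Off `C` the overlap is open, so a maximum of `f` over the overlap
  -- is an interior one; that forces `f = 0`, against the separation.
  obtain ⟨f, r, hfC, hfx⟩ := geometric_hahn_banach_closed_point hcv hC hxC
  have e : (D₁ ∩ D₂) \ C = (D₁ \ (A₁ ∪ C)) ∩ (D₂ \ (A₂ ∪ C)) := by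
    ext y
    constructor
    · rintro ⟨⟨h1, h2⟩, h3⟩
      exact ⟨⟨h1, fun h => h.elim (fun h => h3 (hA₁ ⟨h, h2⟩)) h3⟩,
        ⟨h2, fun h => h.elim (fun h => h3 (hA₂ ⟨h, h1⟩)) h3⟩⟩
    · rintro ⟨⟨h1, h2⟩, h3, h4⟩
      exact ⟨⟨h1, h3⟩, fun h => h2 (Or.inr h)⟩
  have hopen : IsOpen ((D₁ ∩ D₂) \ C) := e ▸ h₁.inter h₂
  obtain ⟨y, hy, hmax⟩ := (hD₁.inter hD₂).exists_isMaxOn ⟨x, hx1, hx2⟩ f.continuous.continuousOn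
  have hxy : f x ≤ f y := hmax ⟨hx1, hx2⟩
  have hyC : y ∉ C := fun h => by linarith [hfC y h]
  have hloc : IsLocalMax f y := by
    filter_upwards [hopen.mem_nhds ⟨hy, hyC⟩] with z hz using hmax hz.1
  have hf0 : f = 0 := by
    have := hloc.hasFDerivAt_eq_zero f.hasFDerivAt
    exact this
  rw [hf0] at hfx hfC
  obtain ⟨c, hc⟩ := hne
  have := hfC c hc
  simp at this hfx
  linarith

variable {F : E → EuclideanSpace ℝ (Fin 3)} {S V₁ V₂ A₁ A₂ D₁ D₂ : Set E} {b w : E}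

/-- The sweeping property of a region obtained by glueing two regions along a chord `bw`, for the
edges of the first region. -/
theorem sweep_glue (hF : ContinuousOn F S) (hinj : InjOn F S)
    (hA₁ : PolyArc b w V₁ A₁) (hA₂ : PolyArc b w V₂ A₂) (hA : A₁ ∩ A₂ ⊆ {b, w})
    (hd₁ : A₁ ∩ segment ℝ b w ⊆ {b, w}) (hd₂ : A₂ ∩ segment ℝ b w ⊆ {b, w})
    (hR₁ : IsSweptRegion F V₁ (A₁ ∪ segment ℝ b w) D₁)
    (hR₂ : IsSweptRegion F V₂ (A₂ ∪ segment ℝ b w) D₂)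
    (hD : D₁ ∩ D₂ ⊆ segment ℝ b w) (hS₁ : D₁ ⊆ S) (hS₂ : D₂ ⊆ S) {u v : E} {B : Set E}
    (hu : u ∈ V₁ ∪ V₂) (hv : v ∈ V₁ ∪ V₂) (huv : u ≠ v)
    (hdis : Disjoint (openSegment ℝ u v) (V₁ ∪ V₂)) (hB : IsClosed B) (huB : u ∈ B) (hvB : v ∈ B)
    (hi : segment ℝ u v ∩ B ⊆ {u, v}) (hP : A₁ ∪ A₂ = segment ℝ u v ∪ B)
    (he : segment ℝ u v ⊆ A₁) {R : Set (EuclideanSpace ℝ (Fin 3))} (hRc : IsClosed R)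
    (hR : R ∩ F '' (D₁ ∪ D₂) ⊆ {F u, F v}) :
    AmbientIsotopicRel R (F '' B) (F '' segment ℝ u v) := by
  have huA : u ∈ A₁ := he (left_mem_segment _ _ _)
  have hvA : v ∈ A₁ := he (right_mem_segment _ _ _)
  have hAD : ∀ {x}, x ∈ A₁ → x ∈ D₂ → x ∈ ({b, w} : Set E) := fun h1 h2 =>
    hd₁ ⟨h1, hD ⟨hR₁.boundary_subset (Or.inl h1), h2⟩⟩
  have hV : ∀ {x}, x ∈ A₁ → x ∈ V₁ ∪ V₂ → x ∈ V₁ := by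
    rintro x h1 (h | h)
    · exact h
    · rcases hA ⟨h1, hA₂.vertices_subset h⟩ with rfl | rfl
      exacts [hA₁.ends_mem.1, hA₁.ends_mem.2]
  have hend : ∀ {x}, x ∈ segment ℝ u v → x ∈ ({b, w} : Set E) → x ∈ ({u, v} : Set E) := by
    intro x hx hxb
    by_contra hne
    simp only [mem_insert_iff, mem_singleton_iff, not_or] at hne
    refine disjoint_left.1 hdis (mem_openSegment_of_ne_left_right (Ne.symm hne.1) (Ne.symm hne.2) hx)
      (Or.inl ?_)
    rcases hxb with rfl | rfl
    exacts [hA₁.ends_mem.1, hA₁.ends_mem.2]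
  have huvB : ({u, v} : Set E) ⊆ B := by rintro x (rfl | rfl) <;> assumption
  have hA₂B : A₂ ⊆ B := by
    intro x hx
    rcases hP.subset (Or.inr hx) with h | h
    · exact huvB (hend h (hA ⟨he h, hx⟩))
    · exact h
  have hbw := hA₁.ne
  have hdD₂ : segment ℝ b w ⊆ D₂ := subset_union_right.trans hR₂.boundary_subset
  have hA₁S : A₁ ⊆ S := (subset_union_left.trans hR₁.boundary_subset).trans hS₁
  have hB1 : IsCompact (B ∩ A₁) := hA₁.isCompact.inter_left hB
  have hBA : B = (B ∩ A₁) ∪ A₂ := by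
    ext x
    constructor
    · intro hx
      rcases hP.symm.subset (Or.inr hx) with h | h
      exacts [Or.inl ⟨hx, h⟩, Or.inr h]
    · rintro (h | h)
      exacts [h.1, hA₂B h]
  have hopen : Disjoint (openSegment ℝ b w) V₂ := by
    rw [disjoint_left]
    intro x hx hxV
    rcases hd₂ ⟨hA₂.vertices_subset hxV, openSegment_subset_segment _ _ _ hx⟩ with rfl | rfl
    · exact hbw (left_mem_openSegment_iff.1 hx)
    · exact hbw (right_mem_openSegment_iff.1 hx)
  -- First sweep `A₂` across `D₂` onto the chord, holding `R` and the rest of `B` still.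
  have s1 := ((hR₂.sweep b hA₂.ends_mem.1 w hA₂.ends_mem.2 A₂ hbw hopen hA₂.isCompact.isClosed
    hA₂.left_mem hA₂.right_mem (by rwa [inter_comm]) (union_comm _ _) (R ∪ F '' (B ∩ A₁))
    (hRc.union (hB1.image_of_continuousOn
      (hF.mono (inter_subset_right.trans hA₁S))).isClosed) ?_).union
    subset_union_right).mono subset_union_left
  · have hseg₁ : segment ℝ b w ⊆ D₁ := subset_union_right.trans hR₁.boundary_subset
    -- Then sweep the chord together with the rest of `B` across `D₁` onto `uv`.
    have s2 := hR₁.sweep u (hV huA hu) v (hV hvA hv) (segment ℝ b w ∪ (B ∩ A₁)) huv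
      (hdis.mono_right subset_union_left) (by
        refine IsClosed.union ?_ hB1.isClosed
        rw [← convexHull_pair]
        exact (toFinite _).isClosed_convexHull ℝ)
      (Or.inr ⟨huB, huA⟩) (Or.inr ⟨hvB, hvA⟩) (by
        rintro x ⟨hx, hx' | hx'⟩
        · exact hend hx (hd₁ ⟨he hx, hx'⟩)
        · exact hi ⟨hx, hx'.1⟩) (by
        ext x
        constructor
        · rintro (h | h)
          · rcases hP.subset (Or.inl h) with h' | h'
            exacts [Or.inl h', Or.inr (Or.inr ⟨h', h⟩)]
          · exact Or.inr (Or.inl h)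
        · rintro (h | h | h)
          exacts [Or.inl (he h), Or.inr h, Or.inl h.2]) R hRc
      (fun x hx => hR ⟨hx.1, image_mono subset_union_left hx.2⟩)
    rw [← image_union, ← image_union, union_comm, ← hBA] at s1
    exact s1.trans s2
  · rintro _ ⟨hx | hx, ⟨y, hy, rfl⟩⟩
    · have hyA : y ∈ A₁ := by
        rcases hR ⟨hx, mem_image_of_mem _ (Or.inr hy)⟩ with h | h
        · rwa [hinj (hS₂ hy) (hA₁S huA) h]
        · rwa [hinj (hS₂ hy) (hA₁S hvA) h]
      rcases hAD hyA hy with rfl | rfl <;> simp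
    · obtain ⟨z, hz, hzy⟩ := hx
      obtain rfl := hinj (hA₁S hz.2) (hS₂ hy) hzy
      rcases hAD hz.2 hy with rfl | rfl <;> simp

/-- At chord points that are not vertices the half-discs of the two regions face each other and fill
a neighbourhood, so the chord without its ends becomes interior. Sweeping `A₂` onto the chord
reduces the unknot claim to the first region. -/
theorem isSweptRegion_glue [FiniteDimensional ℝ E] (hE : 2 ≤ Module.finrank ℝ E)
    (hF : ContinuousOn F S) (hinj : InjOn F S)
    (hA₁ : PolyArc b w V₁ A₁) (hA₂ : PolyArc b w V₂ A₂) (hA : A₁ ∩ A₂ ⊆ {b, w})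
    (hd₁ : A₁ ∩ segment ℝ b w ⊆ {b, w}) (hd₂ : A₂ ∩ segment ℝ b w ⊆ {b, w})
    (hR₁ : IsSweptRegion F V₁ (A₁ ∪ segment ℝ b w) D₁)
    (hR₂ : IsSweptRegion F V₂ (A₂ ∪ segment ℝ b w) D₂)
    (hAD₁ : A₁ ∩ D₂ ⊆ segment ℝ b w) (hAD₂ : A₂ ∩ D₁ ⊆ segment ℝ b w)
    (hS₁ : D₁ ⊆ S) (hS₂ : D₂ ⊆ S) :
    IsSweptRegion F (V₁ ∪ V₂) (A₁ ∪ A₂) (D₁ ∪ D₂) := by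
  have hbw := hA₁.ne
  have hcomp : IsCompact (segment ℝ b w) := by
    rw [← convexHull_pair]
    exact (toFinite _).isCompact_convexHull ℝ
  have hc₁ : IsCompact D₁ := (hA₁.finite.isCompact_convexHull ℝ).of_isClosed_subset
    hR₁.isClosed hR₁.subset_hull
  have hc₂ : IsCompact D₂ := (hA₂.finite.isCompact_convexHull ℝ).of_isClosed_subset
    hR₂.isClosed hR₂.subset_hull
  have hD : D₁ ∩ D₂ ⊆ segment ℝ b w := inter_subset_of_boundary_disjoint hc₁ hc₂ hR₁.isOpen
    hR₂.isOpen hAD₁ hAD₂ hcomp.isClosed ⟨b, left_mem_segment _ _ _⟩ (convex_segment _ _)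
  have hsub₁ : A₁ ⊆ D₁ := subset_union_left.trans hR₁.boundary_subset
  have hsub₂ : A₂ ⊆ D₂ := subset_union_left.trans hR₂.boundary_subset
  have hPc : IsClosed (A₁ ∪ A₂) := (hA₁.isCompact.union hA₂.isCompact).isClosed
  have hint : interior (segment ℝ b w) = ∅ := by
    rw [← convexHull_pair, ← not_nonempty_iff_eq_empty,
      interior_convexHull_nonempty_iff_affineSpan_eq_top]
    intro htop
    have h1 : vectorSpan ℝ ({b, w} : Set E) = ⊤ := by
      rw [← direction_affineSpan, htop, AffineSubspace.direction_top]
    have h2 := collinear_iff_finrank_le_one.1 (collinear_pair ℝ b w)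
    rw [h1, finrank_top] at h2
    omega
  have hnhds : ∀ x ∈ segment ℝ b w, x ∉ V₁ → x ∉ V₂ → D₁ ∪ D₂ ∈ 𝓝 x := by
    intro x hx hx1 hx2
    obtain ⟨n₁, h1⟩ := hR₁.halfDisc x (Or.inr hx) hx1
    obtain ⟨n₂, h2⟩ := hR₂.halfDisc x (Or.inr hx) hx2
    have h12 := h1.and h2
    -- If both functionals were positive at some vector, the overlap would contain an open set, but
    -- it lies in a segment, whose interior is empty in dimension at least 2.
    have hpos : ∀ w', ¬ (0 < n₁ w' ∧ 0 < n₂ w') := by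
      rintro w' ⟨hw1, hw2⟩
      have ho : IsOpen {w : E | 0 < n₁ w ∧ 0 < n₂ w} :=
        (isOpen_lt continuous_const n₁.continuous).inter
          (isOpen_lt continuous_const n₂.continuous)
      have ht : Tendsto (fun t : ℝ => t • w') (𝓝[>] 0) (𝓝 0) := by
        have : Continuous fun t : ℝ => t • w' := by fun_prop
        have := this.tendsto 0
        rw [zero_smul] at this
        exact this.mono_left nhdsWithin_le_nhds
      obtain ⟨t, ht1, ht2⟩ := ((ht.eventually h12.eventually_nhds).and self_mem_nhdsWithin).exists
      have ht2 : 0 < t := ht2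
      have hmem : t • w' ∈ {w : E | 0 < n₁ w ∧ 0 < n₂ w} := by
        refine ⟨?_, ?_⟩ <;> simp only [map_smul, smul_eq_mul] <;> positivity
      have hev : ∀ᶠ z in 𝓝 (t • w'), x + z ∈ segment ℝ b w := by
        filter_upwards [ht1, ho.mem_nhds hmem] with z hz hz'
        exact hD ⟨hz.1 hz'.1.le, hz.2 hz'.2.le⟩
      have : x + t • w' ∈ interior (segment ℝ b w) := by
        rw [mem_interior_iff_mem_nhds]
        have hm : Tendsto (fun z => z - x) (𝓝 (x + t • w')) (𝓝 (t • w')) := by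
          have : Continuous fun z : E => z - x := by fun_prop
          have := this.tendsto (x + t • w')
          rwa [add_sub_cancel_left] at this
        filter_upwards [hm.eventually hev] with z hz
        simpa using hz
      rw [hint] at this
      exact this
    have hev : ∀ᶠ z in 𝓝 (0 : E), x + z ∈ D₁ ∪ D₂ := by
      filter_upwards [h12] with z hz
      rcases le_or_gt 0 (n₁ z) with h | h
      · exact Or.inl (hz.1 h)
      rcases le_or_gt 0 (n₂ z) with h' | h'
      · exact Or.inr (hz.2 h')
      -- A vector on which both are negative is excluded by applying `hpos` to its opposite.
      · exact absurd ⟨by simpa using h, by simpa using h'⟩ (hpos (-z))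
    have hm : Tendsto (fun z => z - x) (𝓝 x) (𝓝 0) := by
      have : Continuous fun z : E => z - x := by fun_prop
      have := this.tendsto x
      rwa [sub_self] at this
    filter_upwards [hm.eventually hev] with z hz
    simpa using hz
  refine ⟨hR₁.isClosed.union hR₂.isClosed, ?_, union_subset_union hsub₁ hsub₂, ?_, ?_, ?_, ?_⟩
  · exact union_subset (hR₁.subset_hull.trans (convexHull_mono subset_union_left))
      (hR₂.subset_hull.trans (convexHull_mono subset_union_right))
  · rw [isOpen_iff_mem_nhds]
    rintro x ⟨hxD, hxP⟩
    by_cases hxd : x ∈ segment ℝ b w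
    · refine inter_mem (hnhds x hxd (fun h => hxP (Or.inl (hA₁.vertices_subset h)))
        (fun h => hxP (Or.inr (hA₂.vertices_subset h)))) (hPc.isOpen_compl.mem_nhds hxP)
    · rcases hxD with h | h
      · have := hR₁.isOpen.mem_nhds ⟨h, fun h' => h'.elim (fun h' => hxP (Or.inl h')) hxd⟩
        filter_upwards [this] with y hy
        refine ⟨Or.inl hy.1, ?_⟩
        rintro (h' | h')
        · exact hy.2 (Or.inl h')
        · exact hy.2 (Or.inr (hAD₂ ⟨h', hy.1⟩))
      · have := hR₂.isOpen.mem_nhds ⟨h, fun h' => h'.elim (fun h' => hxP (Or.inr h')) hxd⟩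
        filter_upwards [this] with y hy
        refine ⟨Or.inr hy.1, ?_⟩
        rintro (h' | h')
        · exact hy.2 (Or.inr (hAD₁ ⟨h', hy.1⟩))
        · exact hy.2 (Or.inl h')
  · rintro x (hx | hx) hxV
    · obtain ⟨n, hn⟩ := hR₁.halfDisc x (Or.inl hx) fun h => hxV (Or.inl h)
      exact ⟨n, hn.mono fun w hw h => Or.inl (hw h)⟩
    · obtain ⟨n, hn⟩ := hR₂.halfDisc x (Or.inl hx) fun h => hxV (Or.inr h)
      exact ⟨n, hn.mono fun w hw h => Or.inr (hw h)⟩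
  · intro u hu v hv B huv hdis hB huB hvB hi hP R hRc hR
    -- An edge lying partly on each arc would, by connectedness, contain `b` or `w` in its relative
    -- interior, and these are vertices.
    have hcases : segment ℝ u v ⊆ A₁ ∨ segment ℝ u v ⊆ A₂ := by
      have hsub : openSegment ℝ u v ⊆ A₁ ∪ A₂ := by
        rw [hP]; exact (openSegment_subset_segment _ _ _).trans subset_union_left
      have hcl : ∀ A : Set E, IsClosed A → openSegment ℝ u v ⊆ A → segment ℝ u v ⊆ A := by
        intro A hA h
        rw [← closure_openSegment]
        exact hA.closure_subset_iff.2 h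
      by_contra! hcon
      have h1 : (openSegment ℝ u v ∩ A₂).Nonempty := by
        by_contra hne
        refine hcon.1 (hcl _ hA₁.isCompact.isClosed fun x hx => (hsub hx).resolve_right fun h =>
          hne ⟨x, hx, h⟩)
      have h2 : (openSegment ℝ u v ∩ A₁).Nonempty := by
        by_contra hne
        refine hcon.2 (hcl _ hA₂.isCompact.isClosed fun x hx => (hsub hx).resolve_left fun h =>
          hne ⟨x, hx, h⟩)
      obtain ⟨x, hx, hx'⟩ := isPreconnected_closed_iff.1 (convex_openSegment u v).isPreconnected
        A₁ A₂ hA₁.isCompact.isClosed hA₂.isCompact.isClosed hsub h2 h1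
      refine disjoint_left.1 hdis hx (Or.inl ?_)
      rcases hA hx' with rfl | rfl
      exacts [hA₁.ends_mem.1, hA₁.ends_mem.2]
    rcases hcases with he | he
    · exact sweep_glue hF hinj hA₁ hA₂ hA hd₁ hd₂ hR₁ hR₂ hD hS₁ hS₂ hu hv huv hdis hB huB hvB hi
        hP he hRc hR
    · exact sweep_glue hF hinj hA₂ hA₁ (by rwa [inter_comm]) hd₂ hd₁ hR₂ hR₁ (by rwa [inter_comm])
        hS₂ hS₁ (by rwa [union_comm]) (by rwa [union_comm]) huv (by rwa [union_comm]) hB huB hvB hi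
        (by rwa [union_comm]) he hRc (by rwa [union_comm])
  · have hopen : Disjoint (openSegment ℝ b w) V₂ := by
      rw [disjoint_left]
      intro x hx hxV
      rcases hd₂ ⟨hA₂.vertices_subset hxV, openSegment_subset_segment _ _ _ hx⟩ with rfl | rfl
      · exact hbw (left_mem_openSegment_iff.1 hx)
      · exact hbw (right_mem_openSegment_iff.1 hx)
    have s1 := (hR₂.sweep b hA₂.ends_mem.1 w hA₂.ends_mem.2 A₂ hbw hopen hA₂.isCompact.isClosed
      hA₂.left_mem hA₂.right_mem (by rwa [inter_comm]) (union_comm _ _) (F '' A₁)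
      (hA₁.isCompact.image_of_continuousOn (hF.mono (hsub₁.trans hS₁))).isClosed (by
        rintro _ ⟨⟨z, hz, rfl⟩, y, hy, hzy⟩
        obtain rfl := hinj (hS₂ hy) (hS₁ (hsub₁ hz)) hzy
        rcases hd₁ ⟨hz, hD ⟨hsub₁ hz, hy⟩⟩ with rfl | rfl <;> simp)).union Subset.rfl
    rw [← image_union, ← image_union, union_comm, union_comm (segment ℝ b w)] at s1
    exact ((s1.mono (empty_subset _)).trans
      (AmbientIsotopicRel.of_ambientIsotopic hR₁.unknot)).ambientIsotopic

end Region

/-! ### Triangles in the plane -/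

section Plane

variable {E : Type*} [NormedAddCommGroup E] [NormedSpace ℝ E]

theorem ContinuousLinearMap.map_combination_sub (l : E →L[ℝ] ℝ) (b p q : E) {s t : ℝ}
    (h : s + t = 1) : l (s • p + t • q - b) = s * l (p - b) + t * l (q - b) := by
  have : s • p + t • q - b = s • (p - b) + t • (q - b) := by
    obtain rfl : s = 1 - t := by linarith
    module
  rw [this, map_add, map_smul, map_smul, smul_eq_mul, smul_eq_mul]

/-- Barycentric coordinates with respect to a nondegenerate triangle in the plane. -/
theorem exists_barycentric (hE : Module.finrank ℝ E = 2) {a b c : E}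
    (h : LinearIndependent ℝ ![b - a, c - a]) : ∃ β γ : E →L[ℝ] ℝ,
      (∀ v, β v • (b - a) + γ v • (c - a) = v) ∧
      (β (b - a) = 1 ∧ γ (b - a) = 0 ∧ β (c - a) = 0 ∧ γ (c - a) = 1) ∧
      (∀ x, x ∈ convexHull ℝ {a, b, c} ↔
        0 ≤ β (x - a) ∧ 0 ≤ γ (x - a) ∧ β (x - a) + γ (x - a) ≤ 1) ∧
      (∀ x, x ∈ segment ℝ a b ↔ 0 ≤ β (x - a) ∧ γ (x - a) = 0 ∧ β (x - a) ≤ 1) ∧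
      (∀ x, x ∈ segment ℝ a c ↔ 0 ≤ γ (x - a) ∧ β (x - a) = 0 ∧ γ (x - a) ≤ 1) ∧
      (∀ x, x ∈ segment ℝ b c ↔
        0 ≤ β (x - a) ∧ 0 ≤ γ (x - a) ∧ β (x - a) + γ (x - a) = 1) := by
  have : FiniteDimensional ℝ E := .of_finrank_pos (by omega)
  let B := basisOfLinearIndependentOfCardEqFinrank h (by simp [hE])
  have hB0 : B 0 = b - a := by simp [B]
  have hB1 : B 1 = c - a := by simp [B]
  let β : E →L[ℝ] ℝ := LinearMap.toContinuousLinearMap (B.coord 0)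
  let γ : E →L[ℝ] ℝ := LinearMap.toContinuousLinearMap (B.coord 1)
  have hv : ∀ v, β v • (b - a) + γ v • (c - a) = v := fun v => by
    have := B.sum_repr v
    rw [Fin.sum_univ_two, hB0, hB1] at this
    exact this
  have h1 : β (b - a) = 1 := by simp [β, ← hB0]
  have h2 : γ (b - a) = 0 := by simp [γ, ← hB0]
  have h3 : β (c - a) = 0 := by simp [β, ← hB1]
  have h4 : γ (c - a) = 1 := by simp [γ, ← hB1]
  have hx : ∀ x, x = a + β (x - a) • (b - a) + γ (x - a) • (c - a) := fun x => by
    rw [add_assoc, hv, add_sub_cancel]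
  refine ⟨β, γ, hv, ⟨h1, h2, h3, h4⟩, fun x => ⟨fun hm => ?_, fun hm => ?_⟩,
    fun x => ⟨fun hm => ?_, fun hm => ?_⟩, fun x => ⟨fun hm => ?_, fun hm => ?_⟩,
    fun x => ⟨fun hm => ?_, fun hm => ?_⟩⟩
  · obtain ⟨p, q, r, hp, hq, hr, hs, rfl⟩ := mem_convexHull_triple.1 hm
    have e : p • a + q • b + r • c - a = q • (b - a) + r • (c - a) := by
      obtain rfl : p = 1 - q - r := by linarith
      module
    simp only [e, map_add, map_smul, h1, h2, h3, h4, smul_eq_mul]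
    exact ⟨by linarith, by linarith, by linarith⟩
  · refine mem_convexHull_triple.2 ⟨1 - β (x - a) - γ (x - a), β (x - a), γ (x - a), by linarith,
      hm.1, hm.2.1, by ring, ?_⟩
    nth_rewrite 5 [hx x]
    module
  · obtain ⟨s, t, hs, ht, hst, rfl⟩ := hm
    simp only [ContinuousLinearMap.map_combination_sub _ _ _ _ hst, h1, h2, sub_self, map_zero]
    exact ⟨by linarith, by ring, by linarith⟩
  · refine ⟨1 - β (x - a), β (x - a), by linarith, hm.1, by ring, ?_⟩
    nth_rewrite 3 [hx x]
    rw [hm.2.1]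
    module
  · obtain ⟨s, t, hs, ht, hst, rfl⟩ := hm
    simp only [ContinuousLinearMap.map_combination_sub _ _ _ _ hst, h3, h4, sub_self, map_zero]
    exact ⟨by linarith, by ring, by linarith⟩
  · refine ⟨1 - γ (x - a), γ (x - a), by linarith, hm.1, by ring, ?_⟩
    nth_rewrite 3 [hx x]
    rw [hm.2.1]
    module
  · obtain ⟨s, t, hs, ht, hst, rfl⟩ := hm
    simp only [ContinuousLinearMap.map_combination_sub _ _ _ _ hst, h1, h2, h3, h4]
    exact ⟨by linarith, by linarith, by linarith⟩
  · refine ⟨β (x - a), γ (x - a), hm.1, hm.2.1, hm.2.2, ?_⟩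
    nth_rewrite 3 [hx x]
    have : β (x - a) = 1 - γ (x - a) := by linarith
    rw [this]
    module

variable {F : E → EuclideanSpace ℝ (Fin 3)} {a b c : E}

/-- The hypotheses force `B` to be the union of the other two sides, so this is the push from the
vertex `b`. -/
theorem IsTameTriangle.sweep_edge (hT : IsTameTriangle F a b c)
    (h : LinearIndependent ℝ ![b - a, c - a]) {B : Set E} (ha : a ∈ B) (hc : c ∈ B)
    (hi : segment ℝ a c ∩ B ⊆ {a, c})
    (hP : segment ℝ a b ∪ segment ℝ b c ∪ segment ℝ c a = segment ℝ a c ∪ B)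
    {R : Set (EuclideanSpace ℝ (Fin 3))} (hRc : IsClosed R)
    (hR : R ∩ F '' convexHull ℝ {a, b, c} ⊆ {F a, F c}) :
    AmbientIsotopicRel R (F '' B) (F '' segment ℝ a c) := by
  have h1 := segment_inter_segment_of_linearIndependent h
  have h2 := segment_inter_segment_of_linearIndependent (linearIndependent_triangle_swap h)
  have e : B = segment ℝ a b ∪ segment ℝ b c := by
    ext x
    constructor
    · intro hx
      rcases hP.symm.subset (Or.inr hx) with h' | h'
      · exact h'
      · rw [segment_symm] at h'
        rcases hi ⟨h', hx⟩ with rfl | rfl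
        · exact Or.inl (left_mem_segment _ _ _)
        · exact Or.inr (right_mem_segment _ _ _)
    · intro hx
      rcases hP.subset (Or.inl hx) with h' | h'
      · rcases hx with hx | hx
        · rwa [h1 ⟨hx, h'⟩]
        · rw [segment_symm] at hx h'
          rwa [h2 ⟨hx, h'⟩]
      · exact h'
  rw [e]
  exact hT.push_mid R hRc hR

/-- The base case of the induction. The triangle is given by three linear inequalities, strict in
its interior; at a point inside an edge two of them stay strict nearby, and the third supplies the
half-disc. -/
theorem IsTameTriangle.isSweptRegion (hE : Module.finrank ℝ E = 2) (hT : IsTameTriangle F a b c)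
    (h : LinearIndependent ℝ ![b - a, c - a]) :
    IsSweptRegion F {a, b, c} (segment ℝ a b ∪ segment ℝ b c ∪ segment ℝ c a)
      (convexHull ℝ {a, b, c}) := by
  obtain ⟨β, γ, -, -, hmem, hab, hac, hbc⟩ := exists_barycentric hE h
  have hcv := convex_convexHull ℝ ({a, b, c} : Set E)
  have ha := left_mem_triangle a b c
  have hb := mid_mem_triangle a b c
  have hc := right_mem_triangle a b c
  refine ⟨(toFinite _).isClosed_convexHull ℝ, Subset.rfl,
    union_subset (union_subset (hcv.segment_subset ha hb) (hcv.segment_subset hb hc))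
      (hcv.segment_subset hc ha), ?_, ?_, ?_, hT.unknot⟩
  · have e : convexHull ℝ {a, b, c} \ (segment ℝ a b ∪ segment ℝ b c ∪ segment ℝ c a) =
        {x | 0 < β (x - a)} ∩ {x | 0 < γ (x - a)} ∩ {x | β (x - a) + γ (x - a) < 1} := by
      ext x
      rw [segment_symm ℝ c a]
      simp only [Set.mem_sdiff, mem_union, hmem, hab, hac, hbc, mem_inter_iff, mem_ofPred_eq, not_or]
      constructor
      · rintro ⟨⟨h1, h2, h3⟩, ⟨h4, h5⟩, h6⟩
        refine ⟨⟨h1.lt_of_ne' fun h0 => h6 ⟨h2, h0, by linarith⟩,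
          h2.lt_of_ne' fun h0 => h4 ⟨h1, h0, by linarith⟩⟩, h3.lt_of_ne fun h0 => h5 ⟨h1, h2, h0⟩⟩
      · rintro ⟨⟨h1, h2⟩, h3⟩
        exact ⟨⟨h1.le, h2.le, h3.le⟩, ⟨fun h0 => h2.ne' h0.2.1, fun h0 => h3.ne h0.2.2⟩,
          fun h0 => h1.ne' h0.2.1⟩
    rw [e]
    exact ((isOpen_lt (by fun_prop) (by fun_prop)).inter
      (isOpen_lt (by fun_prop) (by fun_prop))).inter (isOpen_lt (by fun_prop) (by fun_prop))
  · intro x hx hxV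
    simp only [mem_insert_iff, mem_singleton_iff, not_or] at hxV
    have hev : ∀ l : E →L[ℝ] ℝ, ∀ r : ℝ, 0 < r → ∀ᶠ w in 𝓝 (0 : E), 0 < r + l w := by
      intro l r hr
      have : Continuous fun w => r + l w := by fun_prop
      have := this.tendsto 0
      rw [map_zero, add_zero] at this
      exact this.eventually_const_lt hr
    have hadd : ∀ l : E →L[ℝ] ℝ, ∀ w, l (x + w - a) = l (x - a) + l w := fun l w => by
      rw [add_sub_right_comm, map_add]
    have key : ∀ p q : E, x ∈ segment ℝ p q → p ≠ x → q ≠ x →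
        ∃ s t : ℝ, 0 < s ∧ 0 < t ∧ s + t = 1 ∧ s • p + t • q = x := by
      intro p q hpq hp hq
      obtain ⟨s, t, hs, ht, hst, hx⟩ := mem_openSegment_of_ne_left_right hp hq hpq
      exact ⟨s, t, hs, ht, hst, hx⟩
    obtain ⟨-, -, hv, -⟩ := exists_barycentric hE h
    rcases hx with (hx | hx) | hx
    · have h1 := (hab x).1 hx
      have h2 : 0 < β (x - a) := h1.1.lt_of_ne' fun h0 => hxV.1 <| by
        have := (hac x).2 ⟨by rw [h1.2.1], h0, by rw [h1.2.1]; norm_num⟩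
        exact segment_inter_segment_of_linearIndependent h ⟨hx, this⟩
      have h3 : β (x - a) < 1 := h1.2.2.lt_of_ne fun h0 => hxV.2.1 <| by
        have := (hbc x).2 ⟨h1.1, by rw [h1.2.1], by rw [h0, h1.2.1, add_zero]⟩
        exact segment_inter_segment_of_linearIndependent (linearIndependent_triangle_rotate h)
          ⟨this, by rwa [segment_symm]⟩
      refine ⟨γ, ?_⟩
      filter_upwards [hev β _ h2, hev (-(β + γ)) (1 - β (x - a)) (by linarith)] with w hw1 hw2 hw
      simp only [neg_apply, add_apply] at hw2
      rw [hmem, hadd, hadd, h1.2.1]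
      exact ⟨hw1.le, by linarith, by linarith⟩
    · have h1 := (hbc x).1 hx
      have h2 : 0 < β (x - a) := h1.1.lt_of_ne' fun h0 => hxV.2.2 <| by
        have := (hac x).2 ⟨h1.2.1, h0, by linarith⟩
        exact segment_inter_segment_of_linearIndependent (linearIndependent_triangle_swap h)
          ⟨by rwa [segment_symm], by rwa [segment_symm]⟩
      have h3 : 0 < γ (x - a) := h1.2.1.lt_of_ne' fun h0 => hxV.2.1 <| by
        have := (hab x).2 ⟨h1.1, h0, by linarith⟩
        exact segment_inter_segment_of_linearIndependent (linearIndependent_triangle_rotate h)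
          ⟨hx, by rwa [segment_symm]⟩
      refine ⟨-(β + γ), ?_⟩
      filter_upwards [hev β _ h2, hev γ _ h3] with w hw1 hw2 hw
      simp only [neg_apply, add_apply] at hw
      rw [hmem, hadd, hadd]
      exact ⟨hw1.le, hw2.le, by linarith [h1.2.2]⟩
    · rw [segment_symm] at hx
      have h1 := (hac x).1 hx
      have h2 : 0 < γ (x - a) := h1.1.lt_of_ne' fun h0 => hxV.1 <| by
        have := (hab x).2 ⟨by rw [h1.2.1], h0, by rw [h1.2.1]; norm_num⟩
        exact segment_inter_segment_of_linearIndependent h ⟨this, hx⟩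
      have h3 : γ (x - a) < 1 := h1.2.2.lt_of_ne fun h0 => hxV.2.2 <| by
        have := (hbc x).2 ⟨by rw [h1.2.1], h1.1, by rw [h0, h1.2.1, zero_add]⟩
        exact segment_inter_segment_of_linearIndependent (linearIndependent_triangle_swap h)
          ⟨by rwa [segment_symm], by rwa [segment_symm]⟩
      refine ⟨β, ?_⟩
      filter_upwards [hev γ _ h2, hev (-(β + γ)) (1 - γ (x - a)) (by linarith)] with w hw1 hw2 hw
      simp only [neg_apply, add_apply] at hw2
      rw [hmem, hadd, hadd, h1.2.1]
      exact ⟨by linarith, hw1.le, by linarith⟩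
  · intro u hu v hv B huv _ _ huB hvB hi hP R hRc hR
    have h' := linearIndependent_triangle_rotate h
    have h'' := linearIndependent_triangle_rotate h'
    have e1 : ({b, c, a} : Set E) = {a, b, c} := by rw [pair_comm c a, insert_comm]
    have e2 : ({c, a, b} : Set E) = {a, b, c} := by rw [insert_comm, pair_comm c b]
    have P1 : segment ℝ b c ∪ segment ℝ c a ∪ segment ℝ a b =
        segment ℝ a b ∪ segment ℝ b c ∪ segment ℝ c a := by rw [union_comm, union_assoc]
    have P2 : segment ℝ c a ∪ segment ℝ a b ∪ segment ℝ b c =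
        segment ℝ a b ∪ segment ℝ b c ∪ segment ℝ c a := by rw [union_assoc, union_comm]
    have hi' : segment ℝ v u ∩ B ⊆ {v, u} := by rwa [segment_symm, pair_comm]
    have hP' := hP.trans (congrArg (· ∪ B) (segment_symm ℝ u v))
    have hR' : R ∩ F '' convexHull ℝ {a, b, c} ⊆ {F v, F u} := by rwa [pair_comm (F v)]
    rcases hu with rfl | rfl | rfl <;> rcases hv with rfl | rfl | rfl
    · exact absurd rfl huv
    · rw [segment_symm]
      exact hT.rotate.sweep_edge h' hvB huB hi' (P1.trans hP') hRc (by rwa [e1])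
    · exact hT.sweep_edge h huB hvB hi hP hRc hR
    · exact hT.rotate.sweep_edge h' huB hvB hi (by rw [P1, hP]) hRc (by rwa [e1])
    · exact absurd rfl huv
    · rw [segment_symm]
      exact hT.rotate.rotate.sweep_edge h'' hvB huB hi' (P2.trans hP') hRc (by rwa [e2])
    · rw [segment_symm]
      exact hT.sweep_edge h hvB huB hi' hP' hRc hR'
    · exact hT.rotate.rotate.sweep_edge h'' huB hvB hi (by rw [P2, hP]) hRc (by rwa [e2])
    · exact absurd rfl huv

end Plane

/-! ### Inside and outside; existence of a diagonal -/

/-- `D \ P` and the complement of `D` are disjoint open sets covering `X`. This takes the place of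
the Jordan curve theorem. -/
theorem IsPreconnected.disjoint_of_frontier {Y : Type*} [TopologicalSpace Y] {X D P : Set Y} (hX : IsPreconnected X)
    (hD : IsClosed D) (hDP : IsOpen (D \ P)) (hXP : Disjoint X P) {x : Y} (hx : x ∈ X)
    (hxD : x ∉ D) : Disjoint X D := by
  rw [disjoint_left]
  intro y hy hyD
  obtain ⟨z, -, hz1, hz2⟩ := hX (D \ P) Dᶜ hDP hD.isOpen_compl
    (fun z hz => (em (z ∈ D)).imp (fun h => ⟨h, disjoint_left.1 hXP hz⟩) id)
    ⟨y, hy, hyD, disjoint_left.1 hXP hy⟩ ⟨x, hx, hxD⟩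
  exact hz2 hz1.1

section Diagonal

variable {E : Type*} [NormedAddCommGroup E] [NormedSpace ℝ E]

/-- If the rest of a polygon enters the triangle at the vertex `b`, then `b` can be joined to
another vertex inside the triangle by a segment not meeting the rest of the polygon. -/
theorem PolyArc.exists_diagonal (hE : Module.finrank ℝ E = 2) {a b c : E} {V S : Set E}
    (h : PolyArc a c V S) (hLI : LinearIndependent ℝ ![a - b, c - b])
    (ha : _root_.segment ℝ b a ∩ S ⊆ {a}) (hc : _root_.segment ℝ b c ∩ S ⊆ {c}) (hV : V ≠ {a, c})
    {x : E} (hxS : x ∈ S) (hxT : x ∈ convexHull ℝ {b, a, c}) (hxa : x ≠ a) (hxc : x ≠ c) :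
    ∃ w ∈ V, w ≠ a ∧ w ≠ c ∧ w ∈ convexHull ℝ {b, a, c} ∧ _root_.segment ℝ b w ∩ S ⊆ {w} := by
  obtain ⟨α, γ, hv, ⟨h1, h2, h3, h4⟩, hmem, hba, hbc, hac⟩ := exists_barycentric hE hLI
  have hTc : IsCompact (S ∩ convexHull ℝ {b, a, c}) :=
    h.isCompact.inter ((toFinite _).isCompact_convexHull ℝ)
  -- Levels of `l` are the lines parallel to `ac`: 0 at `b` and 1 on `ac`. The point `x₀` of `S` in
  -- the triangle with lowest level is visible from `b`.
  obtain ⟨l, hl⟩ : ∃ l : E →L[ℝ] ℝ, l = α + γ := ⟨_, rfl⟩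
  have hlv : ∀ v, l v = α v + γ v := fun v => by rw [hl]; rfl
  obtain ⟨x₀, ⟨hx₀S, hx₀T⟩, hmin⟩ := hTc.exists_isMinOn ⟨x, hxS, hxT⟩
    (f := fun y => l (y - b)) (by fun_prop)
  have hmin : ∀ y ∈ S, y ∈ convexHull ℝ {b, a, c} → l (x₀ - b) ≤ l (y - b) := fun y h1 h2 =>
    hmin ⟨h1, h2⟩
  have hab : a ≠ b := fun e => by
    rw [e, sub_self, map_zero] at h1
    norm_num at h1
  have hbS : b ∉ S := fun hb => hab (ha ⟨left_mem_segment _ _ _, hb⟩).symm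
  have hla : l (a - b) = 1 := by rw [hlv, h1, h2, add_zero]
  have hlc : l (c - b) = 1 := by rw [hlv, h3, h4, zero_add]
  have hside : ∀ y ∈ S, y ∈ convexHull ℝ {b, a, c} → l (y - b) < 1 →
      0 < α (y - b) ∧ 0 < γ (y - b) := by
    intro y hyS hyT hy
    have hyT' := (hmem y).1 hyT
    refine ⟨hyT'.1.lt_of_ne' fun h0 => ?_, hyT'.2.1.lt_of_ne' fun h0 => ?_⟩
    · have := hc ⟨(hbc y).2 ⟨hyT'.2.1, h0, by linarith [hyT'.2.2]⟩, hyS⟩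
      rw [this, hlc] at hy
      exact lt_irrefl _ hy
    · have := ha ⟨(hba y).2 ⟨hyT'.1, h0, by linarith [hyT'.2.2]⟩, hyS⟩
      rw [this, hla] at hy
      exact lt_irrefl _ hy
  have hfin : ∀ w ∈ S, w ∈ convexHull ℝ {b, a, c} → l (w - b) ≤ l (x₀ - b) →
      _root_.segment ℝ b w ∩ S ⊆ {w} := by
    rintro w hwS hwT hw y ⟨⟨s, t, hs, ht, hst, rfl⟩, hyS⟩
    have hyT : s • b + t • w ∈ convexHull ℝ {b, a, c} :=
      (convex_convexHull ℝ _) (left_mem_triangle b a c) hwT hs ht hst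
    have h5 := hmin _ hyS hyT
    rw [l.map_combination_sub _ _ _ hst, sub_self, map_zero, mul_zero, zero_add] at h5
    have h6 : 0 < l (w - b) := by
      have hwT' := (hmem w).1 hwT
      rw [hlv]
      refine (add_nonneg hwT'.1 hwT'.2.1).lt_of_ne' fun h0 => hbS ?_
      have h7 : α (w - b) = 0 := by linarith [hwT'.1, hwT'.2.1]
      have h8 : γ (w - b) = 0 := by linarith [hwT'.1, hwT'.2.1]
      have := hv (w - b)
      rw [h7, h8, zero_smul, zero_smul, add_zero, eq_comm, sub_eq_zero] at this
      rwa [← this]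
    have h9 : t = 1 := le_antisymm (by linarith) (by
      by_contra! hlt
      nlinarith)
    have h10 : s = 0 := by linarith
    simp [h9, h10]
  have hx₀T' := (hmem x₀).1 hx₀T
  have hm1 : l (x₀ - b) ≤ 1 := by rw [hlv]; exact hx₀T'.2.2
  rcases hm1.lt_or_eq with hm | hm
  · by_cases hx₀V : x₀ ∈ V
    · exact ⟨x₀, hx₀V, fun e => by rw [e, hla] at hm; exact lt_irrefl _ hm,
        fun e => by rw [e, hlc] at hm; exact lt_irrefl _ hm, hx₀T, hfin _ hx₀S hx₀T le_rfl⟩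
    obtain ⟨p, hp, q, hq, hxpq, hsub, hdis⟩ := h.exists_edge hx₀S hx₀V
    -- On the edge through `x₀`, an affine function cannot exceed its value at `x₀` at both ends.
    have hpq : ∃ p ∈ V, _root_.segment ℝ x₀ p ⊆ S ∧ l (p - b) ≤ l (x₀ - b) := by
      have hx₀ := openSegment_subset_segment _ _ _ hxpq
      obtain ⟨s, t, hs, ht, hst, hx⟩ := hxpq
      have e : l (x₀ - b) = s * l (p - b) + t * l (q - b) := by
        rw [← hx]; exact l.map_combination_sub _ _ _ hst
      rcases le_or_gt (l (p - b)) (l (x₀ - b)) with h5 | h5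
      · exact ⟨p, hp, ((convex_segment _ _).segment_subset hx₀ (left_mem_segment _ _ _)).trans hsub,
          h5⟩
      · refine ⟨q, hq, ((convex_segment _ _).segment_subset hx₀ (right_mem_segment _ _ _)).trans hsub,
          ?_⟩
        by_contra! h6
        obtain rfl : s = 1 - t := by linarith
        nlinarith
    obtain ⟨p, hp, hsub, hlp⟩ := hpq
    -- Otherwise the edge would leave the triangle through `ba` or `bc` at a level below 1, where
    -- `hside` forbids points of `S`.
    have hpT : p ∈ convexHull ℝ {b, a, c} := by
      by_contra hpT
      have hneg : min (α (p - b)) (γ (p - b)) < 0 := by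
        by_contra! h0
        exact hpT ((hmem p).2 ⟨h0.trans (min_le_left _ _), h0.trans (min_le_right _ _), by
          rw [← hlv]; linarith⟩)
      have hpos : 0 < min (α (x₀ - b)) (γ (x₀ - b)) := by
        have := hside x₀ hx₀S hx₀T hm
        exact lt_min this.1 this.2
      obtain ⟨f, hf⟩ : ∃ f : ℝ → ℝ, ∀ t, f t =
        min (α ((1 - t) • x₀ + t • p - b)) (γ ((1 - t) • x₀ + t • p - b)) := ⟨_, fun _ => rfl⟩
      have hfc : Continuous f := by
        have : f = fun t => min (α ((1 - t) • x₀ + t • p - b)) (γ ((1 - t) • x₀ + t • p - b)) :=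
          funext hf
        rw [this]
        fun_prop
      have hf0 : 0 < f 0 := by rw [hf]; simpa using hpos
      have hf1 : f 1 < 0 := by rw [hf]; simpa using hneg
      obtain ⟨t, ht, hft⟩ := intermediate_value_Icc' zero_le_one hfc.continuousOn
        ⟨hf1.le, hf0.le⟩
      obtain ⟨y, hy⟩ : ∃ y, y = (1 - t) • x₀ + t • p := ⟨_, rfl⟩
      have hyS : y ∈ S := hsub ⟨1 - t, t, by linarith [ht.2], ht.1, by ring, hy.symm⟩
      have hly : l (y - b) ≤ l (x₀ - b) := by
        rw [hy, l.map_combination_sub _ _ _ (by ring)]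
        nlinarith [ht.1, ht.2]
      rw [hf, ← hy] at hft
      have hyT : y ∈ convexHull ℝ {b, a, c} := (hmem y).2 ⟨hft ▸ min_le_left _ _,
        hft ▸ min_le_right _ _, by rw [← hlv]; linarith⟩
      have := hside y hyS hyT (by linarith)
      exact (lt_min this.1 this.2).ne' hft
    exact ⟨p, hp, fun e => by rw [e, hla] at hlp; linarith, fun e => by rw [e, hlc] at hlp; linarith,
      hpT, hfin _ (h.vertices_subset hp) hpT hlp⟩
  -- Now `S` meets the triangle only in the side `ac`, and `x` is a point of it other than `a` and
  -- `c`.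
  · have hall : ∀ y ∈ S, y ∈ convexHull ℝ {b, a, c} → l (y - b) = 1 := fun y hyS hyT =>
      le_antisymm (by rw [hlv]; exact ((hmem y).1 hyT).2.2) (hm ▸ hmin y hyS hyT)
    have hfin' : ∀ w ∈ S, w ∈ convexHull ℝ {b, a, c} → _root_.segment ℝ b w ∩ S ⊆ {w} :=
      fun w hwS hwT => hfin w hwS hwT (by rw [hall w hwS hwT, hm])
    by_cases hxV : x ∈ V
    · exact ⟨x, hxV, hxa, hxc, hxT, hfin' x hxS hxT⟩
    have hlx := hall x hxS hxT
    rw [hlv] at hlx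
    have hxT' := (hmem x).1 hxT
    have hpt : ∀ y, α (y - b) + γ (y - b) = 1 → y = (1 - γ (y - b)) • a + γ (y - b) • c := by
      intro y hy
      have := hv (y - b)
      have e : α (y - b) = 1 - γ (y - b) := by linarith
      rw [e] at this
      linear_combination (norm := module) -this
    have hαx : 0 < α (x - b) := hxT'.1.lt_of_ne' fun h0 => hxc (by
      rw [hpt x hlx, show γ (x - b) = 1 by linarith]; simp)
    have hγx : 0 < γ (x - b) := hxT'.2.1.lt_of_ne' fun h0 => hxa (by
      rw [hpt x hlx, h0]; simp)
    obtain ⟨p, hp, q, hq, ⟨s, t, hs, ht, hst, hx⟩, hsub, hdis⟩ := h.exists_edge hxS hxV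
    -- An edge from `x` to a level below 1 would enter the triangle below `ac`. Hence the edge
    -- through `x` lies on the line `ac`.
    have hge : ∀ p, _root_.segment ℝ x p ⊆ S → 1 ≤ l (p - b) := by
      intro p hsub
      by_contra! hlt
      have hev : ∀ k : E →L[ℝ] ℝ, 0 < k (x - b) →
          ∀ᶠ r in 𝓝[>] (0 : ℝ), 0 < k ((1 - r) • x + r • p - b) := by
        intro k hk
        have hc : Continuous fun r : ℝ => k ((1 - r) • x + r • p - b) := by fun_prop
        have := hc.tendsto 0
        simp only [sub_zero, one_smul, zero_smul, add_zero] at this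
        exact (this.eventually_const_lt hk).filter_mono nhdsWithin_le_nhds
      have h1' : ∀ᶠ r in 𝓝[>] (0 : ℝ), r < 1 :=
        mem_nhdsWithin_of_mem_nhds (Iio_mem_nhds one_pos)
      obtain ⟨r, ⟨⟨hr1, hr2⟩, hr3⟩, hr4⟩ :=
        ((((hev α hαx).and (hev γ hγx)).and h1').and self_mem_nhdsWithin).exists
      have hr4 : 0 < r := hr4
      have hlr : l ((1 - r) • x + r • p - b) < 1 := by
        rw [l.map_combination_sub _ _ _ (by ring), hlv (x - b), hlx]
        nlinarith
      have hyS : (1 - r) • x + r • p ∈ S := hsub ⟨1 - r, r, by linarith, hr4.le, by ring, rfl⟩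
      have := hall _ hyS ((hmem _).2 ⟨hr1.le, hr2.le, by rw [← hlv]; exact hlr.le⟩)
      linarith
    have hxm : x ∈ _root_.segment ℝ p q := ⟨s, t, hs.le, ht.le, hst, hx⟩
    have hp1 := hge p (((convex_segment _ _).segment_subset hxm (left_mem_segment _ _ _)).trans hsub)
    have hq1 := hge q (((convex_segment _ _).segment_subset hxm (right_mem_segment _ _ _)).trans hsub)
    have hlxe : l (x - b) = s * l (p - b) + t * l (q - b) := by
      rw [← hx]; exact l.map_combination_sub _ _ _ hst
    rw [hlv (x - b), hlx] at hlxe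
    have hp2 : l (p - b) = 1 := by nlinarith
    have hq2 : l (q - b) = 1 := by nlinarith
    rw [hlv] at hp2 hq2
    have hγe : γ (x - b) = s * γ (p - b) + t * γ (q - b) := by
      rw [← hx]; exact γ.map_combination_sub _ _ _ hst
    have hin : ∀ w ∈ V, α (w - b) + γ (w - b) = 1 → 0 < γ (w - b) → γ (w - b) < 1 →
        ∃ w ∈ V, w ≠ a ∧ w ≠ c ∧ w ∈ convexHull ℝ {b, a, c} ∧ _root_.segment ℝ b w ∩ S ⊆ {w} := by
      intro w hw hw1 hw2 hw3
      have hwT : w ∈ convexHull ℝ {b, a, c} := (hmem w).2 ⟨by linarith, hw2.le, hw1.le⟩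
      exact ⟨w, hw, fun e => by rw [e, h2] at hw2; exact lt_irrefl _ hw2,
        fun e => by rw [e, h4] at hw3; exact lt_irrefl _ hw3, hwT,
        hfin' w (h.vertices_subset hw) hwT⟩
    by_cases hp3 : 0 < γ (p - b) ∧ γ (p - b) < 1
    · exact hin p hp hp2 hp3.1 hp3.2
    by_cases hq3 : 0 < γ (q - b) ∧ γ (q - b) < 1
    · exact hin q hq hq2 hq3.1 hq3.2
    exfalso
    -- With no end strictly between `a` and `c`, the edge covers `ac`; having no vertex inside, it
    -- equals `ac`, and the arc reduces to it, against `hV`.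
    have key : ∀ p q, p ∈ V → q ∈ V → _root_.segment ℝ p q ⊆ S → Disjoint (openSegment ℝ p q) V →
        α (p - b) + γ (p - b) = 1 → α (q - b) + γ (q - b) = 1 → γ (p - b) ≤ 0 → 1 ≤ γ (q - b) →
        False := by
      intro p q hp hq hsub hdis hp2 hq2 hp3 hq3
      have hD : 0 < γ (q - b) - γ (p - b) := by linarith
      have hon : ∀ r : ℝ, 0 ≤ r → r ≤ 1 → (1 - r) • a + r • c ∈ _root_.segment ℝ p q := by
        intro r hr0 hr1
        refine ⟨(γ (q - b) - r) / (γ (q - b) - γ (p - b)), (r - γ (p - b)) / (γ (q - b) - γ (p - b)),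
          div_nonneg (by linarith) hD.le, div_nonneg (by linarith) hD.le, by field_simp; ring, ?_⟩
        have ep := hpt p hp2
        have eq := hpt q hq2
        generalize γ (p - b) = gp at *
        generalize γ (q - b) = gq at *
        rw [ep, eq]
        match_scalars <;> field_simp <;> ring
      have hap := hon 0 le_rfl zero_le_one
      have hcq := hon 1 zero_le_one le_rfl
      simp only [sub_zero, one_smul, zero_smul, add_zero, sub_self, zero_add] at hap hcq
      have hend : ∀ y ∈ V, y ∈ _root_.segment ℝ p q → y = p ∨ y = q := by
        intro y hy hyp
        by_contra! hne
        exact disjoint_left.1 hdis (mem_openSegment_of_ne_left_right hne.1.symm hne.2.symm hyp) hy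
      have hac' := h.ne
      rcases hend a h.ends_mem.1 hap with rfl | rfl <;> rcases hend c h.ends_mem.2 hcq with rfl | rfl
      · exact hac' rfl
      · exact hV (h.eq_segment hsub hdis)
      · rw [_root_.segment_symm] at hsub
        rw [openSegment_symm] at hdis
        exact hV (h.eq_segment hsub hdis)
      · exact hac' rfl
    rcases le_or_gt (γ (p - b)) 0 with hp4 | hp4
    · refine key p q hp hq hsub hdis hp2 hq2 hp4 (not_lt.1 fun hq4 => hq3 ⟨?_, hq4⟩)
      by_contra! hq5
      linarith [mul_nonneg hs.le (neg_nonneg.2 hp4), mul_nonneg ht.le (neg_nonneg.2 hq5)]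
    · have hp5 : 1 ≤ γ (p - b) := not_lt.1 fun hlt => hp3 ⟨hp4, hlt⟩
      refine key q p hq hp (by rwa [_root_.segment_symm]) (by rwa [openSegment_symm]) hq2 hp2
        (not_lt.1 fun hq4 => hq3 ⟨hq4, ?_⟩) hp5
      by_contra! hq5
      linarith [mul_le_mul_of_nonneg_left hp5 hs.le, mul_le_mul_of_nonneg_left hq5 ht.le]

/-- Near an extremal vertex `b`, the region cut off by a diagonal `bw` avoids the edge on the
other side of the diagonal. -/
theorem exists_mem_segment_notMem {f k : E →L[ℝ] ℝ} {a b c w : E} {S D : Set E}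
    (hkw : k (w - b) = 0) (hka : 0 < k (a - b)) (hkc : k (c - b) ≤ 0) (hfw : f (w - b) < 0)
    (hD : IsClosed D) (hS : IsClosed S) (hb : b ∉ S)
    (hDf : ∀ x ∈ D, x ≠ b → f (x - b) < 0)
    (hDo : IsOpen (D \ (segment ℝ b c ∪ S ∪ segment ℝ b w))) :
    ∃ y ∈ segment ℝ b a, y ≠ b ∧ y ∉ D := by
  obtain ⟨r, hr, hball⟩ := Metric.isOpen_iff.1 hS.isOpen_compl b hb
  -- The half-ball at `b` on the side of `a` is connected and misses the boundary of `D`, so one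
  -- point outside `D` puts all of it outside.
  have hX : IsPreconnected ({x | 0 < k (x - b)} ∩ Metric.ball b r) := by
    refine Convex.isPreconnected (Convex.inter ?_ (convex_ball b r))
    have e : {x | 0 < k (x - b)} = {x | k b < k x} := by ext x; simp [map_sub]
    rw [e]
    exact convex_halfSpace_gt k.toLinearMap.isLinear (k b)
  have hXP : Disjoint ({x | 0 < k (x - b)} ∩ Metric.ball b r)
      (segment ℝ b c ∪ S ∪ segment ℝ b w) := by
    rw [disjoint_left]
    rintro x ⟨hx1, hx2⟩ ((⟨s, t, hs, ht, hst, rfl⟩ | hx) | ⟨s, t, hs, ht, hst, rfl⟩)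
    · rw [mem_ofPred_eq, k.map_combination_sub _ _ _ hst, sub_self, map_zero] at hx1
      nlinarith
    · exact hball hx2 hx
    · rw [mem_ofPred_eq, k.map_combination_sub _ _ _ hst, sub_self, map_zero, hkw] at hx1
      linarith
  have hsmall : ∀ v : E, ∀ᶠ t in 𝓝[>] (0 : ℝ), b + t • v ∈ Metric.ball b r := by
    intro v
    have hc : Continuous fun t : ℝ => b + t • v := by fun_prop
    have := hc.tendsto 0
    rw [zero_smul, add_zero] at this
    exact (this.eventually (Metric.ball_mem_nhds b hr)).filter_mono nhdsWithin_le_nhds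
  have hz : ∃ z ∈ {x | 0 < k (x - b)} ∩ Metric.ball b r, z ∉ D := by
    -- Correcting `a - b` along the diagonal gives a direction with `f v = 0`, in which `D` has no
    -- points near `b`, while `k` is still positive.
    obtain ⟨v, hv⟩ : ∃ v, v = (a - b) - (f (a - b) / f (w - b)) • (w - b) := ⟨_, rfl⟩
    have hfv : f v = 0 := by
      rw [hv, map_sub, map_smul, smul_eq_mul, div_mul_cancel₀ _ hfw.ne, sub_self]
    have hkv : k v = k (a - b) := by
      rw [hv, map_sub, map_smul, hkw, smul_zero, sub_zero]
    obtain ⟨t, ht, ht0⟩ := ((hsmall v).and self_mem_nhdsWithin).exists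
    have ht0 : 0 < t := ht0
    have hkz : 0 < k (b + t • v - b) := by
      rw [add_sub_cancel_left, map_smul, hkv, smul_eq_mul]; positivity
    refine ⟨b + t • v, ⟨hkz, ht⟩, fun hmem => ?_⟩
    have := hDf _ hmem (fun e => by rw [e, sub_self, map_zero] at hkz; exact lt_irrefl _ hkz)
    rw [add_sub_cancel_left, map_smul, hfv, smul_zero] at this
    exact lt_irrefl _ this
  obtain ⟨z, hzX, hzD⟩ := hz
  have hdis := hX.disjoint_of_frontier hD hDo hXP hzX hzD
  have h1' : ∀ᶠ t in 𝓝[>] (0 : ℝ), t < 1 := mem_nhdsWithin_of_mem_nhds (Iio_mem_nhds one_pos)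
  obtain ⟨t, ⟨ht, ht1⟩, ht0⟩ := (((hsmall (a - b)).and h1').and self_mem_nhdsWithin).exists
  have ht0 : 0 < t := ht0
  have hky : 0 < k (b + t • (a - b) - b) := by
    rw [add_sub_cancel_left, map_smul, smul_eq_mul]; positivity
  refine ⟨b + t • (a - b), ⟨1 - t, t, by linarith, ht0.le, by ring, by module⟩, fun e => ?_,
    disjoint_left.1 hdis ⟨hky, ht⟩⟩
  rw [e, sub_self, map_zero] at hky
  exact lt_irrefl _ hky

end Diagonal

/-! ### Extreme vertices and the induction on polygons -/

section Loop

/-- A point of largest norm is exposed by the inner product with itself: `⟪b, v - b⟫ ≥ 0` and `‖v‖ ≤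
‖b‖` give `‖b - v‖² ≤ 0`. -/
theorem Set.Finite.exists_extreme {E : Type*} [NormedAddCommGroup E] [InnerProductSpace ℝ E]
    {V : Set E} (hV : V.Finite) (hne : V.Nonempty) :
    ∃ b ∈ V, ∃ f : E →L[ℝ] ℝ, ∀ v ∈ V, v ≠ b → f (v - b) < 0 := by
  obtain ⟨b, hb, hmax⟩ := hV.exists_maximalFor (fun v => ‖v‖) V hne
  refine ⟨b, hb, innerSL ℝ b, fun v hv hvb => ?_⟩
  have h1 : ‖v‖ ≤ ‖b‖ := by
    rcases le_total ‖v‖ ‖b‖ with h | h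
    · exact h
    · exact hmax hv h
  by_contra! h2
  rw [innerSL_apply_apply, inner_sub_right, real_inner_self_eq_norm_sq] at h2
  have h3 := norm_sub_sq_real b v
  have h4 : ‖v‖ ^ 2 ≤ ‖b‖ ^ 2 := by gcongr
  have h5 : ‖b - v‖ ^ 2 ≤ 0 := by linarith
  have h6 : ‖b - v‖ = 0 := by
    have := sq_nonneg ‖b - v‖
    exact pow_eq_zero_iff two_ne_zero |>.1 (le_antisymm h5 this)
  exact hvb (sub_eq_zero.1 (norm_eq_zero.1 h6)).symm

variable {E : Type*} [NormedAddCommGroup E] [NormedSpace ℝ E]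

theorem map_sub_neg_of_mem_convexHull {f : E →L[ℝ] ℝ} {b : E} {W : Set E}
    (h : ∀ v ∈ W, f (v - b) < 0) : ∀ x ∈ convexHull ℝ W, f (x - b) < 0 := by
  have e : {x | f (x - b) < 0} = {x | f x < f b} := by ext x; simp [map_sub]
  refine convexHull_min (s := W) (t := {x | f (x - b) < 0}) h ?_
  rw [e]
  exact convex_halfSpace_lt f.toLinearMap.isLinear (f b)

theorem map_sub_neg_of_mem_convexHull_insert {f : E →L[ℝ] ℝ} {b : E} {W : Set E}
    (h : ∀ v ∈ W, v ≠ b → f (v - b) < 0) : ∀ x ∈ convexHull ℝ W, x ≠ b → f (x - b) < 0 := by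
  intro x hx hxb
  have hx' : x ∈ convexHull ℝ (insert b (W \ {b})) := by
    rw [insert_sdiff_singleton]
    exact convexHull_mono (subset_insert _ _) hx
  rcases (W \ {b}).eq_empty_or_nonempty with h0 | h0
  · rw [h0, insert_empty_eq, convexHull_singleton] at hx'
    exact absurd hx' hxb
  rw [convexHull_insert h0, mem_convexJoin] at hx'
  obtain ⟨b', rfl, y, hy, s, t, hs, ht, hst, rfl⟩ := hx'
  have h1 := map_sub_neg_of_mem_convexHull (fun v hv => h v hv.1 hv.2) y hy
  rw [f.map_combination_sub _ _ _ hst, sub_self, map_zero, mul_zero, zero_add]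
  have ht' : t ≠ 0 := by
    rintro rfl
    apply hxb
    rw [show s = 1 by linarith]
    simp
  exact mul_neg_of_pos_of_neg (ht.lt_of_ne' ht') h1

/-- Both edges point into `f < 0`, so if dependent they have the same direction and the shorter one
lies in the longer. -/
theorem linearIndependent_of_segment_inter {f : E →L[ℝ] ℝ} {a b c : E} (hab : a ≠ b)
    (hfa : f (a - b) < 0) (hfc : f (c - b) < 0) (h : segment ℝ b a ∩ segment ℝ b c ⊆ {b}) :
    LinearIndependent ℝ ![a - b, c - b] := by
  rw [LinearIndependent.pair_iff]
  intro s t hst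
  by_contra hne
  have e := congrArg f hst
  simp only [map_add, map_smul, smul_eq_mul, map_zero] at e
  have ht0 : t ≠ 0 := by
    rintro rfl
    have : s = 0 := by
      rcases mul_eq_zero.1 (by linarith : s * f (a - b) = 0) with h | h
      · exact h
      · exact absurd h hfa.ne
    exact hne ⟨this, rfl⟩
  have hs0 : s ≠ 0 := by
    rintro rfl
    rcases mul_eq_zero.1 (by linarith : t * f (c - b) = 0) with h | h
    · exact ht0 h
    · exact hfc.ne h
  obtain ⟨k, hk⟩ : ∃ k, k = -t / s := ⟨_, rfl⟩
  have hk1 : a - b = k • (c - b) := by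
    have : s • (a - b - k • (c - b)) = 0 := by
      rw [← hst, hk]
      match_scalars <;> field_simp; ring
    rcases smul_eq_zero.1 this with h | h
    · exact absurd h hs0
    · exact sub_eq_zero.1 h
  have hk0 : 0 < k := by
    have := congrArg f hk1
    rw [map_smul, smul_eq_mul] at this
    by_contra! h0
    nlinarith
  rcases le_total k 1 with hk2 | hk2
  · refine hab (h ⟨right_mem_segment _ _ _, 1 - k, k, by linarith, hk0.le, by ring, ?_⟩)
    linear_combination (norm := module) -hk1
  · have hcb : c = b := h ⟨⟨1 - 1 / k, 1 / k, by
      rw [sub_nonneg, div_le_one hk0]; exact hk2, by positivity, by ring, by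
      rw [sub_eq_iff_eq_add.1 hk1]
      match_scalars <;> field_simp; ring⟩, right_mem_segment _ _ _⟩
    rw [hcb, sub_self, map_zero] at hfc
    exact lt_irrefl _ hfc

end Loop

section LoopTheorem

section Chord

variable {E : Type*} [NormedAddCommGroup E] [NormedSpace ℝ E]

theorem PolyArc.polyLoop {a c : E} {V S : Set E} (h : PolyArc a c V S)
    (hS : S ∩ _root_.segment ℝ a c ⊆ {a, c}) : PolyLoop V (S ∪ _root_.segment ℝ a c) :=
  ⟨a, c, V, {a, c}, S, _root_.segment ℝ a c, h, .segment h.ne, hS, by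
    rw [eq_comm, union_eq_left]
    exact pair_subset h.ends_mem.1 h.ends_mem.2, rfl⟩

variable {F : E → EuclideanSpace ℝ (Fin 3)} {f k : E →L[ℝ] ℝ} {a b c w : E} {V₁ V₂ S₁ S₂ D : Set E}

/-- The part of a polygon on one side of a diagonal from an extremal vertex stays outside the
region bounded by the part on the other side. -/
theorem inter_subset_of_diagonal (h₁ : PolyArc b w V₁ (segment ℝ b a ∪ S₁))
    (h₂ : PolyArc c w V₂ S₂) (hb : b ∉ S₂) (hba : b ≠ a)
    (hA : (segment ℝ b a ∪ S₁) ∩ (segment ℝ b c ∪ S₂) ⊆ {b, w})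
    (hd : (segment ℝ b a ∪ S₁) ∩ segment ℝ b w ⊆ {b, w})
    (hf : ∀ v ∈ insert b V₂, v ≠ b → f (v - b) < 0)
    (hkw : k (w - b) = 0) (hka : 0 < k (a - b)) (hkc : k (c - b) ≤ 0)
    (hR : IsSweptRegion F (insert b V₂) (segment ℝ b c ∪ S₂ ∪ segment ℝ b w) D) :
    (segment ℝ b a ∪ S₁) ∩ D ⊆ segment ℝ b w := by
  have hbw := h₁.ne
  obtain ⟨y, hy, hyb, hyD⟩ := exists_mem_segment_notMem hkw hka hkc
    (hf w (Or.inr h₂.ends_mem.2) hbw.symm) hR.isClosed h₂.isCompact.isClosed hb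
    (fun x hx => map_sub_neg_of_mem_convexHull_insert hf x (hR.subset_hull hx)) hR.isOpen
  have hyw : y ≠ w := fun e =>
    hyD (hR.boundary_subset (Or.inr (e ▸ right_mem_segment ℝ b y)))
  -- The arc without its ends is connected, misses the boundary of `D`, and contains the point `y`
  -- outside `D`.
  have hdis := h₁.isPreconnected_diff.2.2.disjoint_of_frontier hR.isClosed hR.isOpen
    (by
      rw [disjoint_left]
      rintro x ⟨hx1, hx2⟩ (hx | hx)
      · exact hx2 (hA ⟨hx1, hx⟩)
      · exact hx2 (hd ⟨hx1, hx⟩)) ⟨Or.inl hy, by simp [hyb, hyw]⟩ hyD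
  rintro x ⟨hx1, hx2⟩
  by_contra hx
  refine disjoint_left.1 hdis ⟨hx1, ?_⟩ hx2
  rintro (rfl | rfl)
  · exact hx (left_mem_segment _ _ _)
  · exact hx (right_mem_segment _ _ _)

end Chord

section Induction

variable {E : Type*} [NormedAddCommGroup E] [NormedSpace ℝ E]
  {F : E → EuclideanSpace ℝ (Fin 3)} {f : E →L[ℝ] ℝ} {a b c : E} {V S Q D : Set E}

/-- The ear is glued along `ac` to the region of the polygon with `b` removed. That region lies in
the convex hull of `V`, so `b`, and with it the path from `a` to `c` through `b`, stays outside. -/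
theorem isSweptRegion_of_ear [FiniteDimensional ℝ E] (hE : Module.finrank ℝ E = 2)
    (hF : IsPLOn F Q) (hinj : InjOn F Q) (hQ : Convex ℝ Q)
    (h : PolyArc a c V S) (hLI : LinearIndependent ℝ ![a - b, c - b])
    (hVQ : insert b V ⊆ Q) (ha : segment ℝ b a ∩ S ⊆ {a}) (hc : segment ℝ b c ∩ S ⊆ {c})
    (hT : S ∩ convexHull ℝ {b, a, c} ⊆ {a, c}) (hbV : b ∉ convexHull ℝ V)
    (hR : IsSweptRegion F V (S ∪ segment ℝ a c) D) :
    IsSweptRegion F (insert b V) (segment ℝ b a ∪ segment ℝ b c ∪ S)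
      (convexHull ℝ {b, a, c} ∪ D) := by
  have hTQ : convexHull ℝ {b, a, c} ⊆ Q := convexHull_min (by
    rintro x (rfl | rfl | rfl)
    · exact hVQ (mem_insert _ _)
    · exact hVQ (Or.inr h.ends_mem.1)
    · exact hVQ (Or.inr h.ends_mem.2)) hQ
  have hDQ : D ⊆ Q := hR.subset_hull.trans (convexHull_min ((subset_insert _ _).trans hVQ) hQ)
  have hR₁ := (hF.isTameTriangle hinj hLI hTQ).isSweptRegion hE hLI
  have hba : b ≠ a := by
    rintro rfl
    exact hLI.ne_zero 0 (by simp)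
  have hbc : b ≠ c := by
    rintro rfl
    exact hLI.ne_zero 1 (by simp)
  have hi := segment_inter_segment_of_linearIndependent hLI
  have hia := segment_inter_segment_of_linearIndependent (linearIndependent_triangle_rotate hLI)
  have hic := segment_inter_segment_of_linearIndependent (linearIndependent_triangle_swap hLI)
  have hsT : segment ℝ a c ⊆ convexHull ℝ {b, a, c} :=
    (convex_convexHull ℝ _).segment_subset (subset_convexHull ℝ _ (by simp))
      (subset_convexHull ℝ _ (by simp))
  have hA₁ : PolyArc a c ({a, b} ∪ {b, c}) (segment ℝ b a ∪ segment ℝ b c) := by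
    rw [segment_symm ℝ b a]
    exact .concat (.segment hba.symm) (.segment hbc) (by rwa [segment_symm ℝ a b])
  have hd₁ : (segment ℝ b a ∪ segment ℝ b c) ∩ segment ℝ a c ⊆ {a, c} := by
    rintro x ⟨hx | hx, hx'⟩
    · exact Or.inl (hia ⟨hx', segment_symm ℝ b a ▸ hx⟩)
    · exact Or.inr (hic ⟨segment_symm ℝ a c ▸ hx', segment_symm ℝ b c ▸ hx⟩)
  have hA : (segment ℝ b a ∪ segment ℝ b c) ∩ S ⊆ {a, c} := by
    rintro x ⟨hx | hx, hx'⟩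
    · exact Or.inl (ha ⟨hx, hx'⟩)
    · exact Or.inr (hc ⟨hx, hx'⟩)
  have hV₁ : ({b, a, c} : Set E) = {a, b} ∪ {b, c} := by
    ext; simp only [mem_union, mem_insert_iff, mem_singleton_iff]; tauto
  have hP₁ : segment ℝ b a ∪ segment ℝ a c ∪ segment ℝ c b =
      segment ℝ b a ∪ segment ℝ b c ∪ segment ℝ a c := by
    rw [segment_symm ℝ c b, union_right_comm]
  rw [hP₁, hV₁, ← hV₁] at hR₁
  have hac : {a, c} ⊆ segment ℝ a c :=
    pair_subset (left_mem_segment _ _ _) (right_mem_segment _ _ _)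
  have hdis := hA₁.isPreconnected_diff.2.2.disjoint_of_frontier hR.isClosed hR.isOpen
    (by
      rw [disjoint_left]
      rintro x ⟨hx1, hx2⟩ (hx | hx)
      · exact hx2 (hA ⟨hx1, hx⟩)
      · exact hx2 (hd₁ ⟨hx1, hx⟩))
    (x := b) ⟨Or.inl (left_mem_segment _ _ _), by simp [hba, hbc]⟩
    (fun hb => hbV (hR.subset_hull hb))
  have := isSweptRegion_glue hE.ge hF.continuousOn hinj hA₁ h hA hd₁
    (fun x hx => hT ⟨hx.1, hsT hx.2⟩) (hV₁ ▸ hR₁) hR ?_ (hT.trans hac) hTQ hDQ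
  · convert this using 1
    ext x
    simp only [mem_union, mem_insert_iff, mem_singleton_iff]
    constructor
    · rintro (hx | hx)
      · exact Or.inl (Or.inl (Or.inr hx))
      · exact Or.inr hx
    · rintro (((rfl | rfl) | rfl | rfl) | hx)
      exacts [Or.inr h.ends_mem.1, Or.inl rfl, Or.inl rfl, Or.inr h.ends_mem.2, Or.inr hx]
  · rintro x ⟨hx1, hx2⟩
    by_contra hx
    exact disjoint_left.1 hdis ⟨hx1, fun hx' => hx (hac hx')⟩ hx2

/-- The diagonal splits the polygon into two loops, one without the vertex `c` and one without `a`,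
so the induction applies to both and their regions are glued along `bw`. -/
theorem exists_isSweptRegion_of_diagonal [FiniteDimensional ℝ E] (hE : Module.finrank ℝ E = 2)
    (hF : IsPLOn F Q) (hinj : InjOn F Q) (hQ : Convex ℝ Q)
    (h : PolyArc a c V S) (hLI : LinearIndependent ℝ ![a - b, c - b])
    (hVQ : insert b V ⊆ Q) (ha : segment ℝ b a ∩ S ⊆ {a}) (hc : segment ℝ b c ∩ S ⊆ {c})
    (hf : ∀ v ∈ V, f (v - b) < 0) (hbS : b ∉ S) {w : E} (hwV : w ∈ V) (hwa : w ≠ a) (hwc : w ≠ c)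
    (hwT : w ∈ convexHull ℝ {b, a, c}) (hw : segment ℝ b w ∩ S ⊆ {w})
    (IH : ∀ V' P, PolyLoop V' P → V' ⊂ insert b V → ∃ D, IsSweptRegion F V' P D) :
    ∃ D, IsSweptRegion F (insert b V) (segment ℝ b a ∪ segment ℝ b c ∪ S) D := by
  obtain ⟨α, γ, hv, ⟨h1, h2, h3, h4⟩, hmem, hba, hbc, hac⟩ := exists_barycentric hE hLI
  obtain ⟨V₁, V₂, S₁, S₂, hS₁, hS₂, hS, rfl, rfl⟩ := h.split hwV hwa hwc
  have hne_ba : b ≠ a := by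
    rintro rfl
    exact hLI.ne_zero 0 (by simp)
  have hne_bc : b ≠ c := by
    rintro rfl
    exact hLI.ne_zero 1 (by simp)
  have hwS : w ∈ S₁ ∪ S₂ := Or.inl hS₁.right_mem
  have hwT' := (hmem w).1 hwT
  have hαw : 0 < α (w - b) := hwT'.1.lt_of_ne' fun h0 =>
    hwc (hc ⟨(hbc w).2 ⟨hwT'.2.1, h0, by linarith [hwT'.2.2]⟩, hwS⟩)
  have hγw : 0 < γ (w - b) := hwT'.2.1.lt_of_ne' fun h0 =>
    hwa (ha ⟨(hba w).2 ⟨hwT'.1, h0, by linarith [hwT'.2.2]⟩, hwS⟩)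
  have hac := h.ne
  have hi := segment_inter_segment_of_linearIndependent hLI
  have hcS₁ : c ∉ S₁ := fun hx => hwc (hS ⟨hx, hS₂.right_mem⟩).symm
  have haS₂ : a ∉ S₂ := fun hx => hwa (hS ⟨hS₁.left_mem, hx⟩).symm
  have hA₁ : PolyArc b w ({b, a} ∪ V₁) (segment ℝ b a ∪ S₁) :=
    .concat (.segment hne_ba) hS₁ fun x hx => ha ⟨hx.1, Or.inl hx.2⟩
  have hA₂ : PolyArc b w ({b, c} ∪ V₂) (segment ℝ b c ∪ S₂) :=
    .concat (.segment hne_bc) hS₂.symm fun x hx => hc ⟨hx.1, Or.inr hx.2⟩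
  have hV₁ : {b, a} ∪ V₁ = insert b V₁ := by
    rw [insert_union, singleton_union, insert_eq_of_mem hS₁.ends_mem.1]
  have hV₂ : {b, c} ∪ V₂ = insert b V₂ := by
    rw [insert_union, singleton_union, insert_eq_of_mem hS₂.ends_mem.2]
  rw [hV₁] at hA₁
  rw [hV₂] at hA₂
  have hA : (segment ℝ b a ∪ S₁) ∩ (segment ℝ b c ∪ S₂) ⊆ {b, w} := by
    rintro x ⟨hx1 | hx1, hx2 | hx2⟩
    · exact Or.inl (hi ⟨hx1, hx2⟩)
    · obtain rfl : x = a := ha ⟨hx1, Or.inr hx2⟩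
      exact absurd hx2 haS₂
    · obtain rfl : x = c := hc ⟨hx2, Or.inl hx1⟩
      exact absurd hx1 hcS₁
    · exact Or.inr (hS ⟨hx1, hx2⟩)
  have hiw : ∀ x ∈ segment ℝ b w, (α (x - b) = 0 ∨ γ (x - b) = 0) → x = b := by
    rintro _ ⟨s, t, hs, ht, hst, rfl⟩ hx
    rw [α.map_combination_sub _ _ _ hst, γ.map_combination_sub _ _ _ hst, sub_self, map_zero,
      map_zero, mul_zero, zero_add, zero_add, mul_eq_zero, mul_eq_zero] at hx
    have ht0 : t = 0 := by
      rcases hx with (h | h) | (h | h)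
      exacts [h, absurd h hαw.ne', h, absurd h hγw.ne']
    rw [ht0, show s = 1 by linarith]
    simp
  have hd₁ : (segment ℝ b a ∪ S₁) ∩ segment ℝ b w ⊆ {b, w} := by
    rintro x ⟨hx1 | hx1, hx2⟩
    · exact Or.inl (hiw x hx2 (Or.inr ((hba x).1 hx1).2.1))
    · exact Or.inr (hw ⟨hx2, Or.inl hx1⟩)
  have hd₂ : (segment ℝ b c ∪ S₂) ∩ segment ℝ b w ⊆ {b, w} := by
    rintro x ⟨hx1 | hx1, hx2⟩
    · exact Or.inl (hiw x hx2 (Or.inl ((hbc x).1 hx1).2.1))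
    · exact Or.inr (hw ⟨hx2, Or.inr hx1⟩)
  have hsub₁ : insert b V₁ ⊆ insert b (V₁ ∪ V₂) := insert_subset_insert subset_union_left
  have hsub₂ : insert b V₂ ⊆ insert b (V₁ ∪ V₂) := insert_subset_insert subset_union_right
  obtain ⟨D₁, hD₁⟩ := IH _ _ (hA₁.polyLoop hd₁) ((ssubset_iff_of_subset hsub₁).2
    ⟨c, Or.inr (Or.inr hS₂.ends_mem.2), by
      rintro (e | e)
      exacts [hne_bc e.symm, hcS₁ (hS₁.vertices_subset e)]⟩)
  obtain ⟨D₂, hD₂⟩ := IH _ _ (hA₂.polyLoop hd₂) ((ssubset_iff_of_subset hsub₂).2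
    ⟨a, Or.inr (Or.inl hS₁.ends_mem.1), by
      rintro (e | e)
      exacts [hne_ba e.symm, haS₂ (hS₂.vertices_subset e)]⟩)
  -- A functional vanishing along the diagonal, with `a` on its positive and `c` on its negative
  -- side.
  obtain ⟨k, hk⟩ : ∃ k : E →L[ℝ] ℝ, ∀ v, k v = γ (w - b) * α v - α (w - b) * γ v :=
    ⟨γ (w - b) • α - α (w - b) • γ, fun v => rfl⟩
  have hkw : k (w - b) = 0 := by rw [hk]; ring
  have hka : 0 < k (a - b) := by rw [hk, h1, h2]; linarith
  have hkc : k (c - b) < 0 := by rw [hk, h3, h4]; linarith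
  have hf' : ∀ W ⊆ V₁ ∪ V₂, ∀ v ∈ insert b W, v ≠ b → f (v - b) < 0 := fun W hW v hv hvb =>
    hf v (hW (hv.resolve_left hvb))
  have hAD₁ := inter_subset_of_diagonal (k := k) hA₁ hS₂.symm (fun hb => hbS (Or.inr hb)) hne_ba hA hd₁
    (hf' V₂ subset_union_right) hkw hka hkc.le hD₂
  have hAD₂ := inter_subset_of_diagonal (k := -k) hA₂ hS₁ (fun hb => hbS (Or.inl hb)) hne_bc
    (inter_comm _ _ ▸ hA) hd₂ (hf' V₁ subset_union_left) (by rw [neg_apply, hkw, neg_zero])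
    (by rw [neg_apply]; linarith) (by rw [neg_apply]; linarith) hD₁
  have := isSweptRegion_glue hE.ge hF.continuousOn hinj hA₁ hA₂ hA hd₁ hd₂ hD₁ hD₂ hAD₁ hAD₂
    (hD₁.subset_hull.trans (convexHull_min (hsub₁.trans hVQ) hQ))
    (hD₂.subset_hull.trans (convexHull_min (hsub₂.trans hVQ) hQ))
  rw [← insert_union_distrib, union_union_union_comm] at this
  exact ⟨_, this⟩

end Induction

/-- Every polygon in the domain of an injective piecewise linear map of the plane bounds a region
across whose image it can be swept. -/
theorem exists_isSweptRegion {E : Type*} [NormedAddCommGroup E] [InnerProductSpace ℝ E]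
    (hE : Module.finrank ℝ E = 2) {F : E → EuclideanSpace ℝ (Fin 3)} {Q : Set E}
    (hF : IsPLOn F Q) (hinj : InjOn F Q) (hQ : Convex ℝ Q) {V P : Set E} (h : PolyLoop V P)
    (hVQ : V ⊆ Q) : ∃ D, IsSweptRegion F V P D := by
  have : FiniteDimensional ℝ E := Module.finite_of_finrank_pos (by omega)
  have hfin : ∀ V P : Set E, PolyLoop V P → V.Finite := by
    rintro _ _ ⟨a, b, V₁, V₂, S₁, S₂, h1, h2, -, rfl, -⟩
    exact h1.finite.union h2.finite
  obtain ⟨n, hn⟩ : ∃ n, n = V.ncard := ⟨_, rfl⟩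
  induction n using Nat.strong_induction_on generalizing V P with
  | _ n ih =>
  have IH : ∀ V' P', PolyLoop V' P' → V' ⊂ V → ∃ D, IsSweptRegion F V' P' D := fun V' P' h' hs =>
    ih _ (hn ▸ ncard_lt_ncard hs (hfin V P h)) h' (hs.subset.trans hVQ) rfl
  have hne : V.Nonempty := by
    obtain ⟨a, b, V₁, V₂, S₁, S₂, h1, h2, -, rfl, -⟩ := h
    exact ⟨a, Or.inl h1.ends_mem.1⟩
  obtain ⟨b, hb, f, hf⟩ := (hfin V P h).exists_extreme hne
  obtain ⟨a, c, W, S, hba, hbc, hS, hi, ha, hc, rfl, rfl⟩ := h.exists_neighbors hb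
  have hbS : b ∉ S := fun hx => hba (ha ⟨left_mem_segment _ _ _, hx⟩)
  have hbW : b ∉ W := fun hx => hbS (hS.vertices_subset hx)
  have hfW : ∀ v ∈ W, f (v - b) < 0 := fun v hv => hf v (Or.inr hv) fun e => hbW (e ▸ hv)
  have hLI := linearIndependent_of_segment_inter hba.symm (hfW a hS.ends_mem.1)
    (hfW c hS.ends_mem.2) hi
  by_cases hW : W = {a, c}
  · subst hW
    -- Having only two vertices does not by itself say that the arc is one edge: a further edge
    -- would need another vertex.
    have hSe : S = segment ℝ a c := by
      rcases hS.first_edge with h | ⟨p, V', S', hap, hS', hS'i, hV', rfl⟩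
      · exact h.2
      · exfalso
        have haS' : a ∉ S' := fun hx => hap (hS'i ⟨left_mem_segment _ _ _, hx⟩)
        have : V' ⊆ {c} := fun x hx => by
          have : x ∈ ({a, c} : Set E) := hV' ▸ Or.inr hx
          exact this.resolve_left fun e => haS' (e ▸ hS'.vertices_subset hx)
        exact hS'.ne (this hS'.ends_mem.1)
    subst hSe
    refine ⟨convexHull ℝ {b, a, c}, ?_⟩
    have := (hF.isTameTriangle hinj hLI (convexHull_min hVQ hQ)).isSweptRegion hE hLI
    rwa [segment_symm ℝ c b, union_right_comm] at this
  by_cases hT : S ∩ convexHull ℝ {b, a, c} ⊆ {a, c}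
  · obtain ⟨D, hD⟩ := IH W _ (hS.polyLoop fun x hx => hT ⟨hx.1,
      (convex_convexHull ℝ _).segment_subset (subset_convexHull ℝ _ (by simp))
        (subset_convexHull ℝ _ (by simp)) hx.2⟩) (ssubset_insert hbW)
    exact ⟨_, isSweptRegion_of_ear hE hF hinj hQ hS hLI hVQ ha hc hT (fun hx => by
      simpa using map_sub_neg_of_mem_convexHull hfW b hx) hD⟩
  · obtain ⟨x, ⟨hxS, hxT⟩, hx⟩ := not_subset.1 hT
    obtain ⟨w, hwV, hwa, hwc, hwT, hw⟩ := hS.exists_diagonal hE hLI ha hc hW hxS hxT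
      (fun e => hx (Or.inl e)) (fun e => hx (Or.inr e))
    exact exists_isSweptRegion_of_diagonal hE hF hinj hQ hS hLI hVQ ha hc hfW hbS hwV hwa hwc hwT
      hw IH

end LoopTheorem

/-! ### From piecewise linear curves to polygons -/

section Curve

variable {E : Type*} [NormedAddCommGroup E] [NormedSpace ℝ E] {γ : ℝ → E}

/-- A piecewise linear curve is affine between consecutive break points. -/
theorem IsPLOn.exists_breakpoints (h : IsPLOn γ (Icc (0 : ℝ) 1)) : ∃ B : Set ℝ, B.Finite ∧
    ∀ t t', 0 ≤ t → t < t' → t' ≤ 1 → B ∩ Ioo t t' = ∅ →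
      ∃ g : ℝ →ᵃ[ℝ] E, EqOn γ g (Icc t t') := by
  obtain ⟨K, hK, hKs, hg⟩ := h
  -- Break points are all vertices of the triangulation. The simplex containing the midpoint of `[t,
  -- t']` has no vertex inside, so it has vertices on both sides and contains the whole interval.
  refine ⟨⋃ s ∈ K.faces, (s : Set ℝ), hK.biUnion fun s _ => s.finite_toSet, ?_⟩
  intro t t' h0 htt h1 hB
  have hm : (t + t') / 2 ∈ K.space := by
    rw [hKs]
    constructor <;> linarith
  obtain ⟨s, hs, hms⟩ := Geometry.SimplicialComplex.mem_space_iff.1 hm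
  obtain ⟨g, hg⟩ := hg s hs
  refine ⟨g, hg.mono ?_⟩
  have hB' : ∀ x ∈ s, x ≤ t ∨ t' ≤ x := by
    intro x hx
    by_contra! hlt
    exact (Set.ext_iff.1 hB x).1 ⟨mem_iUnion₂.2 ⟨s, hs, hx⟩, hlt⟩
  have hlow : ∃ x ∈ s, x ≤ t := by
    by_contra! hlt
    have : (s : Set ℝ) ⊆ Ici t' := fun x hx => (hB' x hx).resolve_left (hlt x hx).not_ge
    have := convexHull_min this (convex_Ici t') hms
    rw [mem_Ici] at this
    linarith
  have hhigh : ∃ x ∈ s, t' ≤ x := by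
    by_contra! hlt
    have : (s : Set ℝ) ⊆ Iic t := fun x hx => (hB' x hx).resolve_right (hlt x hx).not_ge
    have := convexHull_min this (convex_Iic t) hms
    rw [mem_Iic] at this
    linarith
  obtain ⟨x, hx, hxt⟩ := hlow
  obtain ⟨y, hy, hyt⟩ := hhigh
  calc Icc t t' ⊆ Icc x y := Icc_subset_Icc hxt hyt
    _ = segment ℝ x y := (segment_eq_Icc (by linarith)).symm
    _ ⊆ convexHull ℝ (s : Set ℝ) := segment_subset_convexHull hx hy

/-- An injective piecewise linear path is a polygonal arc. -/
theorem exists_polyArc_of_injOn {B : Set ℝ} (hB : B.Finite)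
    (h : ∀ t t', 0 ≤ t → t < t' → t' ≤ 1 → B ∩ Ioo t t' = ∅ →
      ∃ g : ℝ →ᵃ[ℝ] E, EqOn γ g (Icc t t')) {t t' : ℝ} (h0 : 0 ≤ t) (htt : t < t') (h1 : t' ≤ 1)
    (hinj : InjOn γ (Icc t t')) : ∃ V, PolyArc (γ t) (γ t') V (γ '' Icc t t') := by
  obtain ⟨n, hn⟩ : ∃ n, n = (B ∩ Ioo t t').ncard := ⟨_, rfl⟩
  induction n using Nat.strong_induction_on generalizing t t' with
  | _ n ih =>
  rcases (B ∩ Ioo t t').eq_empty_or_nonempty with he | ⟨m, hmB, hm⟩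
  · obtain ⟨g, hg⟩ := h t t' h0 htt h1 he
    have hne : γ t ≠ γ t' := fun e =>
      htt.ne (hinj (left_mem_Icc.2 htt.le) (right_mem_Icc.2 htt.le) e)
    have himg : γ '' Icc t t' = segment ℝ (γ t) (γ t') := by
      rw [hg.image_eq, ← segment_eq_Icc htt.le, image_segment, hg (left_mem_Icc.2 htt.le),
        hg (right_mem_Icc.2 htt.le)]
    rw [himg]
    exact ⟨_, .segment hne⟩
  · have hlt : ∀ I : Set ℝ, I ⊆ Ioo t t' → m ∉ I → (B ∩ I).ncard < n := fun I hI hmI =>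
      hn ▸ ncard_lt_ncard ((ssubset_iff_of_subset (inter_subset_inter_right B hI)).2
        ⟨m, ⟨hmB, hm⟩, fun hx => hmI hx.2⟩) (hB.inter_of_left _)
    obtain ⟨V, hV⟩ := ih _ (hlt (Ioo t m) (Ioo_subset_Ioo_right hm.2.le) (by simp)) h0 hm.1
      (hm.2.le.trans h1) (hinj.mono (Icc_subset_Icc_right hm.2.le)) rfl
    obtain ⟨W, hW⟩ := ih _ (hlt (Ioo m t') (Ioo_subset_Ioo_left hm.1.le) (by simp))
      (h0.trans hm.1.le) hm.2 h1 (hinj.mono (Icc_subset_Icc_left hm.1.le)) rfl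
    have := hV.concat hW (by
      rintro _ ⟨⟨x, hx, rfl⟩, y, hy, e⟩
      obtain rfl : y = x := hinj ⟨hm.1.le.trans hy.1, hy.2⟩ ⟨hx.1, hx.2.trans hm.2.le⟩ e
      exact congrArg γ (le_antisymm hx.2 hy.1))
    rw [← image_union, Icc_union_Icc_eq_Icc hm.1.le hm.2.le] at this
    exact ⟨_, this⟩

/-- Some break point lies in `(0,1)`, since a single affine piece with equal ends would be constant.
Cutting at 0 and at this point gives the two arcs. -/
theorem IsPLSimpleClosedCurve.exists_polyLoop (hγ : IsPLSimpleClosedCurve γ) :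
    ∃ V, PolyLoop V (γ '' Icc (0 : ℝ) 1) := by
  obtain ⟨B, hB, h⟩ := hγ.pl.exists_breakpoints
  obtain ⟨m, -, hm⟩ : (B ∩ Ioo (0 : ℝ) 1).Nonempty := by
    rw [nonempty_iff_ne_empty]
    intro he
    obtain ⟨g, hg⟩ := h 0 1 le_rfl one_pos le_rfl he
    have e : g 0 = g 1 := by
      rw [← hg (left_mem_Icc.2 zero_le_one), ← hg (right_mem_Icc.2 zero_le_one), hγ.closed]
    have e2 : g (1 / 2) = g 0 := by
      have : (1 / 2 : ℝ) = AffineMap.lineMap 0 1 (1 / 2 : ℝ) := by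
        rw [AffineMap.lineMap_apply_module]; simp
      rw [this, AffineMap.apply_lineMap, ← e, AffineMap.lineMap_same_apply]
    have h2 : (1 / 2 : ℝ) ∈ Icc (0 : ℝ) 1 := ⟨by norm_num, by norm_num⟩
    have h3 : (0 : ℝ) ∈ Icc (0 : ℝ) 1 := ⟨le_rfl, zero_le_one⟩
    rw [← hg h2, ← hg h3] at e2
    have := hγ.simple (x₁ := 1 / 2) ⟨by norm_num, by norm_num⟩ ⟨le_rfl, one_pos⟩ e2
    norm_num at this
  have hend : ∀ x ∈ Icc m 1, γ x = γ 1 → x = 1 := by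
    intro x hx e
    by_contra hne
    rw [← hγ.closed] at e
    have := hγ.simple ⟨hm.1.le.trans hx.1, hx.2.lt_of_ne hne⟩ ⟨le_rfl, one_pos⟩ e
    linarith [hx.1, hm.1]
  obtain ⟨V, hV⟩ := exists_polyArc_of_injOn hB h le_rfl hm.1 hm.2.le
    (hγ.simple.mono (Icc_subset_Ico_right hm.2))
  obtain ⟨W, hW⟩ := exists_polyArc_of_injOn hB h hm.1.le hm.2 le_rfl (by
    intro x hx y hy e
    rcases hx.2.eq_or_lt with rfl | hx1
    · exact (hend y hy e.symm).symm
    rcases hy.2.eq_or_lt with rfl | hy1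
    · exact hend x hx e
    exact hγ.simple ⟨hm.1.le.trans hx.1, hx1⟩ ⟨hm.1.le.trans hy.1, hy1⟩ e)
  refine ⟨V ∪ W, _, _, V, W, _, _, hV, hγ.closed ▸ hW.symm, ?_, rfl, ?_⟩
  · rintro _ ⟨⟨x, hx, rfl⟩, y, hy, e⟩
    rcases hy.2.eq_or_lt with rfl | hy1
    · exact Or.inl (by rw [← e, hγ.closed])
    · obtain rfl : y = x := hγ.simple ⟨hm.1.le.trans hy.1, hy1⟩ ⟨hx.1, hx.2.trans_lt hm.2⟩ e
      exact Or.inr (congrArg γ (le_antisymm hx.2 hy.1))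
  · rw [← image_union, Icc_union_Icc_eq_Icc hm.1.le hm.2.le]

end Curve

theorem convex_unitSquare : Convex ℝ unitSquare := by
  intro x hx y hy s t hs ht hst i
  have := convex_Icc (0 : ℝ) 1 (hx i) (hy i) hs ht hst
  simpa using this

theorem PolyLoop.vertices_subset {E : Type*} [NormedAddCommGroup E] [NormedSpace ℝ E]
    {V P : Set E} (h : PolyLoop V P) : V ⊆ P := by
  obtain ⟨a, b, V₁, V₂, S₁, S₂, h1, h2, -, rfl, rfl⟩ := h
  exact union_subset_union h1.vertices_subset h2.vertices_subset

/-- An injective piecewise linear map from the unit square to three-space sends every piecewise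
linear simple closed curve in the square to an unknot. -/
theorem mainTheorem4
    (F : EuclideanSpace ℝ (Fin 2) → EuclideanSpace ℝ (Fin 3))
    (hF : IsPLOn F unitSquare) (hinj : Set.InjOn F unitSquare)
    (γ : ℝ → EuclideanSpace ℝ (Fin 2)) (hγ : IsPLSimpleClosedCurve γ)
    (hmem : Set.MapsTo γ (Set.Icc (0 : ℝ) 1) unitSquare) :
    IsUnknot (F '' (γ '' Set.Icc (0 : ℝ) 1)) := by
  obtain ⟨V, hV⟩ := hγ.exists_polyLoop
  obtain ⟨D, hD⟩ := exists_isSweptRegion (by simp) hF hinj convex_unitSquare hV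
    (hV.vertices_subset.trans hmem.image_subset)
  exact hD.unknot
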